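/- Let $E,U,V$ be real Banach spaces and let $E^{\otimes 2}$ be a completion of the algebraic tensor product $E\otimes E$ for a norm such that $(a,b)\mapsto a\otimes b$ is continuous and $L(E,L(E,V))$ embeds continuously in $L(E^{\otimes2},V)$. Let $2\le p<3$ and let $\mathbf X=(X_{ts},\mathbb X_{ts})_{0\le s\le t\le 1}$ be a $p$-rough path over $E$: $X_{ts}\in E$ and $\mathbb X_{ts}\in E^{\otimes 2}$ satisfy $X_{ts}=X_{tu}+X_{us}$ and $\mathbb X_{ts}=\mathbb X_{tu}+\mathbb X_{us}+X_{us}\otimes X_{tu}$ for $s\le u\le t$, and $|X_{ts}|\le C|t-s|^{1/p}$, $|\mathbb X_{ts}|\le C|t-s|^{2/p}$ for some constant $C$. For a Banach space $W$, let $\mathcal C_{\mathbf X}(W)$ be the space of pairs $(z,z')$, with $z:[0,1]\to W$ and $z':[0,1]\to L(E,W)$, such that $z'$ is $\frac1p$-Hölder and $R_{ts}:=z_t-z_s-z'_sX_{ts}$ satisfies $\sup_{s<t}|R_{ts}|/|t-s|^{2/p}<\infty$, with the norm $\|z'\|_{1/p}+\|R\|_{2/p}+|z_0|$, where $\|z'\|_{1/p}$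 is the sum of the supremum norm and the $\frac1p$-Hölder seminorm and $\|R\|_{2/p}$ is the above supremum. For $x_0\in V$, let $\mathcal C^{x_0}_{\mathbf X}(V)$ be the affine subspace of the pairs with $z_0=x_0$. Let $k\ge 3$ be a real number with integer part $[k]$, and write $k=m+\delta$ with $m\in\mathbb N$ and $0\le\delta\le1$. (If $k$ is not an integer, then $m=[k]$; if $k$ is an integer, both $(m,\delta)=(k,0)$ and $(m,\delta)=(k-1,1)$ are allowed, which covers the two usual conventions.) Let $\mathrm{Lip}_k(V,V)$ be the space of the $C^m$ maps $f:V\to V$ with finite norm $$\|f\|_k=\sum_{j=0}^m\sup_{x}\|f^{(j)}(x)\|+\sup_{x\ne y}\frac{\|f^{(m)}(x)-f^{(m)}(y)\|}{\|x-y\|^{\delta}},$$ and let $L(U,\mathrm{Lip}_k(V,V))$ carry the operator norm. For $F$ in this space and $x\in V$, write $F(x)\in L(U,V)$ for the map $u\mapsto F(u)(x)$. For $F\in L(U,\mathrm{Lip}_k(V,V))$, $y\in\mathcal C_{\mathbf X}(U)$ and $z\in\mathcal C_{\mathbf X}(V)$, the rough integral $\int_0^\bullet F(z_r)\,dy_r$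 is the unique path $w$ with $w_0=0$ for which there are $\zeta>1$ and $C$ such that, for all $0\le s\le t\le 1$, $$\bigl|w_t-w_s-F(z_s)(y_t-y_s)-(D_{z_s}F)(z'_s\otimes y'_s)\,\mathbb X_{ts}\bigr|\le C|t-s|^\zeta .$$ A controlled path $(x,x')\in\mathcal C_{\mathbf X}(V)$ solves $$x_\bullet=x_0+\int_0^\bullet F(x_r)\,dy_r \qquad (*)$$ if this identity holds and $x'_t=F(x_t)y'_t$ for all $t\in[0,1]$. **Theorem.** Fix $x_0\in V$. For all $F\in L(U,\mathrm{Lip}_k(V,V))$ and $y\in\mathcal C_{\mathbf X}(U)$, equation $(*)$ has exactly one solution $\mathfrak I(F,y)$ in $\mathcal C_{\mathbf X}(V)$, it belongs to $\mathcal C^{x_0}_{\mathbf X}(V)$, and the Itô–Lyons solution map $$\mathfrak I: L\bigl(U,\mathrm{Lip}_k(V,V)\bigr)\times\mathcal C_{\mathbf X}(U)\to\mathcal C^{x_0}_{\mathbf X}(V)\subset\mathcal C_{\mathbf X}(V)$$ is of class $C^{[k]-2}$ in the sense of Fréchet. -/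

import Mathlib

open Set

noncomputable section

namespace ItoLyons

/-! ### Suprema of bounded families -/

/-- The family `f` is bounded in norm. -/
def BddFam {ι G : Type*} [NormedAddCommGroup G] (f : ι → G) : Prop :=
  ∃ C : ℝ, ∀ i, ‖f i‖ ≤ C

/-- `sup_i ‖f i‖`; it is only used for bounded families. -/
def supNorm {ι G : Type*} [NormedAddCommGroup G] (f : ι → G) : ℝ := ⨆ i, ‖f i‖

section SupNorm

variable {ι G : Type*} [NormedAddCommGroup G]

theorem BddFam.bddAbove {f : ι → G} (hf : BddFam f) : BddAbove (range fun i => ‖f i‖) := by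
  obtain ⟨C, hC⟩ := hf
  exact ⟨C, by rintro _ ⟨i, rfl⟩; exact hC i⟩

theorem BddFam.zero : BddFam (0 : ι → G) := ⟨0, fun i => by simp⟩

theorem BddFam.add {f g : ι → G} (hf : BddFam f) (hg : BddFam g) : BddFam (f + g) := by
  obtain ⟨C, hC⟩ := hf
  obtain ⟨D, hD⟩ := hg
  exact ⟨C + D, fun i => (norm_add_le _ _).trans (add_le_add (hC i) (hD i))⟩

theorem BddFam.smul [NormedSpace ℝ G] {f : ι → G} (c : ℝ) (hf : BddFam f) : BddFam (c • f) := by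
  obtain ⟨C, hC⟩ := hf
  refine ⟨‖c‖ * C, fun i => ?_⟩
  rw [Pi.smul_apply, norm_smul]
  exact mul_le_mul_of_nonneg_left (hC i) (norm_nonneg c)

theorem le_supNorm {f : ι → G} (hf : BddFam f) (i : ι) : ‖f i‖ ≤ supNorm f :=
  le_ciSup hf.bddAbove i

theorem supNorm_nonneg (f : ι → G) : 0 ≤ supNorm f := Real.iSup_nonneg fun _ => norm_nonneg _

theorem supNorm_add_le {f g : ι → G} (hf : BddFam f) (hg : BddFam g) :
    supNorm (f + g) ≤ supNorm f + supNorm g :=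
  Real.iSup_le (fun i => (norm_add_le _ _).trans (add_le_add (le_supNorm hf i) (le_supNorm hg i)))
    (add_nonneg (supNorm_nonneg f) (supNorm_nonneg g))

theorem supNorm_smul [NormedSpace ℝ G] (c : ℝ) (f : ι → G) :
    supNorm (c • f) = ‖c‖ * supNorm f := by
  unfold supNorm
  rw [Real.mul_iSup_of_nonneg (norm_nonneg c)]
  exact iSup_congr fun i => norm_smul _ _

theorem eq_zero_of_supNorm {f : ι → G} (hf : BddFam f) (h : supNorm f = 0) (i : ι) : f i = 0 :=
  norm_le_zero_iff.1 (h ▸ le_supNorm hf i)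

end SupNorm

/-! ### Lipschitz functions in the sense of Stein -/

section Lip

variable {V W : Type*} [NormedAddCommGroup V] [NormedSpace ℝ V]
  [NormedAddCommGroup W] [NormedSpace ℝ W]

/-- The difference quotients `(f^(m)(x) - f^(m)(y)) / ‖x - y‖ ^ δ`. -/
def topQuotient (m : ℕ) (δ : ℝ) (f : V → W) : V × V → (V [×m]→L[ℝ] W) := fun q =>
  (‖q.1 - q.2‖ ^ δ)⁻¹ • (iteratedFDeriv ℝ m f q.1 - iteratedFDeriv ℝ m f q.2)

theorem iteratedFDeriv_add_fun {m j : ℕ} (hj : j ≤ m) {f g : V → W} (hf : ContDiff ℝ m f)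
    (hg : ContDiff ℝ m g) :
    iteratedFDeriv ℝ j (f + g) = iteratedFDeriv ℝ j f + iteratedFDeriv ℝ j g := by
  have hj' : ((j : ℕ) : WithTop ℕ∞) ≤ m := by exact_mod_cast hj
  exact iteratedFDeriv_add (hf.of_le hj') (hg.of_le hj')

theorem iteratedFDeriv_smul_fun {m j : ℕ} (hj : j ≤ m) (c : ℝ) {f : V → W}
    (hf : ContDiff ℝ m f) : iteratedFDeriv ℝ j (c • f) = c • iteratedFDeriv ℝ j f := by
  have hj' : ((j : ℕ) : WithTop ℕ∞) ≤ m := by exact_mod_cast hj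
  funext x
  exact iteratedFDeriv_const_smul_apply (hf.of_le hj').contDiffAt

theorem topQuotient_add (m : ℕ) (δ : ℝ) {f g : V → W} (hf : ContDiff ℝ m f)
    (hg : ContDiff ℝ m g) :
    topQuotient m δ (f + g) = topQuotient m δ f + topQuotient m δ g := by
  funext q
  simp only [topQuotient, iteratedFDeriv_add_fun le_rfl hf hg, Pi.add_apply, ← smul_add]
  congr 1
  abel

theorem topQuotient_smul (m : ℕ) (δ : ℝ) (c : ℝ) {f : V → W} (hf : ContDiff ℝ m f) :
    topQuotient m δ (c • f) = c • topQuotient m δ f := by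
  funext q
  simp only [topQuotient, iteratedFDeriv_smul_fun le_rfl c hf, Pi.smul_apply, ← smul_sub]
  rw [smul_comm]

variable (V W) in
/-- Functions of class `C^m` whose derivatives of order `0, …, m` are all bounded, the last one
being moreover `δ`-Hölder. -/
def lipSubmodule (m : ℕ) (δ : ℝ) : Submodule ℝ (V → W) where
  carrier := {f | ContDiff ℝ m f ∧ (∀ j ≤ m, BddFam (iteratedFDeriv ℝ j f)) ∧
    BddFam (topQuotient m δ f)}
  zero_mem' := by
    refine ⟨contDiff_const, fun j _ => ⟨0, fun x => ?_⟩, ⟨0, fun q => ?_⟩⟩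
    · rw [show iteratedFDeriv ℝ j (0 : V → W) = 0 from iteratedFDeriv_fun_zero]
      simp
    · rw [topQuotient, show iteratedFDeriv ℝ m (0 : V → W) = 0 from iteratedFDeriv_fun_zero]
      simp
  add_mem' := by
    rintro f g ⟨hf, hfb, hfq⟩ ⟨hg, hgb, hgq⟩
    refine ⟨hf.add hg, fun j hj => ?_, ?_⟩
    · rw [iteratedFDeriv_add_fun hj hf hg]
      exact (hfb j hj).add (hgb j hj)
    · rw [topQuotient_add m δ hf hg]
      exact hfq.add hgq
  smul_mem' := by
    rintro c f ⟨hf, hfb, hfq⟩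
    refine ⟨contDiff_const.smul hf, fun j hj => ?_, ?_⟩
    · rw [iteratedFDeriv_smul_fun hj c hf]
      exact (hfb j hj).smul c
    · rw [topQuotient_smul m δ c hf]
      exact hfq.smul c

variable (V W) in
/-- The space `Lip_k(V, W)` for `k = m + δ`. If `k` is not an integer, then `0 ≤ δ ≤ 1` forces
`m = [k]`. If `k` is an integer, then `m = k`, `δ = 0` gives the bounded `C^k` functions with
bounded derivatives, and `m = k - 1`, `δ = 1` gives the larger space of functions whose
derivatives up to order `k - 1` are bounded, the last one being Lipschitz. -/
def LipMap (m : ℕ) (δ : ℝ) : Type _ := ↥(lipSubmodule V W m δ)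

namespace LipMap

variable {m : ℕ} {δ : ℝ}

instance : AddCommGroup (LipMap V W m δ) := inferInstanceAs (AddCommGroup ↥(lipSubmodule V W m δ))

instance : Module ℝ (LipMap V W m δ) := inferInstanceAs (Module ℝ ↥(lipSubmodule V W m δ))

/-- The underlying function. -/
def fn (f : LipMap V W m δ) : V → W := f.1

theorem fn_add (f g : LipMap V W m δ) : (f + g).fn = f.fn + g.fn := rfl

theorem fn_smul (c : ℝ) (f : LipMap V W m δ) : (c • f).fn = c • f.fn := rfl

theorem contDiff_fn (f : LipMap V W m δ) : ContDiff ℝ m f.fn := f.2.1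

theorem bdd_deriv (f : LipMap V W m δ) {j : ℕ} (hj : j ≤ m) : BddFam (iteratedFDeriv ℝ j f.fn) :=
  f.2.2.1 j hj

theorem bdd_quotient (f : LipMap V W m δ) : BddFam (topQuotient m δ f.fn) := f.2.2.2

instance : Norm (LipMap V W m δ) where
  norm f := ∑ j ∈ Finset.range (m + 1), supNorm (iteratedFDeriv ℝ j f.fn)
    + supNorm (topQuotient m δ f.fn)

theorem norm_def (f : LipMap V W m δ) :
    ‖f‖ = ∑ j ∈ Finset.range (m + 1), supNorm (iteratedFDeriv ℝ j f.fn)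
      + supNorm (topQuotient m δ f.fn) := rfl

theorem norm_fn_le (f : LipMap V W m δ) (x : V) : ‖f.fn x‖ ≤ ‖f‖ := by
  have h1 : ‖f.fn x‖ ≤ supNorm (iteratedFDeriv ℝ 0 f.fn) := by
    have := le_supNorm (f.bdd_deriv (Nat.zero_le m)) x
    rwa [norm_iteratedFDeriv_zero] at this
  have h2 : supNorm (iteratedFDeriv ℝ 0 f.fn) ≤
      ∑ j ∈ Finset.range (m + 1), supNorm (iteratedFDeriv ℝ j f.fn) :=
    Finset.single_le_sum (f := fun j => supNorm (iteratedFDeriv ℝ j f.fn))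
      (fun j _ => supNorm_nonneg _) (Finset.mem_range.2 (Nat.succ_pos m))
  have h3 := supNorm_nonneg (topQuotient m δ f.fn)
  rw [norm_def]
  linarith

theorem core : NormedSpace.Core ℝ (LipMap V W m δ) where
  norm_nonneg f := add_nonneg (Finset.sum_nonneg fun _ _ => supNorm_nonneg _) (supNorm_nonneg _)
  norm_smul c f := by
    rw [norm_def, norm_def, mul_add, Finset.mul_sum, fn_smul,
      topQuotient_smul m δ c f.contDiff_fn, supNorm_smul]
    congr 1
    refine Finset.sum_congr rfl fun j hj => ?_
    rw [iteratedFDeriv_smul_fun (Nat.lt_succ_iff.1 (Finset.mem_range.1 hj)) c f.contDiff_fn,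
      supNorm_smul]
  norm_triangle f g := by
    have h1 : ∑ j ∈ Finset.range (m + 1), supNorm (iteratedFDeriv ℝ j (f + g).fn) ≤
        ∑ j ∈ Finset.range (m + 1), supNorm (iteratedFDeriv ℝ j f.fn) +
        ∑ j ∈ Finset.range (m + 1), supNorm (iteratedFDeriv ℝ j g.fn) := by
      rw [← Finset.sum_add_distrib]
      refine Finset.sum_le_sum fun j hj => ?_
      have hj' : j ≤ m := Nat.lt_succ_iff.1 (Finset.mem_range.1 hj)
      rw [fn_add, iteratedFDeriv_add_fun hj' f.contDiff_fn g.contDiff_fn]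
      exact supNorm_add_le (f.bdd_deriv hj') (g.bdd_deriv hj')
    have h2 : supNorm (topQuotient m δ (f + g).fn) ≤
        supNorm (topQuotient m δ f.fn) + supNorm (topQuotient m δ g.fn) := by
      rw [fn_add, topQuotient_add m δ f.contDiff_fn g.contDiff_fn]
      exact supNorm_add_le f.bdd_quotient g.bdd_quotient
    rw [norm_def, norm_def, norm_def]
    linarith
  norm_eq_zero_iff f := by
    constructor
    · intro h
      refine Subtype.ext (funext fun x => ?_)
      exact norm_le_zero_iff.1 (h ▸ norm_fn_le f x)
    · rintro rfl
      have h0 : (0 : LipMap V W m δ).fn = (0 : ℝ) • (0 : LipMap V W m δ).fn := by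
        rw [zero_smul]; rfl
      have hc := (0 : LipMap V W m δ).contDiff_fn
      rw [norm_def, h0, topQuotient_smul m δ 0 hc, supNorm_smul, norm_zero, zero_mul, add_zero]
      refine Finset.sum_eq_zero fun j hj => ?_
      rw [iteratedFDeriv_smul_fun (Nat.lt_succ_iff.1 (Finset.mem_range.1 hj)) 0 hc,
        supNorm_smul, norm_zero, zero_mul]

instance : NormedAddCommGroup (LipMap V W m δ) := NormedAddCommGroup.ofCore core

instance : NormedSpace ℝ (LipMap V W m δ) := NormedSpace.ofCore core

/-- Evaluation at the point `x`. -/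
def evalAt (x : V) : LipMap V W m δ →L[ℝ] W :=
  LinearMap.mkContinuous
    { toFun := fun f => f.fn x
      map_add' := fun _ _ => rfl
      map_smul' := fun _ _ => rfl } 1 (fun f => by
      rw [one_mul]
      exact norm_fn_le f x)

end LipMap

end Lip

/-! ### Tensor squares and rough paths -/

/-- `E2` is a completion of the algebraic tensor product `E ⊗ E` for a norm that makes the
bilinear map `(a, b) ↦ a ⊗ b` continuous. -/
structure TensorSquare (E E2 : Type*) [NormedAddCommGroup E] [NormedSpace ℝ E]
    [NormedAddCommGroup E2] [NormedSpace ℝ E2] where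
  tmul : E →L[ℝ] E →L[ℝ] E2
  injective_lift : Function.Injective (TensorProduct.lift tmul.toLinearMap₁₂)
  dense_lift : DenseRange (TensorProduct.lift tmul.toLinearMap₁₂)

/-- The continuous embedding of `L(E, L(E, H))` into `L(E2, H)` (it is unique if it exists). -/
structure TensorSquare.Extension {E E2 : Type*} [NormedAddCommGroup E] [NormedSpace ℝ E]
    [NormedAddCommGroup E2] [NormedSpace ℝ E2] (T : TensorSquare E E2)
    (H : Type*) [NormedAddCommGroup H] [NormedSpace ℝ H] where
  lift : (E →L[ℝ] E →L[ℝ] H) →L[ℝ] (E2 →L[ℝ] H)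
  lift_tmul : ∀ (B : E →L[ℝ] E →L[ℝ] H) (a b : E), lift B (T.tmul a b) = B a b

/-- A `p`-rough path over `E` on the time interval `[0, 1]`, for `2 ≤ p < 3`. The increments are
written `fst s t` for `X_{ts}` and `snd s t` for `𝕏_{ts}`; only their values for `s ≤ t` matter. -/
structure RoughPath {E E2 : Type*} [NormedAddCommGroup E] [NormedSpace ℝ E]
    [NormedAddCommGroup E2] [NormedSpace ℝ E2] (T : TensorSquare E E2) (p : ℝ) where
  fst : Icc (0 : ℝ) 1 → Icc (0 : ℝ) 1 → E
  snd : Icc (0 : ℝ) 1 → Icc (0 : ℝ) 1 → E2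
  fst_add : ∀ s u t, s ≤ u → u ≤ t → fst s t = fst u t + fst s u
  chen : ∀ s u t, s ≤ u → u ≤ t →
    snd s t = snd u t + snd s u + T.tmul (fst s u) (fst u t)
  fst_holder : ∃ C : ℝ, ∀ s t, s ≤ t → ‖fst s t‖ ≤ C * ((t : ℝ) - s) ^ (1 / p)
  snd_holder : ∃ C : ℝ, ∀ s t, s ≤ t → ‖snd s t‖ ≤ C * ((t : ℝ) - s) ^ (2 / p)

/-! ### Controlled paths -/

section Controlled

variable {E E2 : Type*} [NormedAddCommGroup E] [NormedSpace ℝ E]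
  [NormedAddCommGroup E2] [NormedSpace ℝ E2] {T : TensorSquare E E2} {p : ℝ}
  (X : RoughPath T p)
  (V : Type*) [NormedAddCommGroup V] [NormedSpace ℝ V]

/-- The difference quotients `(z'_t - z'_s) / |t - s| ^ (1/p)`. -/
def derivQuotient (p : ℝ) {V : Type*} [NormedAddCommGroup V] [NormedSpace ℝ V]
    (z : (Icc (0 : ℝ) 1 → V) × (Icc (0 : ℝ) 1 → E →L[ℝ] V)) :
    Icc (0 : ℝ) 1 × Icc (0 : ℝ) 1 → (E →L[ℝ] V) := fun q =>
  (|(q.2 : ℝ) - q.1| ^ (1 / p))⁻¹ • (z.2 q.2 - z.2 q.1)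

/-- The quotients `R_{ts} / (t - s) ^ (2/p)` for `s ≤ t`, where
`R_{ts} = z_t - z_s - z'_s X_{ts}`. -/
def remQuotient (X : RoughPath T p) {V : Type*} [NormedAddCommGroup V] [NormedSpace ℝ V]
    (z : (Icc (0 : ℝ) 1 → V) × (Icc (0 : ℝ) 1 → E →L[ℝ] V)) :
    {q : Icc (0 : ℝ) 1 × Icc (0 : ℝ) 1 // q.1 ≤ q.2} → V := fun q =>
  (((q.1.2 : ℝ) - q.1.1) ^ (2 / p))⁻¹ •
    (z.1 q.1.2 - z.1 q.1.1 - z.2 q.1.1 (X.fst q.1.1 q.1.2))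

variable {V} in
theorem derivQuotient_add (z w : (Icc (0 : ℝ) 1 → V) × (Icc (0 : ℝ) 1 → E →L[ℝ] V)) :
    derivQuotient p (z + w) = derivQuotient p z + derivQuotient p w := by
  funext q
  simp only [derivQuotient, Prod.snd_add, Pi.add_apply, ← smul_add]
  congr 1
  abel

variable {V} in
theorem derivQuotient_smul (c : ℝ) (z : (Icc (0 : ℝ) 1 → V) × (Icc (0 : ℝ) 1 → E →L[ℝ] V)) :
    derivQuotient p (c • z) = c • derivQuotient p z := by
  funext q
  simp only [derivQuotient, Prod.smul_snd, Pi.smul_apply, ← smul_sub]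
  rw [smul_comm]

variable {V} in
theorem remQuotient_add (z w : (Icc (0 : ℝ) 1 → V) × (Icc (0 : ℝ) 1 → E →L[ℝ] V)) :
    remQuotient X (z + w) = remQuotient X z + remQuotient X w := by
  funext q
  simp only [remQuotient, Prod.snd_add, Prod.fst_add, Pi.add_apply, ← smul_add,
    add_apply]
  congr 1
  abel

variable {V} in
theorem remQuotient_smul (c : ℝ) (z : (Icc (0 : ℝ) 1 → V) × (Icc (0 : ℝ) 1 → E →L[ℝ] V)) :
    remQuotient X (c • z) = c • remQuotient X z := by
  funext q
  simp only [remQuotient, Prod.smul_snd, Prod.smul_fst, Pi.smul_apply, ← smul_sub,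
    smul_apply]
  rw [smul_comm]

/-- Pairs `(z, z')` such that `z'` is bounded and `1/p`-Hölder, and
`R_{ts} = z_t - z_s - z'_s X_{ts}` is bounded by a multiple of `(t - s) ^ (2/p)`. -/
def controlledSubmodule : Submodule ℝ ((Icc (0 : ℝ) 1 → V) × (Icc (0 : ℝ) 1 → E →L[ℝ] V)) where
  carrier := {z | BddFam z.2 ∧ BddFam (derivQuotient p z) ∧ BddFam (remQuotient X z)}
  zero_mem' := ⟨BddFam.zero, ⟨0, fun q => by simp [derivQuotient]⟩,
    ⟨0, fun q => by simp [remQuotient]⟩⟩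
  add_mem' := by
    rintro z w ⟨h1, h2, h3⟩ ⟨k1, k2, k3⟩
    refine ⟨h1.add k1, ?_, ?_⟩
    · rw [derivQuotient_add]
      exact h2.add k2
    · rw [remQuotient_add]
      exact h3.add k3
  smul_mem' := by
    rintro c z ⟨h1, h2, h3⟩
    refine ⟨h1.smul c, ?_, ?_⟩
    · rw [derivQuotient_smul]
      exact h2.smul c
    · rw [remQuotient_smul]
      exact h3.smul c

/-- The space of `V`-valued paths controlled by `X`. -/
def ControlledPath : Type _ := ↥(controlledSubmodule X V)

namespace ControlledPath

variable {X V}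

instance : AddCommGroup (ControlledPath X V) :=
  inferInstanceAs (AddCommGroup ↥(controlledSubmodule X V))

instance : Module ℝ (ControlledPath X V) := inferInstanceAs (Module ℝ ↥(controlledSubmodule X V))

/-- The path `z` of the pair `(z, z')`. -/
def path (z : ControlledPath X V) : Icc (0 : ℝ) 1 → V := z.1.1

/-- The derivative `z'` of the pair `(z, z')`. -/
def der (z : ControlledPath X V) : Icc (0 : ℝ) 1 → E →L[ℝ] V := z.1.2

/-- The norm `‖z'‖_{1/p} + ‖R‖_{2/p} + |z_0|`. -/
instance : Norm (ControlledPath X V) where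
  norm z := (supNorm z.der + supNorm (derivQuotient p z.1)) + supNorm (remQuotient X z.1)
    + ‖z.path 0‖

theorem norm_def (z : ControlledPath X V) :
    ‖z‖ = (supNorm z.der + supNorm (derivQuotient p z.1)) + supNorm (remQuotient X z.1)
      + ‖z.path 0‖ := rfl

theorem eq_zero_of_norm {z : ControlledPath X V} (h : ‖z‖ = 0) : z = 0 := by
  have h1 := supNorm_nonneg z.der
  have h2 := supNorm_nonneg (derivQuotient p z.1)
  have h3 := supNorm_nonneg (remQuotient X z.1)
  have h4 := norm_nonneg (z.path 0)
  rw [norm_def] at h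
  have hder : ∀ s, z.1.2 s = 0 := eq_zero_of_supNorm (f := z.1.2) z.2.1
    (by change supNorm z.der = 0; linarith)
  have hrem := eq_zero_of_supNorm z.2.2.2 (by linarith : supNorm (remQuotient X z.1) = 0)
  have h0 : z.1.1 0 = 0 := norm_eq_zero.1 (by change ‖z.path 0‖ = 0; linarith)
  refine Subtype.ext (Prod.ext (funext fun t => ?_) (funext hder))
  change z.1.1 t = 0
  by_cases ht : t = 0
  · rw [ht, h0]
  · have htpos : (0 : ℝ) < (t : ℝ) :=
      lt_of_le_of_ne t.2.1 fun hh => ht (Subtype.ext hh.symm)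
    have hq := hrem ⟨(0, t), t.2.1⟩
    simp only [remQuotient, h0, hder, zero_apply, sub_zero] at hq
    rcases smul_eq_zero.1 hq with hq | hq
    · exact absurd hq (inv_ne_zero (Real.rpow_pos_of_pos (by simpa using htpos) _).ne')
    · exact hq

theorem core : NormedSpace.Core ℝ (ControlledPath X V) where
  norm_nonneg z := add_nonneg (add_nonneg (add_nonneg (supNorm_nonneg _) (supNorm_nonneg _))
    (supNorm_nonneg _)) (norm_nonneg _)
  norm_smul c z := by
    have h1 : supNorm (c • z).der = ‖c‖ * supNorm z.der := supNorm_smul c z.der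
    have h2 : supNorm (derivQuotient p (c • z).1) = ‖c‖ * supNorm (derivQuotient p z.1) := by
      rw [← supNorm_smul, ← derivQuotient_smul]; rfl
    have h3 : supNorm (remQuotient X (c • z).1) = ‖c‖ * supNorm (remQuotient X z.1) := by
      rw [← supNorm_smul, ← remQuotient_smul]; rfl
    have h4 : ‖(c • z).path 0‖ = ‖c‖ * ‖z.path 0‖ := norm_smul c (z.path 0)
    rw [norm_def, norm_def, h1, h2, h3, h4]
    ring
  norm_triangle z w := by
    have h1 : supNorm (z + w).der ≤ supNorm z.der + supNorm w.der := supNorm_add_le z.2.1 w.2.1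
    have h2 : supNorm (derivQuotient p (z + w).1) ≤
        supNorm (derivQuotient p z.1) + supNorm (derivQuotient p w.1) := by
      refine le_trans (le_of_eq ?_) (supNorm_add_le z.2.2.1 w.2.2.1)
      rw [← derivQuotient_add]; rfl
    have h3 : supNorm (remQuotient X (z + w).1) ≤
        supNorm (remQuotient X z.1) + supNorm (remQuotient X w.1) := by
      refine le_trans (le_of_eq ?_) (supNorm_add_le z.2.2.2 w.2.2.2)
      rw [← remQuotient_add]; rfl
    have h4 : ‖(z + w).path 0‖ ≤ ‖z.path 0‖ + ‖w.path 0‖ := norm_add_le _ _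
    rw [norm_def, norm_def, norm_def]
    linarith
  norm_eq_zero_iff z := by
    refine ⟨eq_zero_of_norm, ?_⟩
    rintro rfl
    have h1 : supNorm (0 : ControlledPath X V).der = 0 := by
      have := supNorm_smul (0 : ℝ) (0 : ControlledPath X V).der
      rwa [norm_zero, zero_mul, zero_smul] at this
    have h2 : supNorm (derivQuotient p (0 : ControlledPath X V).1) = 0 := by
      have := supNorm_smul (0 : ℝ) (derivQuotient p (0 : ControlledPath X V).1)
      rw [norm_zero, zero_mul, ← derivQuotient_smul, zero_smul] at this
      exact this
    have h3 : supNorm (remQuotient X (0 : ControlledPath X V).1) = 0 := by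
      have := supNorm_smul (0 : ℝ) (remQuotient X (0 : ControlledPath X V).1)
      rw [norm_zero, zero_mul, ← remQuotient_smul, zero_smul] at this
      exact this
    have h4 : ‖(0 : ControlledPath X V).path 0‖ = 0 := norm_zero
    rw [norm_def, h1, h2, h3, h4]
    simp

instance : NormedAddCommGroup (ControlledPath X V) := NormedAddCommGroup.ofCore core

instance : NormedSpace ℝ (ControlledPath X V) := NormedSpace.ofCore core

variable (X) in
/-- The affine subspace of the controlled paths started from `x₀`. -/
def startingAt (x₀ : V) : AffineSubspace ℝ (ControlledPath X V) where
  carrier := {z | z.path 0 = x₀}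
  smul_vsub_vadd_mem' c z₁ z₂ z₃ h₁ h₂ h₃ := by
    have h₁' : z₁.path 0 = x₀ := h₁
    have h₂' : z₂.path 0 = x₀ := h₂
    have h₃' : z₃.path 0 = x₀ := h₃
    change c • (z₁.path 0 - z₂.path 0) + z₃.path 0 = x₀
    rw [h₁', h₂', h₃', sub_self, smul_zero, zero_add]

end ControlledPath

end Controlled

/-! ### Rough integrals and rough differential equations -/

section Equation

variable {E E2 U V : Type*} [NormedAddCommGroup E] [NormedSpace ℝ E]
  [NormedAddCommGroup E2] [NormedSpace ℝ E2] [NormedAddCommGroup U] [NormedSpace ℝ U]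
  [NormedAddCommGroup V] [NormedSpace ℝ V] {T : TensorSquare E E2} {p : ℝ} {X : RoughPath T p}
  {m : ℕ} {δ : ℝ}

/-- A `V`-valued one-form `F` on `U`, seen as the map `x ↦ F(x)` from `V` to `L(U, V)`. -/
def formAt (F : U →L[ℝ] LipMap V V m δ) (x : V) : U →L[ℝ] V := (LipMap.evalAt x).comp F

/-- The almost additive map `F(z_s) y_{ts} + (D_{z_s} F)(z'_s ⊗ y'_s) 𝕏_{ts}`. -/
def germ (L : T.Extension V) (F : U →L[ℝ] LipMap V V m δ) (y : ControlledPath X U)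
    (z : ControlledPath X V) (s t : Icc (0 : ℝ) 1) : V :=
  formAt F (z.path s) (y.path t - y.path s) +
    L.lift ((fderiv ℝ (formAt F) (z.path s)).bilinearComp (z.der s) (y.der s)) (X.snd s t)

/-- `w` is the rough integral `∫_0^• F(z_u) dy_u`: it starts from `0` and its increments are
those of the germ up to `O(|t - s| ^ ζ)` for some `ζ > 1`. -/
def IsRoughIntegral (L : T.Extension V) (F : U →L[ℝ] LipMap V V m δ) (y : ControlledPath X U)
    (z : ControlledPath X V) (w : Icc (0 : ℝ) 1 → V) : Prop :=
  w 0 = 0 ∧ ∃ ζ : ℝ, 1 < ζ ∧ ∃ C : ℝ, ∀ s t : Icc (0 : ℝ) 1, s ≤ t →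
    ‖w t - w s - germ L F y z s t‖ ≤ C * ((t : ℝ) - s) ^ ζ

/-- The controlled path `x` solves `x_• = x₀ + ∫_0^• F(x_r) dy_r` in the space of controlled
paths: it is a fixed point of `(z, z') ↦ (x₀ + ∫_0^• F(z_r) dy_r, F(z_•) y'_•)`. -/
def IsSolution (L : T.Extension V) (x₀ : V) (F : U →L[ℝ] LipMap V V m δ)
    (y : ControlledPath X U) (x : ControlledPath X V) : Prop :=
  (∃ w : Icc (0 : ℝ) 1 → V, IsRoughIntegral L F y x w ∧ ∀ t, x.path t = x₀ + w t) ∧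
    ∀ t, x.der t = (formAt F (x.path t)).comp (y.der t)

end Equation

end ItoLyons

end

open Set

noncomputable section

namespace ItoLyons

/-! ### The sewing lemma -/

section Sewing

open Filter Topology

variable {W : Type*} [NormedAddCommGroup W]

/-! The integral is linear in its integrand and in `y`, and F(z) is linear in F. Write C(z) for the
bounded operator f ↦ f ∘ z. The equation then reads z = x₀ + A (C z), where A = A(F, y) is a bounded
linear operator depending bilinearly on the data (`isSolution_iff`). All the nonlinearity sits in
the single map C, which does not involve the data. Smooth dependence therefore reduces to smoothness
of C and to the implicit function theorem for z = v + A (C z) (`exists_contDiffAt_fixedPoint`).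

Smoothness of C is obtained at the cost of some Hölder regularity. Fix p < q < 3 and regard f ∘ z as
controlled at the larger roughness q. If w is close to z, then f ∘ w - f ∘ z is bounded at roughness
p and uniformly small, hence small at roughness q by interpolation (`exists_norm_relaxPath_le`),
uniformly over ‖f‖ ≤ 1. So C is continuous. The expected derivative of C is multiplication by the
same composition map evaluated on f'; it is continuous in operator norm, and every evaluation
functional of C is differentiable by the ordinary chain rule. A mean value inequality for each
functional making up the norm upgrades this to Fréchet differentiability, and induction gives C of
class C^n on functions whose derivative of order n + 1 is Lipschitz (`contDiff_compRelax`).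
Integration pays the loss back: since p ≥ 2 and q < 3, an integrand of roughness q gives an integral
of roughness p (`integral_bounds`). The integral itself comes from the sewing lemma, and Chen's
relation makes its germ almost additive (`intGerm_defect`).

If `y` has small seminorm, then A is small, and z ↦ x₀ + A (C z) contracts a seminorm ball, whatever
x₀ is (`exists_solvable`). For large `y`, time is cut in halves, each half is rescaled to [0, 1],
and the rough path is dilated so that its bound K is preserved. The dilation divides the seminorms
of all controlled paths by at least 2^(1/p). The smallness threshold depends on the rough path only
through K, so solving on the halves and concatenating multiplies the threshold by 2^(1/p)
(`Solvable.of_halves`), and repetition makes it arbitrarily large. Uniqueness below every threshold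
is global uniqueness, and concatenation is a continuous linear map, so it preserves smoothness
(`exists_solutionMap`).

Orders of differentiability: a Lipschitz derivative of order n + 2 means k = n + 3, and C is then of
class C^(n+1), that is C^([k]-2). The remaining values of k reduce to this case, because a bounded
derivative of order n + 3 makes the derivative of order n + 2 Lipschitz. -/

/-- The projection of `a` to the interval `[s, t]`. -/
def clamp (s t a : ℝ) : ℝ := max s (min a t)

/-- The Riemann sum of the germ `Ξ` over `[s, t]` along the dyadic grid of mesh `2⁻ⁿ`. -/
def dyadicSum (Ξ : ℝ → ℝ → W) (n : ℕ) (s t : ℝ) : W :=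
  ∑ k ∈ Finset.range (2 ^ n), Ξ (clamp s t (k / 2 ^ n)) (clamp s t ((k + 1 : ℕ) / 2 ^ n))

/-- The defect of additivity of `Ξ` is at most `C (t - s) ^ ζ`. -/
def AlmostAdditive (Ξ : ℝ → ℝ → W) (C ζ : ℝ) : Prop :=
  ∀ s u t, 0 ≤ s → s ≤ u → u ≤ t → t ≤ 1 → ‖Ξ s t - Ξ s u - Ξ u t‖ ≤ C * (t - s) ^ ζ

theorem le_clamp (s t a : ℝ) : s ≤ clamp s t a := le_max_left _ _

theorem clamp_le {s t : ℝ} (h : s ≤ t) (a : ℝ) : clamp s t a ≤ t := max_le h (min_le_right _ _)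

theorem clamp_mono (s t : ℝ) {a b : ℝ} (h : a ≤ b) : clamp s t a ≤ clamp s t b :=
  max_le_max le_rfl (min_le_min h le_rfl)

theorem clamp_sub_le (s t : ℝ) {a b : ℝ} (h : a ≤ b) : clamp s t b - clamp s t a ≤ b - a := by
  unfold clamp
  rcases le_total b t with h1 | h1 <;> rcases le_total a t with h2 | h2 <;>
    simp only [h1, h2, min_eq_left, min_eq_right] <;>
    rcases le_total s a with h3 | h3 <;> rcases le_total s b with h4 | h4 <;>
    rcases le_total s t with h5 | h5 <;>
    simp only [h3, h4, h5, max_eq_left, max_eq_right] <;> linarith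

theorem clamp_of_le {s t a : ℝ} (h : a ≤ s) : clamp s t a = s :=
  max_eq_left ((min_le_left _ _).trans h)

theorem clamp_of_ge {s t a : ℝ} (hst : s ≤ t) (h : t ≤ a) : clamp s t a = t := by
  rw [clamp, min_eq_right h, max_eq_right hst]

theorem sum_range_two_mul {A : Type*} [AddCommMonoid A] (f : ℕ → A) (N : ℕ) :
    ∑ k ∈ Finset.range (2 * N), f k = ∑ k ∈ Finset.range N, (f (2 * k) + f (2 * k + 1)) := by
  induction N with
  | zero => simp
  | succ N ih =>
    rw [Finset.sum_range_succ, ← ih, show 2 * (N + 1) = 2 * N + 1 + 1 by ring,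
      Finset.sum_range_succ, Finset.sum_range_succ, add_assoc]

/-- The defect of the triple (s, s, s) is -Ξ s s, and its bound contains 0 ^ ζ = 0. -/
theorem AlmostAdditive.self {Ξ : ℝ → ℝ → W} {C ζ : ℝ} (h : AlmostAdditive Ξ C ζ) (hζ : 1 < ζ)
    {s : ℝ} (h0 : 0 ≤ s) (h1 : s ≤ 1) : Ξ s s = 0 := by
  have := h s s s h0 le_rfl le_rfl h1
  rw [sub_self, sub_self, Real.zero_rpow (by linarith), mul_zero, zero_sub, norm_neg] at this
  exact norm_le_zero_iff.1 this

/-- A clamped cell has length d ≤ 2⁻ⁿ, so d ^ ζ ≤ 2 ^ (-n (ζ - 1)) d, and the lengths d telescope to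
t - s. -/
theorem sum_mesh_le {ζ : ℝ} (hζ : 1 < ζ) (n : ℕ) {s t : ℝ} (h0 : 0 ≤ s) (hst : s ≤ t)
    (h1 : t ≤ 1) :
    ∑ k ∈ Finset.range (2 ^ n),
      (clamp s t ((k + 1 : ℕ) / 2 ^ n) - clamp s t (k / 2 ^ n)) ^ ζ
      ≤ ((1 / 2 : ℝ) ^ (ζ - 1)) ^ n * (t - s) := by
  have hpow : ((1 / 2 : ℝ) ^ (ζ - 1)) ^ n = ((1 / 2 : ℝ) ^ n) ^ (ζ - 1) := by
    exact Real.rpow_pow_comm (by norm_num) _ _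
  have hterm : ∀ k ∈ Finset.range (2 ^ n),
      (clamp s t ((k + 1 : ℕ) / 2 ^ n) - clamp s t (k / 2 ^ n)) ^ ζ ≤
      ((1 / 2 : ℝ) ^ n) ^ (ζ - 1) *
        (clamp s t ((k + 1 : ℕ) / 2 ^ n) - clamp s t (k / 2 ^ n)) := by
    intro k _
    have hk : (k : ℝ) / 2 ^ n ≤ ((k + 1 : ℕ) : ℝ) / 2 ^ n := by
      gcongr
      simp
    have hd : 0 ≤ clamp s t ((k + 1 : ℕ) / 2 ^ n) - clamp s t (k / 2 ^ n) :=
      sub_nonneg.2 (clamp_mono s t hk)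
    have hd' : clamp s t ((k + 1 : ℕ) / 2 ^ n) - clamp s t (k / 2 ^ n) ≤ (1 / 2 : ℝ) ^ n := by
      refine (clamp_sub_le s t hk).trans (le_of_eq ?_)
      push_cast
      rw [div_pow, one_pow]
      ring
    rcases hd.eq_or_lt with hd0 | hd0
    · rw [← hd0, Real.zero_rpow (by linarith), mul_zero]
    · calc _ = (clamp s t ((k + 1 : ℕ) / 2 ^ n) - clamp s t (k / 2 ^ n)) ^ (ζ - 1) *
            (clamp s t ((k + 1 : ℕ) / 2 ^ n) - clamp s t (k / 2 ^ n)) := by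
              rw [← Real.rpow_add_one hd0.ne', sub_add_cancel]
        _ ≤ _ := by
              refine mul_le_mul_of_nonneg_right ?_ hd
              exact Real.rpow_le_rpow hd hd' (by linarith)
  refine (Finset.sum_le_sum hterm).trans (le_of_eq ?_)
  rw [← Finset.mul_sum, Finset.sum_range_sub fun k : ℕ => clamp s t ((k : ℝ) / 2 ^ n), hpow]
  congr 2
  · rw [clamp_of_ge hst]
    push_cast
    rwa [div_self (by positivity)]
  · rw [clamp_of_le]
    simpa using h0

/-- All intervals use the same grid of [0, 1], so only the cell around u has a nonzero defect; any
other cell is degenerate on one side of u. The bound is generous, but it tends to 0 with n, so the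
limit of the sums is exactly additive. -/
theorem AlmostAdditive.dyadicSum_add {Ξ : ℝ → ℝ → W} {C ζ : ℝ} (h : AlmostAdditive Ξ C ζ)
    (hC : 0 ≤ C) (hζ : 1 < ζ) (n : ℕ) {s u t : ℝ} (h0 : 0 ≤ s) (hsu : s ≤ u) (hut : u ≤ t)
    (h1 : t ≤ 1) :
    ‖dyadicSum Ξ n s t - dyadicSum Ξ n s u - dyadicSum Ξ n u t‖ ≤
      C * (((1 / 2 : ℝ) ^ (ζ - 1)) ^ n * (t - s)) := by
  have hst := hsu.trans hut
  refine le_trans ?_ (mul_le_mul_of_nonneg_left (sum_mesh_le hζ n h0 hst h1) hC)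
  rw [dyadicSum, dyadicSum, dyadicSum, ← Finset.sum_sub_distrib, ← Finset.sum_sub_distrib,
    Finset.mul_sum]
  refine norm_sum_le_of_le _ fun k _ => ?_
  have hk : (k : ℝ) / 2 ^ n ≤ ((k + 1 : ℕ) : ℝ) / 2 ^ n := by
    gcongr
    simp
  generalize (k : ℝ) / 2 ^ n = a at hk ⊢
  generalize ((k + 1 : ℕ) : ℝ) / 2 ^ n = b at hk ⊢
  have hpos : 0 ≤ C * (clamp s t b - clamp s t a) ^ ζ :=
    mul_nonneg hC (Real.rpow_nonneg (sub_nonneg.2 (clamp_mono s t hk)) _)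
  have huu : Ξ u u = 0 := h.self hζ (h0.trans hsu) (hut.trans h1)
  rcases le_total b u with hb | hb
  · have e : ∀ x ≤ u, clamp s u x = clamp s t x := fun x hx => by
      rw [clamp, clamp, min_eq_left hx, min_eq_left (hx.trans hut)]
    rw [e a (hk.trans hb), e b hb, clamp_of_le (hk.trans hb), clamp_of_le hb, huu]
    simpa using hpos
  rcases le_total u a with ha | ha
  · have e : ∀ x, u ≤ x → clamp u t x = clamp s t x := fun x hx => by
      rw [clamp, clamp, max_eq_right (le_min hx hut), max_eq_right (hsu.trans (le_min hx hut))]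
    rw [e a ha, e b (ha.trans hk), clamp_of_ge hsu ha, clamp_of_ge hsu (ha.trans hk), huu]
    simpa using hpos
  · have e1 : clamp s u a = clamp s t a := by
      rw [clamp, clamp, min_eq_left ha, min_eq_left (ha.trans hut)]
    have e2 : clamp u t b = clamp s t b := by
      rw [clamp, clamp, max_eq_right (le_min hb hut), max_eq_right (hsu.trans (le_min hb hut))]
    rw [e1, e2, clamp_of_ge hsu hb, clamp_of_le ha]
    refine h _ _ _ (h0.trans (le_clamp _ _ _)) ?_ ?_ ((clamp_le hst b).trans h1)
    · exact e1 ▸ clamp_le hsu a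
    · exact e2 ▸ le_clamp _ _ _

/-- Refining the grid splits each cell at its midpoint, so the change is a sum of one defect per
cell. -/
theorem AlmostAdditive.dyadicSum_succ {Ξ : ℝ → ℝ → W} {C ζ : ℝ} (h : AlmostAdditive Ξ C ζ)
    (hC : 0 ≤ C) (hζ : 1 < ζ) (n : ℕ) {s t : ℝ} (h0 : 0 ≤ s) (hst : s ≤ t) (h1 : t ≤ 1) :
    dist (dyadicSum Ξ n s t) (dyadicSum Ξ (n + 1) s t) ≤
      C * (t - s) * ((1 / 2 : ℝ) ^ (ζ - 1)) ^ n := by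
  have hr := mul_le_mul_of_nonneg_left (sum_mesh_le hζ n h0 hst h1) hC
  rw [mul_assoc, mul_comm (t - s)]
  refine le_trans ?_ hr
  rw [dist_eq_norm, dyadicSum, dyadicSum, pow_succ' 2 n, sum_range_two_mul,
    ← Finset.sum_sub_distrib, Finset.mul_sum]
  refine norm_sum_le_of_le _ fun k _ => ?_
  have ek : ∀ j : ℕ, ((2 * j : ℕ) : ℝ) / (2 * 2 ^ n) = j / 2 ^ n := fun j => by
    push_cast
    rw [mul_div_mul_left _ _ two_ne_zero]
  rw [show 2 * k + 1 + 1 = 2 * (k + 1) by ring, pow_succ' 2 n, ek, ek, ← sub_sub]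
  have hk1 : (k : ℝ) / 2 ^ n ≤ ((2 * k + 1 : ℕ) : ℝ) / (2 * 2 ^ n) := by
    rw [← ek]
    gcongr
    simp
  have hk2 : ((2 * k + 1 : ℕ) : ℝ) / (2 * 2 ^ n) ≤ ((k + 1 : ℕ) : ℝ) / 2 ^ n := by
    rw [← ek]
    gcongr
    omega
  exact h _ _ _ (h0.trans (le_clamp _ _ _)) (clamp_mono _ _ hk1) (clamp_mono _ _ hk2)
    ((clamp_le hst _).trans h1)

/-- An interval no longer than the mesh has at most one grid point strictly inside, so the sum
differs from Ξ s t by at most one defect. -/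
theorem AlmostAdditive.dyadicSum_sub {Ξ : ℝ → ℝ → W} {C ζ : ℝ} (h : AlmostAdditive Ξ C ζ)
    (hC : 0 ≤ C) (hζ : 1 < ζ) (n : ℕ) {s t : ℝ} (h0 : 0 ≤ s) (hst : s ≤ t) (h1 : t ≤ 1)
    (hn : t - s ≤ (1 / 2 : ℝ) ^ n) :
    ‖dyadicSum Ξ n s t - Ξ s t‖ ≤ C * (t - s) ^ ζ := by
  set c : ℕ → ℝ := fun k => clamp s t ((k : ℝ) / 2 ^ n) with hc
  have hcs : ∀ k, s ≤ c k := fun k => le_clamp _ _ _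
  have hct : ∀ k, c k ≤ t := fun k => clamp_le hst _
  have hcm : ∀ k, c k ≤ c (k + 1) := fun k => clamp_mono _ _ (by gcongr; simp)
  have hzero : ∀ u, s ≤ u → u ≤ t → Ξ u u = 0 := fun u hu hu' =>
    h.self hζ (h0.trans hu) (hu'.trans h1)
  have hpos : 0 ≤ C * (t - s) ^ ζ := mul_nonneg hC (Real.rpow_nonneg (sub_nonneg.2 hst) _)
  -- Telescoping Ξ s t through the grid turns the difference into a sum of defects of the triples
  -- (s, c k, c (k + 1)).
  have htel : Ξ s t = ∑ k ∈ Finset.range (2 ^ n), (Ξ s (c (k + 1)) - Ξ s (c k)) := by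
    rw [Finset.sum_range_sub fun k => Ξ s (c k)]
    have e0 : c 0 = s := clamp_of_le (by simpa using h0)
    have e1 : c (2 ^ n) = t := clamp_of_ge hst (by
      push_cast
      rwa [div_self (by positivity)])
    rw [e0, e1, hzero s le_rfl hst, sub_zero]
  have hkey : dyadicSum Ξ n s t - Ξ s t =
      -∑ k ∈ Finset.range (2 ^ n), (Ξ s (c (k + 1)) - Ξ s (c k) - Ξ (c k) (c (k + 1))) := by
    have e : dyadicSum Ξ n s t = ∑ k ∈ Finset.range (2 ^ n), Ξ (c k) (c (k + 1)) := rfl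
    rw [htel, e, ← Finset.sum_sub_distrib, ← Finset.sum_neg_distrib]
    exact Finset.sum_congr rfl fun k _ => by abel
  have hterm : ∀ k, ‖Ξ s (c (k + 1)) - Ξ s (c k) - Ξ (c k) (c (k + 1))‖ ≤ C * (t - s) ^ ζ := by
    intro k
    refine (h _ _ _ h0 (hcs k) (hcm k) ((hct _).trans h1)).trans ?_
    exact mul_le_mul_of_nonneg_left (Real.rpow_le_rpow (sub_nonneg.2 (hcs _))
      (by linarith [hct (k + 1)]) (by linarith)) hC
  -- Unless the grid point lies strictly inside (s, t), the triple is degenerate.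
  have hvan : ∀ k : ℕ, ¬ (s < (k : ℝ) / 2 ^ n ∧ (k : ℝ) / 2 ^ n < t) →
      Ξ s (c (k + 1)) - Ξ s (c k) - Ξ (c k) (c (k + 1)) = 0 := by
    intro k hk
    rcases not_and_or.1 hk with hk | hk
    · have : c k = s := clamp_of_le (not_lt.1 hk)
      rw [this, hzero s le_rfl hst]
      simp
    · have e : c k = t := clamp_of_ge hst (not_lt.1 hk)
      have e' : c (k + 1) = t := le_antisymm (hct _) (e ▸ hcm k)
      rw [e, e', hzero t hst le_rfl]
      simp
  rw [hkey, norm_neg]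
  by_cases hex : ∃ k ∈ Finset.range (2 ^ n), s < (k : ℝ) / 2 ^ n ∧ (k : ℝ) / 2 ^ n < t
  · obtain ⟨k, hkr, hk1, hk2⟩ := hex
    rw [Finset.sum_eq_single_of_mem k hkr]
    · exact hterm k
    · intro j _ hjk
      refine hvan j ?_
      rintro ⟨hj1, hj2⟩
      have h2n : (0 : ℝ) < 2 ^ n := by positivity
      rw [div_pow, one_pow] at hn
      have : ∀ i l : ℕ, i < l → s < (i : ℝ) / 2 ^ n → (l : ℝ) / 2 ^ n < t → False := by
        intro i l hil hi hl
        have hil' : ((i : ℝ) + 1) / 2 ^ n ≤ l / 2 ^ n := by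
          gcongr
          exact_mod_cast hil
        rw [add_div] at hil'
        linarith
      rcases lt_or_gt_of_ne hjk with hlt | hlt
      · exact this j k hlt hj1 hk2
      · exact this k j hlt hk1 hj2
  · push Not at hex
    rw [Finset.sum_eq_zero fun k hk => hvan k (by simpa using hex k hk), norm_zero]
    exact hpos

/-- The constant of the sewing lemma. -/
def sewConst (ζ : ℝ) : ℝ := 2 ^ (ζ - 1) / (1 - (1 / 2 : ℝ) ^ (ζ - 1)) + 1

theorem half_rpow_lt_one {ζ : ℝ} (hζ : 1 < ζ) : (1 / 2 : ℝ) ^ (ζ - 1) < 1 :=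
  Real.rpow_lt_one (by norm_num) (by norm_num) (by linarith)

theorem sewConst_nonneg {ζ : ℝ} (hζ : 1 < ζ) : 0 ≤ sewConst ζ :=
  add_nonneg (div_nonneg (by positivity) (by linarith [half_rpow_lt_one hζ])) zero_le_one

/-- The dyadic sums converge geometrically and their limit is additive, hence the increment of a
path. The exponent ζ in the final estimate requires starting the geometric series at the scale of t
- s, not at n = 0. -/
theorem AlmostAdditive.exists_path [CompleteSpace W] {Ξ : ℝ → ℝ → W} {C ζ : ℝ}
    (h : AlmostAdditive Ξ C ζ) (hC : 0 ≤ C) (hζ : 1 < ζ) :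
    ∃ w : ℝ → W, w 0 = 0 ∧ ∀ s t, 0 ≤ s → s ≤ t → t ≤ 1 →
      ‖w t - w s - Ξ s t‖ ≤ sewConst ζ * C * (t - s) ^ ζ := by
  set r : ℝ := (1 / 2 : ℝ) ^ (ζ - 1) with hr
  have hr1 : r < 1 := half_rpow_lt_one hζ
  have hr0 : 0 < r := by positivity
  have hlim : ∀ s t, 0 ≤ s → s ≤ t → t ≤ 1 →
      ∃ J, Tendsto (fun n => dyadicSum Ξ n s t) atTop (𝓝 J) := fun s t h0 hst h1 =>
    cauchySeq_tendsto_of_complete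
      (cauchySeq_of_le_geometric r (C * (t - s)) hr1 fun n => h.dyadicSum_succ hC hζ n h0 hst h1)
  choose! J hJ using hlim
  have hadd : ∀ s t, 0 ≤ s → s ≤ t → t ≤ 1 → J 0 t - J 0 s = J s t := by
    intro s t h0 hst h1
    have hz : Tendsto (fun n => dyadicSum Ξ n 0 t - dyadicSum Ξ n 0 s - dyadicSum Ξ n s t)
        atTop (𝓝 0) := by
      refine squeeze_zero_norm (fun n => h.dyadicSum_add hC hζ n le_rfl h0 hst h1) ?_
      have := ((tendsto_pow_atTop_nhds_zero_of_lt_one hr0.le hr1).mul_const (t - 0)).const_mul C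
      simpa only [zero_mul, mul_zero] using this
    have := tendsto_nhds_unique hz
      (((hJ 0 t le_rfl (h0.trans hst) h1).sub (hJ 0 s le_rfl h0 (hst.trans h1))).sub
        (hJ s t h0 hst h1))
    exact (sub_eq_zero.1 this.symm)
  refine ⟨J 0, ?_, fun s t h0 hst h1 => ?_⟩
  · have := hadd 0 0 le_rfl le_rfl zero_le_one
    rw [sub_self] at this
    exact this.symm
  rw [hadd s t h0 hst h1]
  rcases hst.eq_or_lt with rfl | hlt
  · have := hadd s s h0 le_rfl h1
    rw [← this, h.self hζ h0 h1, sub_self, sub_self, sub_self, norm_zero,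
      Real.zero_rpow (by linarith), mul_zero]
  -- The scale with 2^(-n-1) < t - s ≤ 2^(-n): at level n the sum is one defect away from the germ,
  -- and the tail from n on is of order (t - s) rⁿ, comparable to (t - s) ^ ζ.
  obtain ⟨n, hn1, hn2⟩ := exists_nat_pow_near_of_lt_one (x := t - s) (y := (1 / 2 : ℝ))
    (by linarith) (by linarith) (by norm_num) (by norm_num)
  have hts : 0 < t - s := by linarith
  have hd1 := dist_le_of_le_geometric_of_tendsto r (C * (t - s)) hr1
    (fun n => h.dyadicSum_succ hC hζ n h0 hst h1) (hJ s t h0 hst h1) n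
  have hd2 := h.dyadicSum_sub hC hζ n h0 hst h1 hn2
  have hrn : r ^ n ≤ 2 ^ (ζ - 1) * (t - s) ^ (ζ - 1) := by
    rw [hr, Real.rpow_pow_comm (by norm_num),
      ← Real.mul_rpow (by norm_num) hts.le]
    refine Real.rpow_le_rpow (by positivity) ?_ (by linarith)
    rw [pow_succ] at hn1
    linarith
  have hz : (t - s) ^ ζ = (t - s) ^ (ζ - 1) * (t - s) := by
    rw [← Real.rpow_add_one hts.ne', sub_add_cancel]
  have h1r : 0 < 1 - r := by linarith
  calc ‖J s t - Ξ s t‖ ≤ ‖J s t - dyadicSum Ξ n s t‖ + ‖dyadicSum Ξ n s t - Ξ s t‖ :=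
        norm_sub_le_norm_sub_add_norm_sub _ _ _
    _ ≤ C * (t - s) * r ^ n / (1 - r) + C * (t - s) ^ ζ := by
        rw [← dist_eq_norm, dist_comm]
        exact add_le_add hd1 hd2
    _ ≤ C * (t - s) * (2 ^ (ζ - 1) * (t - s) ^ (ζ - 1)) / (1 - r) + C * (t - s) ^ ζ := by
        gcongr
    _ = sewConst ζ * C * (t - s) ^ ζ := by
        rw [sewConst, ← hr, hz]
        ring

/-- The sewing lemma on `[0, 1]`. -/
theorem exists_sewing [CompleteSpace W] {Ξ : Icc (0 : ℝ) 1 → Icc (0 : ℝ) 1 → W} {C ζ : ℝ}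
    (hC : 0 ≤ C) (hζ : 1 < ζ)
    (h : ∀ s u t, s ≤ u → u ≤ t → ‖Ξ s t - Ξ s u - Ξ u t‖ ≤ C * ((t : ℝ) - s) ^ ζ) :
    ∃ w : Icc (0 : ℝ) 1 → W, w 0 = 0 ∧ ∀ s t, s ≤ t →
      ‖w t - w s - Ξ s t‖ ≤ sewConst ζ * C * ((t : ℝ) - s) ^ ζ := by
  have hp : ∀ x (h0 : 0 ≤ x) (h1 : x ≤ 1), projIcc (0 : ℝ) 1 zero_le_one x = ⟨x, h0, h1⟩ :=
    fun x h0 h1 => projIcc_of_mem zero_le_one ⟨h0, h1⟩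
  have ha : AlmostAdditive (fun s t => Ξ (projIcc 0 1 zero_le_one s) (projIcc 0 1 zero_le_one t))
      C ζ := by
    intro s u t h0 hsu hut h1
    simp only [hp s h0 (by linarith), hp u (by linarith) (by linarith), hp t (by linarith) h1]
    exact h _ _ _ hsu hut
  obtain ⟨w, hw0, hw⟩ := ha.exists_path hC hζ
  refine ⟨fun t => w t, hw0, fun s t hst => ?_⟩
  have := hw s t s.2.1 hst t.2.2
  rwa [projIcc_val, projIcc_val] at this

/-- A function that is Hölder continuous with an exponent larger than one is constant. -/
theorem eq_of_holder_gt_one {w : Icc (0 : ℝ) 1 → W} {C ζ : ℝ} (hζ : 1 < ζ)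
    (h : ∀ s t, s ≤ t → ‖w t - w s‖ ≤ C * ((t : ℝ) - s) ^ ζ) (t : Icc (0 : ℝ) 1) :
    w t = w 0 := by
  set a : ℕ → ℕ → Icc (0 : ℝ) 1 := fun n k => projIcc 0 1 zero_le_one (k / n * t) with ha
  have hval : ∀ n k : ℕ, 0 < n → k ≤ n → ((a n k : Icc (0 : ℝ) 1) : ℝ) = k / n * t := by
    intro n k hn hk
    have h1 : (k : ℝ) / n ≤ 1 := div_le_one_of_le₀ (by exact_mod_cast hk) (by positivity)
    have h2 : 0 ≤ (k : ℝ) / n * t := mul_nonneg (by positivity) t.2.1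
    have h3 : (k : ℝ) / n * t ≤ 1 := mul_le_one₀ h1 t.2.1 t.2.2
    rw [ha]
    exact congrArg Subtype.val (projIcc_of_mem zero_le_one ⟨h2, h3⟩)
  -- Cutting [0, t] into n equal pieces costs n (t / n) ^ ζ, which tends to 0.
  have hbound : ∀ n : ℕ, 0 < n → ‖w t - w 0‖ ≤ C * t ^ ζ * ((n : ℝ) ^ (ζ - 1))⁻¹ := by
    intro n hn
    have hn' : (0 : ℝ) < n := by exact_mod_cast hn
    have e0 : a n 0 = 0 := Subtype.ext (by rw [hval n 0 hn (Nat.zero_le _)]; simp)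
    have e1 : a n n = t := Subtype.ext (by rw [hval n n hn le_rfl, div_self hn'.ne', one_mul])
    have htel : w t - w 0 = ∑ k ∈ Finset.range n, (w (a n (k + 1)) - w (a n k)) := by
      rw [Finset.sum_range_sub fun k => w (a n k), e0, e1]
    rw [htel]
    have hterm : ∀ k ∈ Finset.range n, ‖w (a n (k + 1)) - w (a n k)‖ ≤ C * (t / n) ^ ζ := by
      intro k hk
      have hk' : k + 1 ≤ n := Finset.mem_range.1 hk
      have hd : ((a n (k + 1) : Icc (0 : ℝ) 1) : ℝ) - a n k = t / n := by
        rw [hval n _ hn hk', hval n k hn (by omega)]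
        push_cast
        ring
      have hle : a n k ≤ a n (k + 1) := by
        rw [← Subtype.coe_le_coe, ← sub_nonneg, hd]
        exact div_nonneg t.2.1 hn'.le
      have := h _ _ hle
      rwa [hd] at this
    refine (norm_sum_le_of_le _ hterm).trans (le_of_eq ?_)
    rw [Finset.sum_const, Finset.card_range, nsmul_eq_mul, Real.div_rpow t.2.1 hn'.le,
      Real.rpow_sub_one hn'.ne']
    field_simp
  have hlim : Tendsto (fun n : ℕ => C * (t : ℝ) ^ ζ * ((n : ℝ) ^ (ζ - 1))⁻¹) atTop (𝓝 0) := by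
    have := (tendsto_inv_atTop_zero.comp ((tendsto_rpow_atTop (by linarith : 0 < ζ - 1)).comp
      tendsto_natCast_atTop_atTop)).const_mul (C * (t : ℝ) ^ ζ)
    simpa using this
  have hle : ‖w t - w 0‖ ≤ 0 :=
    ge_of_tendsto hlim ((eventually_gt_atTop 0).mono fun n hn => hbound n hn)
  exact sub_eq_zero.1 (norm_le_zero_iff.1 hle)

end Sewing

/-! ### Estimates for controlled paths -/

theorem supNorm_le {ι G : Type*} [NormedAddCommGroup G] {f : ι → G} {C : ℝ} (hC : 0 ≤ C)
    (h : ∀ i, ‖f i‖ ≤ C) : supNorm f ≤ C := Real.iSup_le h hC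

theorem time_sub_nonneg {s t : Icc (0 : ℝ) 1} (h : s ≤ t) : 0 ≤ (t : ℝ) - s := sub_nonneg.2 h

theorem time_sub_le_one (s t : Icc (0 : ℝ) 1) : (t : ℝ) - s ≤ 1 := by
  linarith [s.2.1, t.2.2]

theorem time_rpow_le {s t : Icc (0 : ℝ) 1} (h : s ≤ t) {a b : ℝ} (ha : 0 ≤ a) (hab : a ≤ b) :
    ((t : ℝ) - s) ^ b ≤ ((t : ℝ) - s) ^ a :=
  Real.rpow_le_rpow_of_exponent_ge_of_imp (time_sub_nonneg h) (time_sub_le_one s t) hab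
    fun h1 h2 => by linarith

theorem time_rpow_nonneg {s t : Icc (0 : ℝ) 1} (h : s ≤ t) (a : ℝ) : 0 ≤ ((t : ℝ) - s) ^ a :=
  Real.rpow_nonneg (time_sub_nonneg h) a

theorem time_rpow_le_one {s t : Icc (0 : ℝ) 1} (h : s ≤ t) {a : ℝ} (ha : 0 ≤ a) :
    ((t : ℝ) - s) ^ a ≤ 1 :=
  Real.rpow_le_one (time_sub_nonneg h) (time_sub_le_one s t) ha

section API

variable {E E2 : Type*} [NormedAddCommGroup E] [NormedSpace ℝ E]
  [NormedAddCommGroup E2] [NormedSpace ℝ E2] {T : TensorSquare E E2} {p : ℝ}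

/-- `K` bounds the Hölder norms of the two levels of the rough path `X`. -/
structure RoughPath.Bound (X : RoughPath T p) (K : ℝ) : Prop where
  nonneg : 0 ≤ K
  fst_le : ∀ s t, s ≤ t → ‖X.fst s t‖ ≤ K * ((t : ℝ) - s) ^ (1 / p)
  snd_le : ∀ s t, s ≤ t → ‖X.snd s t‖ ≤ K * ((t : ℝ) - s) ^ (2 / p)

theorem RoughPath.exists_bound (X : RoughPath T p) : ∃ K, X.Bound K := by
  obtain ⟨C, hC⟩ := X.fst_holder
  obtain ⟨D, hD⟩ := X.snd_holder
  refine ⟨max 0 (max C D), le_max_left _ _, fun s t h => (hC s t h).trans ?_,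
    fun s t h => (hD s t h).trans ?_⟩
  · exact mul_le_mul_of_nonneg_right ((le_max_left _ _).trans (le_max_right _ _))
      (time_rpow_nonneg h _)
  · exact mul_le_mul_of_nonneg_right ((le_max_right _ _).trans (le_max_right _ _))
      (time_rpow_nonneg h _)

variable {X : RoughPath T p} {U V W : Type*} [NormedAddCommGroup U] [NormedSpace ℝ U]
  [NormedAddCommGroup V] [NormedSpace ℝ V] [NormedAddCommGroup W] [NormedSpace ℝ W]

namespace ControlledPath

/-- The part `‖z'‖_{1/p} + ‖R‖_{2/p}` of the norm. -/
def seminorm (z : ControlledPath X V) : ℝ :=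
  supNorm z.der + supNorm (derivQuotient p z.1) + supNorm (remQuotient X z.1)

theorem norm_eq_seminorm_add (z : ControlledPath X V) : ‖z‖ = z.seminorm + ‖z.path 0‖ := rfl

theorem seminorm_nonneg (z : ControlledPath X V) : 0 ≤ z.seminorm :=
  add_nonneg (add_nonneg (supNorm_nonneg _) (supNorm_nonneg _)) (supNorm_nonneg _)

theorem seminorm_le_norm (z : ControlledPath X V) : z.seminorm ≤ ‖z‖ := by
  rw [norm_eq_seminorm_add]
  linarith [norm_nonneg (z.path 0)]

theorem path_zero_le (z : ControlledPath X V) : ‖z.path 0‖ ≤ ‖z‖ := by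
  rw [norm_eq_seminorm_add]
  linarith [z.seminorm_nonneg]

@[simp] theorem path_add (z w : ControlledPath X V) (t) : (z + w).path t = z.path t + w.path t :=
  rfl

@[simp] theorem der_add (z w : ControlledPath X V) (t) : (z + w).der t = z.der t + w.der t := rfl

@[simp] theorem path_sub (z w : ControlledPath X V) (t) : (z - w).path t = z.path t - w.path t :=
  rfl

@[simp] theorem der_sub (z w : ControlledPath X V) (t) : (z - w).der t = z.der t - w.der t := rfl

@[simp] theorem path_smul (c : ℝ) (z : ControlledPath X V) (t) :
    (c • z).path t = c • z.path t := rfl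

@[simp] theorem der_smul (c : ℝ) (z : ControlledPath X V) (t) : (c • z).der t = c • z.der t := rfl

@[ext] theorem ext {z w : ControlledPath X V} (h : ∀ t, z.path t = w.path t)
    (h' : ∀ t, z.der t = w.der t) : z = w :=
  Subtype.ext (Prod.ext (funext h) (funext h'))

theorem der_le (z : ControlledPath X V) (t) : ‖z.der t‖ ≤ z.seminorm := by
  have h1 : ‖z.der t‖ ≤ supNorm z.der := le_supNorm z.2.1 t
  have h2 := supNorm_nonneg (derivQuotient p z.1)
  have h3 := supNorm_nonneg (remQuotient X z.1)
  rw [seminorm]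
  linarith

theorem der_sub_le (z : ControlledPath X V) {s t} (hst : s ≤ t) :
    ‖z.der t - z.der s‖ ≤ z.seminorm * ((t : ℝ) - s) ^ (1 / p) := by
  rcases hst.eq_or_lt with rfl | hlt
  · rw [sub_self, norm_zero]
    exact mul_nonneg z.seminorm_nonneg (time_rpow_nonneg le_rfl _)
  have hpos : 0 < ((t : ℝ) - s) ^ (1 / p) := Real.rpow_pos_of_pos (sub_pos.2 hlt) _
  have h1 := le_supNorm z.2.2.1 (s, t)
  rw [derivQuotient, norm_smul, norm_inv, Real.norm_eq_abs, abs_of_nonneg (time_sub_nonneg hst),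
    abs_of_pos hpos, inv_mul_le_iff₀ hpos, mul_comm] at h1
  refine h1.trans (mul_le_mul_of_nonneg_right ?_ hpos.le)
  have h2 := supNorm_nonneg z.der
  have h3 := supNorm_nonneg (remQuotient X z.1)
  rw [seminorm]
  linarith

theorem rem_le (z : ControlledPath X V) {s t} (hst : s ≤ t) :
    ‖z.path t - z.path s - z.der s (X.fst s t)‖ ≤ z.seminorm * ((t : ℝ) - s) ^ (2 / p) := by
  rcases hst.eq_or_lt with rfl | hlt
  · have : X.fst s s = 0 := by simpa using X.fst_add s s s le_rfl le_rfl
    rw [this, map_zero, sub_self, sub_zero, norm_zero]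
    exact mul_nonneg z.seminorm_nonneg (time_rpow_nonneg le_rfl _)
  have hpos : 0 < ((t : ℝ) - s) ^ (2 / p) := Real.rpow_pos_of_pos (sub_pos.2 hlt) _
  have h1 := le_supNorm z.2.2.2 ⟨(s, t), hst⟩
  rw [remQuotient, norm_smul, norm_inv, Real.norm_eq_abs,
    abs_of_pos hpos, inv_mul_le_iff₀ hpos, mul_comm] at h1
  refine h1.trans (mul_le_mul_of_nonneg_right ?_ hpos.le)
  have h2 := supNorm_nonneg z.der
  have h3 := supNorm_nonneg (derivQuotient p z.1)
  rw [seminorm]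
  linarith

theorem derivQuotient_le {z : (Icc (0 : ℝ) 1 → V) × (Icc (0 : ℝ) 1 → E →L[ℝ] V)} {b : ℝ}
    (hb : 0 ≤ b)
    (h : ∀ s t, s ≤ t → ‖z.2 t - z.2 s‖ ≤ b * ((t : ℝ) - s) ^ (1 / p)) (i) :
    ‖derivQuotient p z i‖ ≤ b := by
  have key : ∀ s t : Icc (0 : ℝ) 1, s ≤ t →
      (((t : ℝ) - s) ^ (1 / p))⁻¹ * ‖z.2 t - z.2 s‖ ≤ b := by
    intro s t hst
    rcases (time_rpow_nonneg hst (1 / p)).eq_or_lt with h0 | hpos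
    · rw [← h0, inv_zero, zero_mul]
      exact hb
    · rw [inv_mul_le_iff₀ hpos, mul_comm]
      exact h s t hst
  obtain ⟨s, t⟩ := i
  rw [derivQuotient, norm_smul, norm_inv, Real.norm_eq_abs, abs_of_nonneg (by positivity)]
  rcases le_total s t with hst | hst
  · rw [abs_of_nonneg (time_sub_nonneg hst)]
    exact key s t hst
  · rw [abs_sub_comm, abs_of_nonneg (time_sub_nonneg hst), norm_sub_rev]
    exact key t s hst

theorem remQuotient_le {z : (Icc (0 : ℝ) 1 → V) × (Icc (0 : ℝ) 1 → E →L[ℝ] V)} {c : ℝ}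
    (hc : 0 ≤ c)
    (h : ∀ s t, s ≤ t → ‖z.1 t - z.1 s - z.2 s (X.fst s t)‖ ≤ c * ((t : ℝ) - s) ^ (2 / p)) (i) :
    ‖remQuotient X z i‖ ≤ c := by
  obtain ⟨⟨s, t⟩, hst⟩ := i
  rw [remQuotient, norm_smul, norm_inv, Real.norm_eq_abs, abs_of_nonneg (time_rpow_nonneg hst _)]
  rcases (time_rpow_nonneg hst (2 / p)).eq_or_lt with h0 | hpos
  · rw [← h0, inv_zero, zero_mul]
    exact hc
  · rw [inv_mul_le_iff₀ hpos, mul_comm]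
    exact h s t hst

/-- A controlled path from bounds on its components. -/
def ofBounds (X : RoughPath T p) (z : Icc (0 : ℝ) 1 → V) (z' : Icc (0 : ℝ) 1 → E →L[ℝ] V)
    {a b c : ℝ}
    (ha : ∀ t, ‖z' t‖ ≤ a)
    (hb : 0 ≤ b ∧ ∀ s t, s ≤ t → ‖z' t - z' s‖ ≤ b * ((t : ℝ) - s) ^ (1 / p))
    (hc : 0 ≤ c ∧ ∀ s t, s ≤ t → ‖z t - z s - z' s (X.fst s t)‖ ≤ c * ((t : ℝ) - s) ^ (2 / p)) :
    ControlledPath X V :=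
  ⟨(z, z'), ⟨a, ha⟩, ⟨b, derivQuotient_le hb.1 hb.2⟩, ⟨c, remQuotient_le hc.1 hc.2⟩⟩

theorem seminorm_le_of_bounds {w : ControlledPath X V} {a b c : ℝ}
    (ha : ∀ t, ‖w.der t‖ ≤ a)
    (hb : 0 ≤ b ∧ ∀ s t, s ≤ t → ‖w.der t - w.der s‖ ≤ b * ((t : ℝ) - s) ^ (1 / p))
    (hc : 0 ≤ c ∧ ∀ s t, s ≤ t →
      ‖w.path t - w.path s - w.der s (X.fst s t)‖ ≤ c * ((t : ℝ) - s) ^ (2 / p)) :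
    w.seminorm ≤ a + b + c :=
  add_le_add (add_le_add (supNorm_le ((norm_nonneg _).trans (ha 0)) ha)
    (supNorm_le hb.1 (derivQuotient_le hb.1 hb.2)))
    (supNorm_le hc.1 (remQuotient_le hc.1 hc.2))

/-- The increment is z' X plus the remainder: the first contributes K, the second 1, because 2/p ≥
1/p and times are at most 1. -/
theorem path_sub_le [hp : Fact (0 < p)] {K : ℝ} (hX : X.Bound K) (z : ControlledPath X V) {s t}
    (hst : s ≤ t) :
    ‖z.path t - z.path s‖ ≤ (K + 1) * z.seminorm * ((t : ℝ) - s) ^ (1 / p) := by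
  have h1 := z.rem_le hst
  have h2 : ‖z.der s (X.fst s t)‖ ≤ z.seminorm * (K * ((t : ℝ) - s) ^ (1 / p)) :=
    (z.der s).le_of_opNorm_le_of_le (z.der_le s) (hX.fst_le s t hst)
  have h3 : ((t : ℝ) - s) ^ (2 / p) ≤ ((t : ℝ) - s) ^ (1 / p) :=
    time_rpow_le hst (one_div_nonneg.2 hp.out.le) (by gcongr; exacts [hp.out.le, one_le_two])
  have h4 := mul_le_mul_of_nonneg_left h3 z.seminorm_nonneg
  have h5 := norm_add_le (z.path t - z.path s - z.der s (X.fst s t)) (z.der s (X.fst s t))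
  rw [sub_add_cancel] at h5
  linarith

theorem path_sub_zero_le [hp : Fact (0 < p)] {K : ℝ} (hX : X.Bound K) (z : ControlledPath X V)
    (t) : ‖z.path t - z.path 0‖ ≤ (K + 1) * z.seminorm := by
  have h0 : (0 : Icc (0 : ℝ) 1) ≤ t := t.2.1
  refine (z.path_sub_le hX h0).trans (mul_le_of_le_one_right ?_ ?_)
  · exact mul_nonneg (by linarith [hX.nonneg]) z.seminorm_nonneg
  · exact time_rpow_le_one h0 (one_div_nonneg.2 hp.out.le)

theorem path_le [Fact (0 < p)] {K : ℝ} (hX : X.Bound K) (z : ControlledPath X V) (t) :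
    ‖z.path t‖ ≤ (K + 1) * ‖z‖ := by
  have h1 := z.path_sub_zero_le hX t
  have h2 := norm_add_le (z.path t - z.path 0) (z.path 0)
  rw [sub_add_cancel] at h2
  rw [norm_eq_seminorm_add, mul_add]
  have := mul_nonneg hX.nonneg (norm_nonneg (z.path 0))
  linarith

variable (X V) in
/-- Evaluation of the path at time `t`. -/
def evalPath [Fact (0 < p)] (t : Icc (0 : ℝ) 1) : ControlledPath X V →L[ℝ] V :=
  LinearMap.mkContinuous
    { toFun := fun z => z.path t, map_add' := fun _ _ => rfl, map_smul' := fun _ _ => rfl }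
    (X.exists_bound.choose + 1) fun z => z.path_le X.exists_bound.choose_spec t

variable (X V) in
/-- Evaluation of the derivative at time `t`. -/
def evalDer (t : Icc (0 : ℝ) 1) : ControlledPath X V →L[ℝ] (E →L[ℝ] V) :=
  LinearMap.mkContinuous
    { toFun := fun z => z.der t, map_add' := fun _ _ => rfl, map_smul' := fun _ _ => rfl }
    1 fun z => by
      rw [one_mul]
      exact (z.der_le t).trans z.seminorm_le_norm

@[simp] theorem ofBounds_path (z : Icc (0 : ℝ) 1 → V) (z' : Icc (0 : ℝ) 1 → E →L[ℝ] V)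
    {a b c : ℝ} (ha) (hb : 0 ≤ b ∧ _) (hc : 0 ≤ c ∧ _) (t) :
    (ofBounds X z z' (a := a) ha hb hc).path t = z t := rfl

@[simp] theorem ofBounds_der (z : Icc (0 : ℝ) 1 → V) (z' : Icc (0 : ℝ) 1 → E →L[ℝ] V)
    {a b c : ℝ} (ha) (hb : 0 ≤ b ∧ _) (hc : 0 ≤ c ∧ _) (t) :
    (ofBounds X z z' (a := a) ha hb hc).der t = z' t := rfl

variable (X) in
/-- The constant path with value `v`. -/
def constPath (v : V) : ControlledPath X V :=
  ofBounds X (fun _ => v) (fun _ => 0) (a := 0) (b := 0) (c := 0) (by simp) (by simp) (by simp)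

theorem seminorm_constPath_le (v : V) : (constPath X v).seminorm ≤ 0 := by
  have := seminorm_le_of_bounds (w := constPath X v) (a := 0) (b := 0) (c := 0)
    (by simp [constPath]) (by simp [constPath]) (by simp [constPath])
  simpa using this

variable (X V) in
/-- The constant paths. -/
def const : V →L[ℝ] ControlledPath X V :=
  LinearMap.mkContinuous
    { toFun := constPath X
      map_add' := fun _ _ => by ext <;> simp [constPath]
      map_smul' := fun _ _ => by ext <;> simp [constPath] }
    1 fun v => by
      rw [one_mul]
      exact (add_le_add_left (seminorm_constPath_le v) ‖v‖).trans_eq (zero_add _)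

@[simp] theorem const_path (v : V) (t) : (const X V v).path t = v := rfl

@[simp] theorem const_der (v : V) (t) : (const X V v).der t = 0 := rfl

theorem seminorm_congr {z w : ControlledPath X V} (h : ∀ t, z.der t = w.der t)
    (h' : ∀ s t, z.path t - z.path s = w.path t - w.path s) : z.seminorm = w.seminorm := by
  have h1 : z.der = w.der := funext h
  have h2 : derivQuotient p z.1 = derivQuotient p w.1 := by
    funext q
    change (|(q.2 : ℝ) - q.1| ^ (1 / p))⁻¹ • (z.der q.2 - z.der q.1) =
      (|(q.2 : ℝ) - q.1| ^ (1 / p))⁻¹ • (w.der q.2 - w.der q.1)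
    rw [h1]
  have h3 : remQuotient X z.1 = remQuotient X w.1 := by
    funext q
    change (((q.1.2 : ℝ) - q.1.1) ^ (2 / p))⁻¹ •
      (z.path q.1.2 - z.path q.1.1 - z.der q.1.1 _) = (((q.1.2 : ℝ) - q.1.1) ^ (2 / p))⁻¹ •
      (w.path q.1.2 - w.path q.1.1 - w.der q.1.1 _)
    rw [h1, h']
  rw [seminorm, seminorm, h1, h2, h3]

/-- Subtracting the constant path kills the initial value and changes no increment. Continuity,
subadditivity and homogeneity of the seminorm are thus inherited from the norm. -/
theorem seminorm_eq_norm_sub (z : ControlledPath X V) :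
    z.seminorm = ‖z - const X V (z.path 0)‖ := by
  rw [norm_eq_seminorm_add, path_sub, const_path, sub_self, norm_zero, add_zero]
  exact seminorm_congr (fun t => by simp) (fun s t => by simp)

theorem seminorm_const_add (v : V) (z : ControlledPath X V) :
    (const X V v + z).seminorm = z.seminorm :=
  seminorm_congr (fun t => by simp) (fun s t => by simp)

theorem continuous_path_zero : Continuous fun z : ControlledPath X V => z.path 0 :=
  (LinearMap.mkContinuous
    ({ toFun := fun z => z.path 0, map_add' := fun _ _ => rfl, map_smul' := fun _ _ => rfl } :
      ControlledPath X V →ₗ[ℝ] V) 1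
    fun z => by rw [one_mul]; exact z.path_zero_le).continuous

theorem continuous_seminorm : Continuous (seminorm : ControlledPath X V → ℝ) := by
  have : (seminorm : ControlledPath X V → ℝ) = fun z => ‖z - const X V (z.path 0)‖ :=
    funext seminorm_eq_norm_sub
  rw [this]
  exact (continuous_id.sub ((const X V).continuous.comp continuous_path_zero)).norm

theorem seminorm_add_le (z w : ControlledPath X V) :
    (z + w).seminorm ≤ z.seminorm + w.seminorm := by
  rw [seminorm_eq_norm_sub, seminorm_eq_norm_sub z, seminorm_eq_norm_sub w, path_add, map_add,
    add_sub_add_comm]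
  exact norm_add_le _ _

theorem seminorm_smul (c : ℝ) (z : ControlledPath X V) :
    (c • z).seminorm = |c| * z.seminorm := by
  rw [seminorm_eq_norm_sub, seminorm_eq_norm_sub z, path_smul, map_smul, ← smul_sub, norm_smul,
    Real.norm_eq_abs]

theorem convex_seminorm_le (r : ℝ) : Convex ℝ {z : ControlledPath X V | z.seminorm ≤ r} := by
  intro z hz w hw a b ha hb hab
  have h1 := seminorm_add_le (a • z) (b • w)
  rw [seminorm_smul, seminorm_smul, abs_of_nonneg ha, abs_of_nonneg hb] at h1
  have h2 := mul_le_mul_of_nonneg_left (mem_ofPred.1 hz) ha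
  have h3 := mul_le_mul_of_nonneg_left (mem_ofPred.1 hw) hb
  refine mem_ofPred.2 (h1.trans ((add_le_add h2 h3).trans (le_of_eq ?_)))
  rw [← add_mul, hab, one_mul]

/-- The remainder functional `z ↦ z_t - z_s - z'_s X_{ts}`. -/
def evalRem [Fact (0 < p)] (X : RoughPath T p) (V : Type*) [NormedAddCommGroup V]
    [NormedSpace ℝ V] (s t : Icc (0 : ℝ) 1) : ControlledPath X V →L[ℝ] V :=
  evalPath X V t - evalPath X V s -
    (ContinuousLinearMap.apply ℝ V (X.fst s t)).comp (evalDer X V s)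

/-- Each bound defining the norm is closed under pointwise convergence, so it passes to a pointwise
limit that is not yet known to be controlled. -/
theorem bounds_of_tendsto [Fact (0 < p)] {v : ℕ → ControlledPath X V}
    {z : Icc (0 : ℝ) 1 → V} {z' : Icc (0 : ℝ) 1 → E →L[ℝ] V}
    (hz : ∀ t, Filter.Tendsto (fun n => (v n).path t) Filter.atTop (nhds (z t)))
    (hz' : ∀ t, Filter.Tendsto (fun n => (v n).der t) Filter.atTop (nhds (z' t)))
    {r : ℝ} (hv : ∀ᶠ n in Filter.atTop, ‖v n‖ ≤ r) :
    (∀ t, ‖z' t‖ ≤ r) ∧ (∀ s t, s ≤ t → ‖z' t - z' s‖ ≤ r * ((t : ℝ) - s) ^ (1 / p)) ∧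
    (∀ s t, s ≤ t → ‖z t - z s - z' s (X.fst s t)‖ ≤ r * ((t : ℝ) - s) ^ (2 / p)) ∧
    ‖z 0‖ ≤ r := by
  refine ⟨fun t => ?_, fun s t hst => ?_, fun s t hst => ?_, ?_⟩
  · refine le_of_tendsto (hz' t).norm (hv.mono fun n hn => ?_)
    exact ((v n).der_le t).trans ((v n).seminorm_le_norm.trans hn)
  · refine le_of_tendsto ((hz' t).sub (hz' s)).norm (hv.mono fun n hn => ?_)
    exact ((v n).der_sub_le hst).trans (mul_le_mul_of_nonneg_right
      ((v n).seminorm_le_norm.trans hn) (time_rpow_nonneg hst _))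
  · have h1 : Filter.Tendsto (fun n => (v n).der s (X.fst s t)) Filter.atTop
        (nhds (z' s (X.fst s t))) :=
      ((ContinuousLinearMap.apply ℝ V (X.fst s t)).continuous.tendsto _).comp (hz' s)
    refine le_of_tendsto (((hz t).sub (hz s)).sub h1).norm (hv.mono fun n hn => ?_)
    exact ((v n).rem_le hst).trans (mul_le_mul_of_nonneg_right
      ((v n).seminorm_le_norm.trans hn) (time_rpow_nonneg hst _))
  · exact le_of_tendsto (hz 0).norm (hv.mono fun n hn => (v n).path_zero_le.trans hn)

instance [Fact (0 < p)] [CompleteSpace V] : CompleteSpace (ControlledPath X V) := by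
  refine Metric.complete_of_cauchySeq_tendsto fun u hu => ?_
  have h1 : ∀ t, ∃ a, Filter.Tendsto (fun n => (u n).path t) Filter.atTop (nhds a) := fun t =>
    cauchySeq_tendsto_of_complete (hu.map (evalPath X V t).uniformContinuous)
  have h2 : ∀ t, ∃ a, Filter.Tendsto (fun n => (u n).der t) Filter.atTop (nhds a) := fun t =>
    cauchySeq_tendsto_of_complete (hu.map (evalDer X V t).uniformContinuous)
  choose z hz using h1
  choose z' hz' using h2
  have key : ∀ r > 0, ∃ N, ∀ m ≥ N,
      (∀ t, ‖(u m).der t - z' t‖ ≤ r) ∧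
      (∀ s t, s ≤ t → ‖(u m).der t - z' t - ((u m).der s - z' s)‖ ≤
        r * ((t : ℝ) - s) ^ (1 / p)) ∧
      (∀ s t, s ≤ t → ‖(u m).path t - z t - ((u m).path s - z s) -
        ((u m).der s - z' s) (X.fst s t)‖ ≤ r * ((t : ℝ) - s) ^ (2 / p)) ∧
      ‖(u m).path 0 - z 0‖ ≤ r := by
    intro r hr
    obtain ⟨N, hN⟩ := Metric.cauchySeq_iff.1 hu r hr
    refine ⟨N, fun m hm => bounds_of_tendsto (v := fun n => u m - u n)
      (z := fun t => (u m).path t - z t) (z' := fun t => (u m).der t - z' t)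
      (fun t => (hz t).const_sub _) (fun t => (hz' t).const_sub _) ?_⟩
    filter_upwards [Filter.eventually_ge_atTop N] with n hn
    rw [← dist_eq_norm]
    exact (hN m hm n hn).le
  obtain ⟨N₀, hN₀⟩ := key 1 one_pos
  obtain ⟨k1, k2, k3, -⟩ := hN₀ N₀ le_rfl
  -- The limit is controlled because its difference from `u N₀` is: the bounds on the differences `u
  -- N₀ - u n` survive the limit.
  set w : ControlledPath X V := u N₀ -
    ofBounds X (fun t => (u N₀).path t - z t) (fun t => (u N₀).der t - z' t) k1
      ⟨zero_le_one, k2⟩ ⟨zero_le_one, k3⟩ with hw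
  have hwp : ∀ t, w.path t = z t := fun t => sub_sub_cancel _ _
  have hwd : ∀ t, w.der t = z' t := fun t => sub_sub_cancel _ _
  refine ⟨w, Metric.tendsto_atTop.2 fun e he => ?_⟩
  obtain ⟨N, hN⟩ := key (e / 8) (by positivity)
  refine ⟨N, fun m hm => ?_⟩
  obtain ⟨k1, k2, k3, k4⟩ := hN m hm
  have hs : (u m - w).seminorm ≤ e / 8 + e / 8 + e / 8 :=
    seminorm_le_of_bounds (fun t => by simpa only [der_sub, hwd] using k1 t)
      ⟨by positivity, fun s t hst => by simpa only [der_sub, hwd] using k2 s t hst⟩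
      ⟨by positivity, fun s t hst => by simpa only [der_sub, path_sub, hwd, hwp] using k3 s t hst⟩
  rw [dist_eq_norm, norm_eq_seminorm_add, path_sub, hwp]
  linarith

end ControlledPath

end API

/-! ### Change of roughness, interpolation, products, operator-valued paths -/

section Operations

variable {E E2 : Type*} [NormedAddCommGroup E] [NormedSpace ℝ E]
  [NormedAddCommGroup E2] [NormedSpace ℝ E2] {T : TensorSquare E E2} {p q : ℝ}
  {X : RoughPath T p} {U V W : Type*} [NormedAddCommGroup U] [NormedSpace ℝ U]
  [NormedAddCommGroup V] [NormedSpace ℝ V] [NormedAddCommGroup W] [NormedSpace ℝ W]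

theorem div_rpow_time_le (hp : 0 < p) (hpq : p ≤ q) {a : ℝ} (ha : 0 ≤ a) {s t : Icc (0 : ℝ) 1}
    (hst : s ≤ t) : ((t : ℝ) - s) ^ (a / p) ≤ ((t : ℝ) - s) ^ (a / q) :=
  time_rpow_le hst (div_nonneg ha (hp.le.trans hpq)) (by gcongr)

/-- A `p`-rough path is a `q`-rough path for `q ≥ p`. -/
def RoughPath.relax (X : RoughPath T p) (hp : 0 < p) (hpq : p ≤ q) : RoughPath T q where
  fst := X.fst
  snd := X.snd
  fst_add := X.fst_add
  chen := X.chen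
  fst_holder := by
    obtain ⟨K, hK⟩ := X.exists_bound
    exact ⟨K, fun s t hst => (hK.fst_le s t hst).trans
      (mul_le_mul_of_nonneg_left (div_rpow_time_le hp hpq zero_le_one hst) hK.nonneg)⟩
  snd_holder := by
    obtain ⟨K, hK⟩ := X.exists_bound
    exact ⟨K, fun s t hst => (hK.snd_le s t hst).trans
      (mul_le_mul_of_nonneg_left (div_rpow_time_le hp hpq zero_le_two hst) hK.nonneg)⟩

theorem RoughPath.Bound.relax {X : RoughPath T p} {K : ℝ} (hX : X.Bound K) (hp : 0 < p)
    (hpq : p ≤ q) : (X.relax hp hpq).Bound K where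
  nonneg := hX.nonneg
  fst_le s t hst := (hX.fst_le s t hst).trans
      (mul_le_mul_of_nonneg_left (div_rpow_time_le hp hpq zero_le_one hst) hX.nonneg)
  snd_le s t hst := (hX.snd_le s t hst).trans
      (mul_le_mul_of_nonneg_left (div_rpow_time_le hp hpq zero_le_two hst) hX.nonneg)

namespace ControlledPath

/-- A path controlled by the `p`-rough path `X`, seen as controlled by the `q`-rough path `X`. -/
def relaxPath (hp : 0 < p) (hpq : p ≤ q) (z : ControlledPath X V) :
    ControlledPath (X.relax hp hpq) V :=
  ofBounds _ z.path z.der (a := z.seminorm) (b := z.seminorm) (c := z.seminorm) z.der_le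
    ⟨z.seminorm_nonneg, fun _ _ hst => (z.der_sub_le hst).trans
      (mul_le_mul_of_nonneg_left (div_rpow_time_le hp hpq zero_le_one hst) z.seminorm_nonneg)⟩
    ⟨z.seminorm_nonneg, fun _ _ hst => (z.rem_le hst).trans
      (mul_le_mul_of_nonneg_left (div_rpow_time_le hp hpq zero_le_two hst) z.seminorm_nonneg)⟩

@[simp] theorem relaxPath_path (hp : 0 < p) (hpq : p ≤ q) (z : ControlledPath X V) (t) :
    (relaxPath hp hpq z).path t = z.path t := rfl

@[simp] theorem relaxPath_der (hp : 0 < p) (hpq : p ≤ q) (z : ControlledPath X V) (t) :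
    (relaxPath hp hpq z).der t = z.der t := rfl

theorem seminorm_relaxPath_le (hp : 0 < p) (hpq : p ≤ q) (z : ControlledPath X V) :
    (relaxPath hp hpq z).seminorm ≤ 3 * z.seminorm := by
  have := seminorm_le_of_bounds (w := relaxPath hp hpq z)
    (a := z.seminorm) (b := z.seminorm) (c := z.seminorm) z.der_le
    ⟨z.seminorm_nonneg, fun _ _ hst => (z.der_sub_le hst).trans
      (mul_le_mul_of_nonneg_left (div_rpow_time_le hp hpq zero_le_one hst) z.seminorm_nonneg)⟩
    ⟨z.seminorm_nonneg, fun _ _ hst => (z.rem_le hst).trans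
      (mul_le_mul_of_nonneg_left (div_rpow_time_le hp hpq zero_le_two hst) z.seminorm_nonneg)⟩
  linarith

theorem norm_relaxPath_le (hp : 0 < p) (hpq : p ≤ q) (z : ControlledPath X V) :
    ‖relaxPath hp hpq z‖ ≤ 3 * ‖z‖ := by
  have := seminorm_relaxPath_le hp hpq z
  rw [norm_eq_seminorm_add, norm_eq_seminorm_add, relaxPath_path]
  linarith [norm_nonneg (z.path 0)]

variable (X V) in
/-- The inclusion of the paths controlled by the `p`-rough path `X` in those controlled by the
`q`-rough path `X`. -/
def relaxL (hp : 0 < p) (hpq : p ≤ q) :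
    ControlledPath X V →L[ℝ] ControlledPath (X.relax hp hpq) V :=
  LinearMap.mkContinuous
    { toFun := relaxPath hp hpq, map_add' := fun _ _ => rfl, map_smul' := fun _ _ => rfl } 3
    (norm_relaxPath_le hp hpq)

/-- Interpolation: uniform smallness gives smallness in the weaker norm on bounded sets. -/
theorem exists_norm_relaxPath_le (hp : 0 < p) (hpq : p < q) (X : RoughPath T p) {B ε : ℝ}
    (hB : 0 ≤ B) (hε : 0 < ε) : ∃ η > 0, ∀ w : ControlledPath X V, w.seminorm ≤ B →
      (∀ t, ‖w.path t‖ ≤ η) → (∀ t, ‖w.der t‖ ≤ η) → ‖relaxPath hp hpq.le w‖ ≤ ε := by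
  obtain ⟨K, hK⟩ := X.exists_bound
  have hK0 := hK.nonneg
  have hq : 0 < q := hp.trans hpq
  set γ : ℝ := 1 / p - 1 / q with hγ
  have hγ0 : 0 < γ := sub_pos.2 (one_div_lt_one_div_of_lt hp hpq)
  -- On times of length at most r, the gain r ^ γ in the exponent alone turns the bound B at
  -- roughness p into ε / 4 at roughness q.
  set r : ℝ := min 1 ((ε / (4 * (B + 1))) ^ (1 / γ)) with hr
  have hr0 : 0 < r := lt_min one_pos (by positivity)
  have hr1 : r ≤ 1 := min_le_left _ _
  have hrγ : B * r ^ γ ≤ ε / 4 := by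
    have h1 : r ^ γ ≤ ε / (4 * (B + 1)) := by
      calc r ^ γ ≤ ((ε / (4 * (B + 1))) ^ (1 / γ)) ^ γ :=
            Real.rpow_le_rpow hr0.le (min_le_right _ _) hγ0.le
        _ = ε / (4 * (B + 1)) := by
            rw [← Real.rpow_mul (by positivity), one_div_mul_cancel hγ0.ne', Real.rpow_one]
    calc B * r ^ γ ≤ (B + 1) * (ε / (4 * (B + 1))) := by gcongr; linarith
      _ = ε / 4 := by field_simp
  have hshort : ∀ a : ℝ, 1 ≤ a → ∀ s t : Icc (0 : ℝ) 1, s ≤ t → (t : ℝ) - s ≤ r →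
      B * ((t : ℝ) - s) ^ (a / p) ≤ ε / 4 * ((t : ℝ) - s) ^ (a / q) := by
    intro a ha s t hst htr
    have h0 := time_sub_nonneg hst
    have h1 : ((t : ℝ) - s) ^ (a / p) ≤ r ^ γ * ((t : ℝ) - s) ^ (a / q) := by
      have e : a / p = a * γ + a / q := by rw [hγ]; ring
      rw [e, Real.rpow_add_of_nonneg h0 (by positivity) (by positivity)]
      refine mul_le_mul_of_nonneg_right ?_ (Real.rpow_nonneg h0 _)
      calc ((t : ℝ) - s) ^ (a * γ) ≤ r ^ (a * γ) :=
            Real.rpow_le_rpow h0 htr (by positivity)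
        _ ≤ r ^ γ := Real.rpow_le_rpow_of_exponent_ge hr0 hr1 (by nlinarith)
    calc _ ≤ B * (r ^ γ * ((t : ℝ) - s) ^ (a / q)) := by gcongr
      _ = B * r ^ γ * ((t : ℝ) - s) ^ (a / q) := by ring
      _ ≤ _ := mul_le_mul_of_nonneg_right hrγ (time_rpow_nonneg hst _)
  -- On times longer than r the triangle inequality suffices: a remainder costs at most (2 + K) η,
  -- and the weight (t - s) ^ (a / q) is at least r ^ (2 / q).
  set η : ℝ := ε / 4 * r ^ (2 / q) / (2 + K) with hη
  have hη0 : 0 < η := by positivity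
  have hηK : (2 + K) * η = ε / 4 * r ^ (2 / q) := by rw [hη]; field_simp
  have hr2 : r ^ (2 / q) ≤ 1 := Real.rpow_le_one hr0.le hr1 (by positivity)
  have hlong : ∀ a : ℝ, 0 ≤ a → a ≤ 2 → ∀ s t : Icc (0 : ℝ) 1, r < (t : ℝ) - s →
      (2 + K) * η ≤ ε / 4 * ((t : ℝ) - s) ^ (a / q) := by
    intro a ha0 ha2 s t htr
    rw [hηK]
    refine mul_le_mul_of_nonneg_left ?_ (by positivity)
    calc r ^ (2 / q) ≤ r ^ (a / q) := Real.rpow_le_rpow_of_exponent_ge hr0 hr1 (by gcongr)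
      _ ≤ _ := Real.rpow_le_rpow hr0.le htr.le (by positivity)
  have hηε : η ≤ ε / 4 := by
    have h1 : 2 * η ≤ (2 + K) * η := by nlinarith
    have h2 : ε / 4 * r ^ (2 / q) ≤ ε / 4 := mul_le_of_le_one_right (by positivity) hr2
    linarith
  refine ⟨η, hη0, fun w hw hpath hder => ?_⟩
  have hs := seminorm_le_of_bounds (w := relaxPath hp hpq.le w) (a := ε / 4) (b := ε / 4)
    (c := ε / 4) (fun t => (hder t).trans hηε)
    ⟨by positivity, fun s t hst => ?_⟩ ⟨by positivity, fun s t hst => ?_⟩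
  · rw [norm_eq_seminorm_add]
    have := hpath 0
    rw [relaxPath_path]
    linarith
  · rcases le_or_gt ((t : ℝ) - s) r with h | h
    · exact (w.der_sub_le hst).trans ((mul_le_mul_of_nonneg_right hw (time_rpow_nonneg hst _)).trans
        (hshort 1 le_rfl s t hst h))
    · refine le_trans ?_ (hlong 1 zero_le_one one_le_two s t h)
      refine (norm_sub_le _ _).trans ?_
      have := hder t
      have := hder s
      simp only [relaxPath_der]
      nlinarith
  · rcases le_or_gt ((t : ℝ) - s) r with h | h
    · exact (w.rem_le hst).trans ((mul_le_mul_of_nonneg_right hw (time_rpow_nonneg hst _)).trans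
        (hshort 2 one_le_two s t hst h))
    · refine le_trans ?_ (hlong 2 zero_le_two le_rfl s t h)
      refine (norm_sub_le _ _).trans ((add_le_add (norm_sub_le _ _) le_rfl).trans ?_)
      have h1 := hpath t
      have h2 := hpath s
      have h3 : ‖w.der s (X.fst s t)‖ ≤ η * K := by
        refine (w.der s).le_of_opNorm_le_of_le (hder s) ((hK.fst_le s t hst).trans ?_)
        exact mul_le_of_le_one_right hK0 (time_rpow_le_one hst (by positivity))
      change ‖w.path t‖ + ‖w.path s‖ + ‖w.der s (X.fst s t)‖ ≤ _
      linarith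

section Mul

variable [hp : Fact (0 < p)]

/-- The derivative of the product of a path of linear maps and a path of vectors. -/
def mulDer (A : ControlledPath X (V →L[ℝ] W)) (h : ControlledPath X V) (t : Icc (0 : ℝ) 1) :
    E →L[ℝ] W :=
  (A.der t).flip (h.path t) + (A.path t).comp (h.der t)

/-- Leibniz rule: the remainder of A h is δA δh + R^A h + A R^h, and a product of two increments of
order 1/p has order 2/p. -/
theorem mul_bounds {K : ℝ} (hX : X.Bound K) (A : ControlledPath X (V →L[ℝ] W))
    (h : ControlledPath X V) :
    (∀ t, ‖mulDer A h t‖ ≤ 2 * (K + 1) ^ 2 * (‖A‖ * ‖h‖)) ∧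
    (0 ≤ 4 * (K + 1) ^ 2 * (‖A‖ * ‖h‖) ∧ ∀ s t, s ≤ t → ‖mulDer A h t - mulDer A h s‖ ≤
      4 * (K + 1) ^ 2 * (‖A‖ * ‖h‖) * ((t : ℝ) - s) ^ (1 / p)) ∧
    (0 ≤ 3 * (K + 1) ^ 2 * (‖A‖ * ‖h‖) ∧ ∀ s t, s ≤ t →
      ‖A.path t (h.path t) - A.path s (h.path s) - mulDer A h s (X.fst s t)‖ ≤
      3 * (K + 1) ^ 2 * (‖A‖ * ‖h‖) * ((t : ℝ) - s) ^ (2 / p)) := by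
  have hK := hX.nonneg
  obtain ⟨k, hk⟩ : ∃ k, k = K + 1 := ⟨_, rfl⟩
  have hk1 : 1 ≤ k := by linarith
  have hA0 := norm_nonneg A
  have hh0 := norm_nonneg h
  have hAp : ∀ t, ‖A.path t‖ ≤ k * ‖A‖ := fun t => hk ▸ A.path_le hX t
  have hhp : ∀ t, ‖h.path t‖ ≤ k * ‖h‖ := fun t => hk ▸ h.path_le hX t
  have hAd : ∀ t, ‖A.der t‖ ≤ ‖A‖ := fun t => (A.der_le t).trans A.seminorm_le_norm
  have hhd : ∀ t, ‖h.der t‖ ≤ ‖h‖ := fun t => (h.der_le t).trans h.seminorm_le_norm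
  have hkk : k ≤ k ^ 2 := by nlinarith
  have hAh : 0 ≤ ‖A‖ * ‖h‖ := by positivity
  have hkAh : k * (‖A‖ * ‖h‖) ≤ k ^ 2 * (‖A‖ * ‖h‖) := mul_le_mul_of_nonneg_right hkk hAh
  have h1Ah : ‖A‖ * ‖h‖ ≤ k ^ 2 * (‖A‖ * ‖h‖) := le_mul_of_one_le_left hAh (by nlinarith)
  have hfl : ∀ (B : E →L[ℝ] V →L[ℝ] W) (v : V), ‖B.flip v‖ ≤ ‖B‖ * ‖v‖ := fun B v =>
    (B.flip.le_opNorm v).trans_eq (by rw [ContinuousLinearMap.opNorm_flip])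
  rw [← hk]
  refine ⟨fun t => ?_, ⟨by positivity, fun s t hst => ?_⟩, ⟨by positivity, fun s t hst => ?_⟩⟩
  · have h1 : ‖(A.der t).flip (h.path t)‖ ≤ ‖A‖ * (k * ‖h‖) :=
      (hfl _ _).trans (mul_le_mul (hAd t) (hhp t) (norm_nonneg _) hA0)
    have h2 : ‖(A.path t).comp (h.der t)‖ ≤ k * ‖A‖ * ‖h‖ :=
      ((A.path t).opNorm_comp_le _).trans (mul_le_mul (hAp t) (hhd t) (norm_nonneg _)
        (by positivity))
    have := norm_add_le ((A.der t).flip (h.path t)) ((A.path t).comp (h.der t))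
    rw [mulDer]
    linarith
  · set τ := ((t : ℝ) - s) ^ (1 / p) with hτ
    have hτ0 : 0 ≤ τ := time_rpow_nonneg hst _
    have hdA : ‖A.der t - A.der s‖ ≤ ‖A‖ * τ := (A.der_sub_le hst).trans
      (mul_le_mul_of_nonneg_right A.seminorm_le_norm hτ0)
    have hdh : ‖h.der t - h.der s‖ ≤ ‖h‖ * τ := (h.der_sub_le hst).trans
      (mul_le_mul_of_nonneg_right h.seminorm_le_norm hτ0)
    have hpA : ‖A.path t - A.path s‖ ≤ k * ‖A‖ * τ := (A.path_sub_le hX hst).trans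
      (by rw [← hk]; gcongr; exact A.seminorm_le_norm)
    have hph : ‖h.path t - h.path s‖ ≤ k * ‖h‖ * τ := (h.path_sub_le hX hst).trans
      (by rw [← hk]; gcongr; exact h.seminorm_le_norm)
    have e : mulDer A h t - mulDer A h s = (A.der t - A.der s).flip (h.path t) +
        (A.der s).flip (h.path t - h.path s) + (A.path t - A.path s).comp (h.der t) +
        (A.path s).comp (h.der t - h.der s) := by
      ext x
      simp only [mulDer, add_apply, sub_apply, ContinuousLinearMap.flip_apply,
        ContinuousLinearMap.comp_apply, map_sub]
      abel
    rw [e]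
    have b1 : ‖(A.der t - A.der s).flip (h.path t)‖ ≤ ‖A‖ * τ * (k * ‖h‖) :=
      (hfl _ _).trans (mul_le_mul hdA (hhp t) (norm_nonneg _) (by positivity))
    have b2 : ‖(A.der s).flip (h.path t - h.path s)‖ ≤ ‖A‖ * (k * ‖h‖ * τ) :=
      (hfl _ _).trans (mul_le_mul (hAd s) hph (norm_nonneg _) (by positivity))
    have b3 : ‖(A.path t - A.path s).comp (h.der t)‖ ≤ k * ‖A‖ * τ * ‖h‖ :=
      ((A.path t - A.path s).opNorm_comp_le _).trans
        (mul_le_mul hpA (hhd t) (norm_nonneg _) (by positivity))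
    have b4 : ‖(A.path s).comp (h.der t - h.der s)‖ ≤ k * ‖A‖ * (‖h‖ * τ) :=
      ((A.path s).opNorm_comp_le _).trans
        (mul_le_mul (hAp s) hdh (norm_nonneg _) (by positivity))
    refine (norm_add_le_of_le (norm_add_le_of_le (norm_add_le_of_le b1 b2) b3) b4).trans ?_
    have := mul_le_mul_of_nonneg_right hkAh hτ0
    linarith
  · have hsq : ((t : ℝ) - s) ^ (2 / p) = ((t : ℝ) - s) ^ (1 / p) * ((t : ℝ) - s) ^ (1 / p) := by
      have hpi : 0 ≤ 1 / p := one_div_nonneg.2 hp.out.le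
      rw [← Real.rpow_add_of_nonneg (time_sub_nonneg hst) hpi hpi]
      congr 1
      ring
    have hRA := (A.rem_le hst).trans
      (mul_le_mul_of_nonneg_right A.seminorm_le_norm (time_rpow_nonneg hst _))
    have hRh := (h.rem_le hst).trans
      (mul_le_mul_of_nonneg_right h.seminorm_le_norm (time_rpow_nonneg hst _))
    rw [hsq] at hRA hRh ⊢
    set τ := ((t : ℝ) - s) ^ (1 / p) with hτ
    have hτ0 : 0 ≤ τ := time_rpow_nonneg hst _
    have hpA : ‖A.path t - A.path s‖ ≤ k * ‖A‖ * τ := (A.path_sub_le hX hst).trans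
      (by rw [← hk]; gcongr; exact A.seminorm_le_norm)
    have hph : ‖h.path t - h.path s‖ ≤ k * ‖h‖ * τ := (h.path_sub_le hX hst).trans
      (by rw [← hk]; gcongr; exact h.seminorm_le_norm)
    have e : A.path t (h.path t) - A.path s (h.path s) - mulDer A h s (X.fst s t) =
        (A.path t - A.path s) (h.path t - h.path s) +
        (A.path t - A.path s - A.der s (X.fst s t)) (h.path s) +
        A.path s (h.path t - h.path s - h.der s (X.fst s t)) := by
      simp only [mulDer, add_apply, sub_apply, ContinuousLinearMap.flip_apply,
        ContinuousLinearMap.comp_apply, map_sub]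
      abel
    rw [e]
    have b1 := (A.path t - A.path s).le_of_opNorm_le_of_le hpA hph
    have b2 := (A.path t - A.path s - A.der s (X.fst s t)).le_of_opNorm_le_of_le hRA (hhp s)
    have b3 := (A.path s).le_of_opNorm_le_of_le (hAp s) hRh
    refine (norm_add_le_of_le (norm_add_le_of_le b1 b2) b3).trans ?_
    have := mul_le_mul_of_nonneg_right hkAh (mul_nonneg hτ0 hτ0)
    linarith

/-- The product of a path of linear maps and a path of vectors. -/
def mul (A : ControlledPath X (V →L[ℝ] W)) (h : ControlledPath X V) : ControlledPath X W :=
  have H := mul_bounds X.exists_bound.choose_spec A h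
  ofBounds X (fun t => A.path t (h.path t)) (mulDer A h) H.1 H.2.1 H.2.2

@[simp] theorem mul_path (A : ControlledPath X (V →L[ℝ] W)) (h : ControlledPath X V) (t) :
    (mul A h).path t = A.path t (h.path t) := rfl

@[simp] theorem mul_der (A : ControlledPath X (V →L[ℝ] W)) (h : ControlledPath X V) (t) :
    (mul A h).der t = mulDer A h t := rfl

theorem norm_mul_le {K : ℝ} (hX : X.Bound K) (A : ControlledPath X (V →L[ℝ] W))
    (h : ControlledPath X V) : ‖mul A h‖ ≤ 10 * (K + 1) ^ 2 * ‖A‖ * ‖h‖ := by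
  obtain ⟨h1, h2, h3⟩ := mul_bounds hX A h
  have := seminorm_le_of_bounds (w := mul A h) h1 h2 h3
  rw [norm_eq_seminorm_add]
  have h0 : ‖(mul A h).path 0‖ ≤ ‖A‖ * ‖h‖ :=
    (A.path 0).le_of_opNorm_le_of_le A.path_zero_le h.path_zero_le
  have h4 : ‖A‖ * ‖h‖ ≤ (K + 1) ^ 2 * (‖A‖ * ‖h‖) :=
    le_mul_of_one_le_left (by positivity) (by nlinarith [hX.nonneg])
  linarith

variable (X V W) in
/-- The product as a continuous bilinear map. -/
def mulL : ControlledPath X (V →L[ℝ] W) →L[ℝ] ControlledPath X V →L[ℝ] ControlledPath X W :=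
  LinearMap.mkContinuous₂
    (LinearMap.mk₂ ℝ mul
      (fun A B h => by
        ext t
        · simp
        · simp only [mul_der, mulDer, der_add, path_add, add_apply,
            ContinuousLinearMap.flip_apply, ContinuousLinearMap.comp_apply]
          abel)
      (fun c A h => by
        ext t
        · simp
        · simp only [mul_der, mulDer, der_smul, path_smul, add_apply, smul_apply,
            ContinuousLinearMap.flip_apply, ContinuousLinearMap.comp_apply, smul_add])
      (fun A g h => by
        ext t
        · simp
        · simp only [mul_der, mulDer, der_add, path_add, add_apply, map_add,
            ContinuousLinearMap.flip_apply, ContinuousLinearMap.comp_apply]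
          abel)
      (fun c A h => by
        ext t
        · simp
        · simp only [mul_der, mulDer, der_smul, path_smul, add_apply, smul_apply, map_smul,
            ContinuousLinearMap.flip_apply, ContinuousLinearMap.comp_apply, smul_add]))
    (10 * (X.exists_bound.choose + 1) ^ 2) (norm_mul_le X.exists_bound.choose_spec)

/-- A linear map with values in controlled paths, seen as a controlled path of linear maps. -/
def flipPath (G : U →L[ℝ] ControlledPath X V) : ControlledPath X (U →L[ℝ] V) :=
  ofBounds X (fun t => (evalPath X V t).comp G) (fun t => ((evalDer X V t).comp G).flip)
    (a := ‖G‖) (b := ‖G‖) (c := ‖G‖)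
    (fun t => by
      rw [ContinuousLinearMap.opNorm_flip]
      refine ContinuousLinearMap.opNorm_le_bound _ (norm_nonneg _) fun u => ?_
      exact ((G u).der_le t).trans ((G u).seminorm_le_norm.trans (G.le_opNorm u)))
    ⟨norm_nonneg _, fun s t hst => by
      have e : ((evalDer X V t).comp G).flip - ((evalDer X V s).comp G).flip =
        ((evalDer X V t).comp G - (evalDer X V s).comp G).flip := rfl
      rw [e, ContinuousLinearMap.opNorm_flip]
      refine ContinuousLinearMap.opNorm_le_bound _
        (mul_nonneg (norm_nonneg _) (time_rpow_nonneg hst _)) fun u => ?_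
      refine ((G u).der_sub_le hst).trans ?_
      rw [mul_right_comm]
      exact mul_le_mul_of_nonneg_right ((G u).seminorm_le_norm.trans (G.le_opNorm u))
        (time_rpow_nonneg hst _)⟩
    ⟨norm_nonneg _, fun s t hst => by
      refine ContinuousLinearMap.opNorm_le_bound _
        (mul_nonneg (norm_nonneg _) (time_rpow_nonneg hst _)) fun u => ?_
      refine ((G u).rem_le hst).trans ?_
      rw [mul_right_comm]
      exact mul_le_mul_of_nonneg_right ((G u).seminorm_le_norm.trans (G.le_opNorm u))
        (time_rpow_nonneg hst _)⟩

@[simp] theorem flipPath_path (G : U →L[ℝ] ControlledPath X V) (t) (u : U) :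
    (flipPath G).path t u = (G u).path t := rfl

@[simp] theorem flipPath_der (G : U →L[ℝ] ControlledPath X V) (t) (e : E) (u : U) :
    (flipPath G).der t e u = (G u).der t e := rfl

theorem norm_flipPath_le (G : U →L[ℝ] ControlledPath X V) : ‖flipPath G‖ ≤ 4 * ‖G‖ := by
  have h0 : ‖(flipPath G).path 0‖ ≤ ‖G‖ :=
    ContinuousLinearMap.opNorm_le_bound _ (norm_nonneg _) fun u =>
      (G u).path_zero_le.trans (G.le_opNorm u)
  have h := seminorm_le_of_bounds (w := flipPath G) (a := ‖G‖) (b := ‖G‖) (c := ‖G‖)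
    (fun t => by
      change ‖((evalDer X V t).comp G).flip‖ ≤ _
      rw [ContinuousLinearMap.opNorm_flip]
      refine ContinuousLinearMap.opNorm_le_bound _ (norm_nonneg _) fun u => ?_
      exact ((G u).der_le t).trans ((G u).seminorm_le_norm.trans (G.le_opNorm u)))
    ⟨norm_nonneg _, fun s t hst => by
      change ‖((evalDer X V t).comp G - (evalDer X V s).comp G).flip‖ ≤ _
      rw [ContinuousLinearMap.opNorm_flip]
      refine ContinuousLinearMap.opNorm_le_bound _
        (mul_nonneg (norm_nonneg _) (time_rpow_nonneg hst _)) fun u => ?_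
      refine ((G u).der_sub_le hst).trans ?_
      rw [mul_right_comm]
      exact mul_le_mul_of_nonneg_right ((G u).seminorm_le_norm.trans (G.le_opNorm u))
        (time_rpow_nonneg hst _)⟩
    ⟨norm_nonneg _, fun s t hst => by
      refine ContinuousLinearMap.opNorm_le_bound _
        (mul_nonneg (norm_nonneg _) (time_rpow_nonneg hst _)) fun u => ?_
      refine ((G u).rem_le hst).trans ?_
      rw [mul_right_comm]
      exact mul_le_mul_of_nonneg_right ((G u).seminorm_le_norm.trans (G.le_opNorm u))
        (time_rpow_nonneg hst _)⟩
  rw [norm_eq_seminorm_add]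
  linarith

variable (X U V) in
/-- `flipPath` as a continuous linear map. -/
def flipL : (U →L[ℝ] ControlledPath X V) →L[ℝ] ControlledPath X (U →L[ℝ] V) :=
  LinearMap.mkContinuous
    { toFun := flipPath, map_add' := fun _ _ => rfl, map_smul' := fun _ _ => rfl } 4
    norm_flipPath_le

end Mul
end ControlledPath

end Operations

/-! ### Calculus for Lipschitz functions -/

namespace LipMap

section Calculus

variable {V W : Type*} [NormedAddCommGroup V] [NormedSpace ℝ V]
  [NormedAddCommGroup W] [NormedSpace ℝ W] {m n : ℕ} {δ : ℝ}

theorem ext {f g : LipMap V W m δ} (h : ∀ x, f.fn x = g.fn x) : f = g := Subtype.ext (funext h)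

@[simp] theorem fn_add_apply (f g : LipMap V W m δ) (x : V) : (f + g).fn x = f.fn x + g.fn x := rfl

@[simp] theorem fn_smul_apply (c : ℝ) (f : LipMap V W m δ) (x : V) :
    (c • f).fn x = c • f.fn x := rfl

theorem supNorm_iteratedFDeriv_le (f : LipMap V W m δ) {j : ℕ} (hj : j ≤ m) :
    supNorm (iteratedFDeriv ℝ j f.fn) ≤ ‖f‖ := by
  have h1 : supNorm (iteratedFDeriv ℝ j f.fn) ≤
      ∑ j ∈ Finset.range (m + 1), supNorm (iteratedFDeriv ℝ j f.fn) :=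
    Finset.single_le_sum (f := fun j => supNorm (iteratedFDeriv ℝ j f.fn))
      (fun j _ => supNorm_nonneg _) (Finset.mem_range.2 (Nat.lt_succ_of_le hj))
  have h2 := supNorm_nonneg (topQuotient m δ f.fn)
  rw [norm_def]
  linarith

theorem norm_iteratedFDeriv_le (f : LipMap V W m δ) {j : ℕ} (hj : j ≤ m) (x : V) :
    ‖iteratedFDeriv ℝ j f.fn x‖ ≤ ‖f‖ :=
  (le_supNorm (f.bdd_deriv hj) x).trans (f.supNorm_iteratedFDeriv_le hj)

theorem norm_top_sub_le (f : LipMap V W m 1) (x y : V) :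
    ‖iteratedFDeriv ℝ m f.fn x - iteratedFDeriv ℝ m f.fn y‖ ≤ ‖f‖ * ‖x - y‖ := by
  rcases eq_or_ne x y with rfl | hxy
  · simp
  have hpos : 0 < ‖x - y‖ := norm_sub_pos_iff.2 hxy
  have h1 := le_supNorm f.bdd_quotient (x, y)
  rw [topQuotient, Real.rpow_one, norm_smul, norm_inv, norm_norm, inv_mul_le_iff₀ hpos,
    mul_comm] at h1
  refine h1.trans (mul_le_mul_of_nonneg_right ?_ hpos.le)
  have h2 : 0 ≤ ∑ j ∈ Finset.range (m + 1), supNorm (iteratedFDeriv ℝ j f.fn) :=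
    Finset.sum_nonneg fun _ _ => supNorm_nonneg _
  rw [norm_def]
  linarith

theorem norm_topQuotient_one_le {f : V → W} {C : ℝ} (hC : 0 ≤ C)
    (h : ∀ x y, ‖iteratedFDeriv ℝ m f x - iteratedFDeriv ℝ m f y‖ ≤ C * ‖x - y‖) (i) :
    ‖topQuotient m 1 f i‖ ≤ C := by
  rw [topQuotient, Real.rpow_one, norm_smul, norm_inv, norm_norm]
  rcases (norm_nonneg (i.1 - i.2)).eq_or_lt with h0 | hpos
  · rw [← h0, inv_zero, zero_mul]
    exact hC
  · rw [inv_mul_le_iff₀ hpos, mul_comm]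
    exact h _ _

/-- The m-th derivative of `fderiv ℝ f` is the (m+1)-st derivative of f up to a linear isometry. -/
theorem norm_topQuotient_fderiv (f : V → W) (i) :
    ‖topQuotient m δ (fderiv ℝ f) i‖ = ‖topQuotient (m + 1) δ f i‖ := by
  rw [topQuotient, topQuotient, norm_smul, norm_smul, iteratedFDeriv_succ_eq_comp_right,
    iteratedFDeriv_succ_eq_comp_right, Function.comp_apply, Function.comp_apply]
  refine congrArg _ ((LinearIsometryEquiv.norm_map
    (continuousMultilinearCurryRightEquiv' ℝ m V W).symm _).symm.trans (congrArg _ ?_))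
  exact (continuousMultilinearCurryRightEquiv' ℝ m V W).symm.map_sub _ _

theorem differentiable_fn (f : LipMap V W (n + 1) δ) : Differentiable ℝ f.fn :=
  f.contDiff_fn.differentiable (by simp)

/-- The derivative of a Lipschitz function. -/
def fderivMap (f : LipMap V W (n + 1) δ) : LipMap V (V →L[ℝ] W) n δ :=
  ⟨fderiv ℝ f.fn, f.contDiff_fn.fderiv_right (by norm_cast),
    fun j hj => by
      obtain ⟨C, hC⟩ := f.bdd_deriv (Nat.succ_le_succ hj)
      exact ⟨C, fun x => (norm_iteratedFDeriv_fderiv (𝕜 := ℝ) (f := f.fn)).trans_le (hC x)⟩,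
    by
      obtain ⟨C, hC⟩ := f.bdd_quotient
      exact ⟨C, fun x => (norm_topQuotient_fderiv _ _).trans_le (hC x)⟩⟩

theorem fn_fderivMap (f : LipMap V W (n + 1) δ) : f.fderivMap.fn = fderiv ℝ f.fn := rfl

theorem hasFDerivAt (f : LipMap V W (n + 1) δ) (x : V) :
    HasFDerivAt f.fn (f.fderivMap.fn x) x :=
  (f.differentiable_fn x).hasFDerivAt

theorem norm_fderivMap_le (f : LipMap V W (n + 1) δ) : ‖f.fderivMap‖ ≤ ‖f‖ := by
  rw [norm_def, norm_def, Finset.sum_range_succ' _ (n + 1), fn_fderivMap]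
  have h1 : ∀ j, supNorm (iteratedFDeriv ℝ j (fderiv ℝ f.fn)) =
      supNorm (iteratedFDeriv ℝ (j + 1) f.fn) := fun j =>
    iSup_congr fun x => norm_iteratedFDeriv_fderiv
  have h2 : supNorm (topQuotient n δ (fderiv ℝ f.fn)) = supNorm (topQuotient (n + 1) δ f.fn) :=
    iSup_congr fun x => norm_topQuotient_fderiv _ _
  have h3 := supNorm_nonneg (iteratedFDeriv ℝ 0 f.fn)
  simp only [h1, h2]
  linarith

variable (V W n δ) in
/-- The derivative as a continuous linear map. -/
def fderivL : LipMap V W (n + 1) δ →L[ℝ] LipMap V (V →L[ℝ] W) n δ :=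
  LinearMap.mkContinuous
    { toFun := fderivMap
      map_add' := fun f g => ext fun x =>
        fderiv_add (f.differentiable_fn x) (g.differentiable_fn x)
      map_smul' := fun c f => ext fun x => fderiv_const_smul (f.differentiable_fn x) c } 1
    fun f => by
      rw [one_mul]
      exact f.norm_fderivMap_le

@[simp] theorem fderivL_apply (f : LipMap V W (n + 1) δ) : fderivL V W n δ f = f.fderivMap := rfl

/-- For order 0 the function is its own top derivative and the bound is the top quotient. Otherwise
it is the mean value inequality. -/
theorem norm_sub_le : ∀ {n : ℕ} (f : LipMap V W n 1) (x y : V),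
    ‖f.fn x - f.fn y‖ ≤ ‖f‖ * ‖x - y‖
  | 0, f, x, y => by
    refine le_trans (le_of_eq ?_) (f.norm_top_sub_le x y)
    rw [iteratedFDeriv_zero_eq_comp, Function.comp_apply, Function.comp_apply, ← map_sub,
      LinearIsometryEquiv.norm_map]
  | n + 1, f, x, y =>
    convex_univ.norm_image_sub_le_of_norm_hasFDerivWithin_le
      (fun z _ => (f.hasFDerivAt z).hasFDerivWithinAt)
      (fun z _ => (f.fderivMap.norm_fn_le z).trans f.norm_fderivMap_le) (mem_univ y) (mem_univ x)

/-- Mean value inequality on the ball of radius ‖y - x‖ around x, where f' differs from f'(x) by at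
most ‖f‖ ‖y - x‖. -/
theorem norm_taylor_le (f : LipMap V W (n + 1) 1) (x y : V) :
    ‖f.fn y - f.fn x - f.fderivMap.fn x (y - x)‖ ≤ ‖f‖ * ‖y - x‖ ^ 2 := by
  have h := (convex_closedBall x ‖y - x‖).norm_image_sub_le_of_norm_hasFDerivWithin_le'
    (φ := f.fderivMap.fn x) (C := ‖f‖ * ‖y - x‖) (x := x) (y := y)
    (fun z _ => (f.hasFDerivAt z).hasFDerivWithinAt)
    (fun z hz => by
      refine (f.fderivMap.norm_sub_le z x).trans ?_
      refine mul_le_mul f.norm_fderivMap_le ?_ (norm_nonneg _) (norm_nonneg _)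
      rw [← dist_eq_norm]
      exact hz) (Metric.mem_closedBall_self (norm_nonneg _))
    (by rw [Metric.mem_closedBall, dist_eq_norm])
  rwa [mul_assoc, ← sq] at h

/-- Lowering of the regularity from `m + 1` bounded derivatives to `(m, 1)`. -/
def lower (f : LipMap V W (m + 1) δ) : LipMap V W m 1 :=
  ⟨f.fn, f.contDiff_fn.of_le (by norm_cast; omega), fun j hj => f.bdd_deriv (hj.trans m.le_succ),
    ⟨‖f‖, norm_topQuotient_one_le (norm_nonneg f) fun x y =>
      convex_univ.norm_image_sub_le_of_norm_hasFDerivWithin_le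
        (fun z _ => ((f.contDiff_fn.differentiable_iteratedFDeriv
          (by norm_cast; omega) z).hasFDerivAt).hasFDerivWithinAt)
        (fun z _ => norm_fderiv_iteratedFDeriv.trans_le (f.norm_iteratedFDeriv_le le_rfl z))
        (mem_univ y) (mem_univ x)⟩⟩

@[simp] theorem fn_lower (f : LipMap V W (m + 1) δ) : f.lower.fn = f.fn := rfl

theorem norm_lower_le (f : LipMap V W (m + 1) δ) : ‖f.lower‖ ≤ 2 * ‖f‖ := by
  have h1 : supNorm (topQuotient m 1 f.lower.fn) ≤ ‖f‖ :=
    supNorm_le (norm_nonneg f) (norm_topQuotient_one_le (norm_nonneg f) fun x y =>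
      convex_univ.norm_image_sub_le_of_norm_hasFDerivWithin_le
        (fun z _ => ((f.contDiff_fn.differentiable_iteratedFDeriv
          (by norm_cast; omega) z).hasFDerivAt).hasFDerivWithinAt)
        (fun z _ => norm_fderiv_iteratedFDeriv.trans_le (f.norm_iteratedFDeriv_le le_rfl z))
        (mem_univ y) (mem_univ x))
  have h2 : ∑ j ∈ Finset.range (m + 1), supNorm (iteratedFDeriv ℝ j f.lower.fn) ≤ ‖f‖ := by
    rw [norm_def, Finset.sum_range_succ _ (m + 1), fn_lower]
    have := supNorm_nonneg (iteratedFDeriv ℝ (m + 1) f.fn)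
    have := supNorm_nonneg (topQuotient (m + 1) δ f.fn)
    linarith
  rw [norm_def]
  linarith

variable (V W m δ) in
/-- `lower` as a continuous linear map. -/
def lowerL : LipMap V W (m + 1) δ →L[ℝ] LipMap V W m 1 :=
  LinearMap.mkContinuous
    { toFun := lower, map_add' := fun _ _ => rfl, map_smul' := fun _ _ => rfl } 2 norm_lower_le

end Calculus

end LipMap

/-! ### The derivative of a one-form in its base point -/

section Form

variable {U V : Type*} [NormedAddCommGroup U] [NormedSpace ℝ U]
  [NormedAddCommGroup V] [NormedSpace ℝ V] {m n : ℕ} {δ : ℝ}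

/-- The Taylor remainder of F(u) is at most ‖F‖ ‖u‖ ‖y - x‖². The uniformity in u assembles the
derivatives of the single F(u) into a derivative in operator norm. -/
theorem hasFDerivAt_formAt (F : U →L[ℝ] LipMap V V (n + 1) 1) (x : V) :
    HasFDerivAt (formAt F)
      ((LipMap.evalAt x).comp ((LipMap.fderivL V V n 1).comp F)).flip x := by
  refine HasFDerivAt.of_isLittleO ?_
  refine Asymptotics.IsBigO.trans_isLittleO (g := fun y => ‖y - x‖ ^ 2) ?_ ?_
  · refine Asymptotics.IsBigO.of_bound ‖F‖ (Filter.Eventually.of_forall fun y => ?_)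
    rw [Real.norm_of_nonneg (sq_nonneg _)]
    refine ContinuousLinearMap.opNorm_le_bound _ (by positivity) fun u => ?_
    refine ((F u).norm_taylor_le x y).trans ?_
    rw [mul_right_comm]
    exact mul_le_mul_of_nonneg_right (F.le_opNorm u) (sq_nonneg _)
  · have h := (Asymptotics.isLittleO_norm_pow_id (E' := V) one_lt_two).comp_tendsto
      (tendsto_sub_nhds_zero_iff.2 Filter.tendsto_id : Filter.Tendsto (fun y => y - x) (nhds x) _)
    exact h

end Form

/-! ### Composition of controlled paths with Lipschitz functions -/

namespace ControlledPath

section Comp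

variable {E E2 : Type*} [NormedAddCommGroup E] [NormedSpace ℝ E]
  [NormedAddCommGroup E2] [NormedSpace ℝ E2] {T : TensorSquare E E2} {p q : ℝ}
  {X : RoughPath T p} {V W : Type*} [NormedAddCommGroup V] [NormedSpace ℝ V]
  [NormedAddCommGroup W] [NormedSpace ℝ W] {n : ℕ} [hp : Fact (0 < p)]

/-- The derivative of the composition of a controlled path with a function. -/
def compDer (f : LipMap V W (n + 1) 1) (z : ControlledPath X V) (t : Icc (0 : ℝ) 1) : E →L[ℝ] W :=
  (f.fderivMap.fn (z.path t)).comp (z.der t)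

/-- Chain rule: the remainder of f(z) is the Taylor remainder of f, quadratic in the increment of z,
plus f'(z_s) applied to the remainder of z. Every bound is linear in ‖f‖, which allows f ∘ z to be
treated as an operator acting on f. -/
theorem comp_bounds {K : ℝ} (hX : X.Bound K) (f : LipMap V W (n + 1) 1)
    (z : ControlledPath X V) :
    (∀ t, ‖compDer f z t‖ ≤ ‖f‖ * z.seminorm) ∧
    (0 ≤ ‖f‖ * ((K + 1) * z.seminorm ^ 2 + z.seminorm) ∧ ∀ s t, s ≤ t →
      ‖compDer f z t - compDer f z s‖ ≤
        ‖f‖ * ((K + 1) * z.seminorm ^ 2 + z.seminorm) * ((t : ℝ) - s) ^ (1 / p)) ∧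
    (0 ≤ ‖f‖ * (((K + 1) * z.seminorm) ^ 2 + z.seminorm) ∧ ∀ s t, s ≤ t →
      ‖f.fn (z.path t) - f.fn (z.path s) - compDer f z s (X.fst s t)‖ ≤
        ‖f‖ * (((K + 1) * z.seminorm) ^ 2 + z.seminorm) * ((t : ℝ) - s) ^ (2 / p)) := by
  have hK := hX.nonneg
  have hf := norm_nonneg f
  have hS := z.seminorm_nonneg
  have hD : ∀ x, ‖f.fderivMap.fn x‖ ≤ ‖f‖ := fun x =>
    (f.fderivMap.norm_fn_le x).trans f.norm_fderivMap_le
  refine ⟨fun t => ?_, ⟨by positivity, fun s t hst => ?_⟩, ⟨by positivity, fun s t hst => ?_⟩⟩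
  · exact (ContinuousLinearMap.opNorm_comp_le _ _).trans
      (mul_le_mul (hD _) (z.der_le t) (norm_nonneg _) hf)
  · have e : compDer f z t - compDer f z s =
        (f.fderivMap.fn (z.path t) - f.fderivMap.fn (z.path s)).comp (z.der t) +
        (f.fderivMap.fn (z.path s)).comp (z.der t - z.der s) := by
      ext x
      simp [compDer]
    rw [e]
    have b1 : ‖f.fderivMap.fn (z.path t) - f.fderivMap.fn (z.path s)‖ ≤
        ‖f‖ * ((K + 1) * z.seminorm * ((t : ℝ) - s) ^ (1 / p)) :=
      (f.fderivMap.norm_sub_le _ _).trans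
        (mul_le_mul f.norm_fderivMap_le (z.path_sub_le hX hst) (norm_nonneg _) hf)
    have b2 := (ContinuousLinearMap.opNorm_comp_le
      (f.fderivMap.fn (z.path t) - f.fderivMap.fn (z.path s)) (z.der t)).trans
        (mul_le_mul b1 (z.der_le t) (norm_nonneg _) ((norm_nonneg _).trans b1))
    have b3 := (ContinuousLinearMap.opNorm_comp_le (f.fderivMap.fn (z.path s))
      (z.der t - z.der s)).trans
        (mul_le_mul (hD _) (z.der_sub_le hst) (norm_nonneg _) hf)
    refine (norm_add_le_of_le b2 b3).trans (le_of_eq ?_)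
    ring
  · have hsq : ((t : ℝ) - s) ^ (2 / p) = (((t : ℝ) - s) ^ (1 / p)) ^ 2 := by
      have hpi : 0 ≤ 1 / p := one_div_nonneg.2 hp.out.le
      rw [sq, ← Real.rpow_add_of_nonneg (time_sub_nonneg hst) hpi hpi]
      congr 1
      ring
    have e : f.fn (z.path t) - f.fn (z.path s) - compDer f z s (X.fst s t) =
        (f.fn (z.path t) - f.fn (z.path s) - f.fderivMap.fn (z.path s) (z.path t - z.path s)) +
        f.fderivMap.fn (z.path s) (z.path t - z.path s - z.der s (X.fst s t)) := by
      simp only [compDer, ContinuousLinearMap.comp_apply, map_sub]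
      abel
    rw [e]
    have b1 := (f.norm_taylor_le (z.path s) (z.path t)).trans
      (mul_le_mul_of_nonneg_left (pow_le_pow_left₀ (norm_nonneg _) (z.path_sub_le hX hst) 2) hf)
    have b2 := (f.fderivMap.fn (z.path s)).le_of_opNorm_le_of_le (hD _) (z.rem_le hst)
    refine (norm_add_le_of_le b1 b2).trans (le_of_eq ?_)
    rw [hsq]
    ring

/-- The composition of a controlled path with a Lipschitz function. -/
def compPath (f : LipMap V W (n + 1) 1) (z : ControlledPath X V) : ControlledPath X W :=
  have H := comp_bounds X.exists_bound.choose_spec f z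
  ofBounds X (fun t => f.fn (z.path t)) (compDer f z) H.1 H.2.1 H.2.2

@[simp] theorem compPath_path (f : LipMap V W (n + 1) 1) (z : ControlledPath X V) (t) :
    (compPath f z).path t = f.fn (z.path t) := rfl

@[simp] theorem compPath_der (f : LipMap V W (n + 1) 1) (z : ControlledPath X V) (t) :
    (compPath f z).der t = (f.fderivMap.fn (z.path t)).comp (z.der t) := rfl

theorem norm_compPath_le {K : ℝ} (hX : X.Bound K) (z : ControlledPath X V)
    (f : LipMap V W (n + 1) 1) :
    ‖compPath f z‖ ≤ 3 * (K + 1) ^ 2 * (1 + z.seminorm) ^ 2 * ‖f‖ := by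
  obtain ⟨h1, h2, h3⟩ := comp_bounds hX f z
  have h := seminorm_le_of_bounds (w := compPath f z) h1 h2 h3
  have h0 : ‖(compPath f z).path 0‖ ≤ ‖f‖ := f.norm_fn_le _
  rw [norm_eq_seminorm_add]
  refine (add_le_add h h0).trans ?_
  have hk : 1 ≤ K + 1 := by linarith [hX.nonneg]
  have hS := z.seminorm_nonneg
  have h4 : z.seminorm + ((K + 1) * z.seminorm ^ 2 + z.seminorm) +
      (((K + 1) * z.seminorm) ^ 2 + z.seminorm) + 1 ≤
      3 * (K + 1) ^ 2 * (1 + z.seminorm) ^ 2 := by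
    have e1 : (K + 1) * z.seminorm ^ 2 ≤ (K + 1) ^ 2 * z.seminorm ^ 2 :=
      mul_le_mul_of_nonneg_right (by nlinarith) (sq_nonneg _)
    have e2 : z.seminorm ≤ (K + 1) ^ 2 * z.seminorm :=
      le_mul_of_one_le_left hS (by nlinarith)
    have e3 : 1 ≤ (K + 1) ^ 2 := by nlinarith
    have e4 : 0 ≤ (K + 1) ^ 2 * z.seminorm ^ 2 := by positivity
    nlinarith
  have := mul_le_mul_of_nonneg_right h4 (norm_nonneg f)
  linarith

/-- The composition map, linear in the function. -/
def compL (W : Type*) [NormedAddCommGroup W] [NormedSpace ℝ W] (n : ℕ)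
    (z : ControlledPath X V) : LipMap V W (n + 1) 1 →L[ℝ] ControlledPath X W :=
  LinearMap.mkContinuous
    { toFun := fun f => compPath f z
      map_add' := fun f g => by
        ext t
        · simp
        · simp only [compPath_der, der_add, ← LipMap.fderivL_apply, map_add, LipMap.fn_add_apply,
            ContinuousLinearMap.add_comp]
      map_smul' := fun c f => by
        ext t
        · simp
        · simp only [compPath_der, der_smul, ← LipMap.fderivL_apply, map_smul, LipMap.fn_smul_apply,
            ContinuousLinearMap.smul_comp, RingHom.id_apply] }
    (3 * (X.exists_bound.choose + 1) ^ 2 * (1 + z.seminorm) ^ 2)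
    (norm_compPath_le X.exists_bound.choose_spec z)

variable (hpq : p < q)

/-- The composition map, with values in the paths controlled at the lower regularity `1 / q`. -/
def compRelax (W : Type*) [NormedAddCommGroup W] [NormedSpace ℝ W] (n : ℕ)
    (z : ControlledPath X V) :
    LipMap V W (n + 1) 1 →L[ℝ] ControlledPath (X.relax hp.out hpq.le) W :=
  (relaxL X W hp.out hpq.le).comp (compL W n z)

@[simp] theorem compRelax_apply (z : ControlledPath X V) (f : LipMap V W (n + 1) 1) :
    compRelax hpq W n z f = relaxPath hp.out hpq.le (compPath f z) := rfl

theorem norm_compRelax_le {K : ℝ} (hX : X.Bound K) (z : ControlledPath X V) :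
    ‖compRelax hpq W n z‖ ≤ 9 * (K + 1) ^ 2 * (1 + z.seminorm) ^ 2 := by
  refine ContinuousLinearMap.opNorm_le_bound _ (by positivity) fun f => ?_
  rw [compRelax_apply]
  refine (norm_relaxPath_le _ _ _).trans ?_
  have := norm_compPath_le hX z f
  linarith

/-- A Lipschitz f' makes f'(w) - f'(z) uniformly small, while its Hölder bound is only kept bounded.
Interpolation then gives smallness at roughness q, uniformly over ‖f‖ = 1, that is in operator norm.
-/
theorem continuous_compRelax (n : ℕ) :
    Continuous (compRelax hpq W n : ControlledPath X V → _) := by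
  refine Metric.continuous_iff.2 fun z ε hε => ?_
  obtain ⟨K, hX⟩ := X.exists_bound
  have hK := hX.nonneg
  have hS := z.seminorm_nonneg
  set S := z.seminorm with hSdef
  set B : ℝ := 2 * (3 * (K + 1) ^ 2 * (2 + S) ^ 2) with hB
  obtain ⟨η, hη, H⟩ := exists_norm_relaxPath_le (V := W) hp.out hpq X (B := B) (ε := ε / 2)
    (by positivity) (by positivity)
  set κ : ℝ := (K + 1) * (2 + S) with hκ
  have hκ0 : 0 < κ := by positivity
  refine ⟨min 1 (η / κ), lt_min one_pos (by positivity), fun w hw => ?_⟩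
  rw [dist_eq_norm] at hw
  have hw1 : ‖w - z‖ ≤ 1 := hw.le.trans (min_le_left _ _)
  have hw2 : κ * ‖w - z‖ ≤ η := by
    have := hw.le.trans (min_le_right _ _)
    rwa [le_div_iff₀ hκ0, mul_comm] at this
  have hSw : w.seminorm ≤ 1 + S := by
    have h1 := seminorm_add_le (w - z) z
    rw [sub_add_cancel] at h1
    linarith [(w - z).seminorm_le_norm]
  have hpath : ∀ t, ‖w.path t - z.path t‖ ≤ (K + 1) * ‖w - z‖ := fun t =>
    (w - z).path_le hX t
  have hder : ∀ t, ‖w.der t - z.der t‖ ≤ ‖w - z‖ := fun t =>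
    ((w - z).der_le t).trans (w - z).seminorm_le_norm
  rw [dist_eq_norm]
  refine lt_of_le_of_lt (ContinuousLinearMap.opNorm_le_of_unit_norm (C := ε / 2)
    (by positivity) fun f hf => ?_) (by linarith)
  have e : (compRelax hpq W n w - compRelax hpq W n z) f =
      relaxPath hp.out hpq.le (compPath f w - compPath f z) := rfl
  rw [e]
  have hD : ∀ x, ‖f.fderivMap.fn x‖ ≤ 1 := fun x =>
    (f.fderivMap.norm_fn_le x).trans (f.norm_fderivMap_le.trans_eq hf)
  have hwz := norm_nonneg (w - z)
  refine H _ ?_ (fun t => ?_) (fun t => ?_)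
  · refine (seminorm_le_norm _).trans ((norm_sub_le _ _).trans ?_)
    have h1 := norm_compPath_le hX w f
    have h2 := norm_compPath_le hX z f
    rw [hf, mul_one] at h1 h2
    have h3 : 3 * (K + 1) ^ 2 * (1 + w.seminorm) ^ 2 ≤ 3 * (K + 1) ^ 2 * (2 + S) ^ 2 := by
      have := w.seminorm_nonneg
      exact mul_le_mul_of_nonneg_left (pow_le_pow_left₀ (by linarith) (by linarith) 2)
        (by positivity)
    have h4 : 3 * (K + 1) ^ 2 * (1 + S) ^ 2 ≤ 3 * (K + 1) ^ 2 * (2 + S) ^ 2 :=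
      mul_le_mul_of_nonneg_left (pow_le_pow_left₀ (by linarith) (by linarith) 2)
        (by positivity)
    linarith
  · refine (f.norm_sub_le _ _).trans ?_
    rw [hf, one_mul]
    refine (hpath t).trans (le_trans ?_ hw2)
    refine mul_le_mul_of_nonneg_right ?_ hwz
    nlinarith
  · have e : (compPath f w - compPath f z).der t =
        (f.fderivMap.fn (w.path t) - f.fderivMap.fn (z.path t)).comp (w.der t) +
        (f.fderivMap.fn (z.path t)).comp (w.der t - z.der t) := by
      ext x
      simp
    rw [e]
    have b1 : ‖f.fderivMap.fn (w.path t) - f.fderivMap.fn (z.path t)‖ ≤ (K + 1) * ‖w - z‖ := by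
      refine (f.fderivMap.norm_sub_le _ _).trans ?_
      refine le_trans (mul_le_of_le_one_left (norm_nonneg _) ?_) (hpath t)
      exact f.norm_fderivMap_le.trans_eq hf
    have b2 := (ContinuousLinearMap.opNorm_comp_le
      (f.fderivMap.fn (w.path t) - f.fderivMap.fn (z.path t)) (w.der t)).trans
        (mul_le_mul b1 ((w.der_le t).trans hSw) (norm_nonneg _) (by positivity))
    have b3 := (ContinuousLinearMap.opNorm_comp_le (f.fderivMap.fn (z.path t))
      (w.der t - z.der t)).trans
        (mul_le_mul (hD _) (hder t) (norm_nonneg _) zero_le_one)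
    refine (norm_add_le_of_le b2 b3).trans (le_trans ?_ hw2)
    have : 0 ≤ K * ‖w - z‖ := by positivity
    rw [hκ]
    linarith

theorem exists_ball_norm_sub_le {A B : Type*} [NormedAddCommGroup A] [NormedAddCommGroup B]
    {φ : A → B} (hφ : Continuous φ) (z : A) {ε : ℝ} (hε : 0 < ε) :
    ∃ r > 0, ∀ x ∈ Metric.ball z r, ‖φ x - φ z‖ ≤ ε := by
  obtain ⟨r, hr, h⟩ := Metric.continuous_iff.1 hφ z ε hε
  exact ⟨r, hr, fun x hx => by
    rw [← dist_eq_norm]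
    exact (h x hx).le⟩

/-- A mean value inequality for functionals of a map that is weakly differentiable. -/
theorem norm_image_sub_le_of_weak {A B G : Type*} [NormedAddCommGroup A] [NormedSpace ℝ A]
    [NormedAddCommGroup B] [NormedSpace ℝ B] [NormedAddCommGroup G] [NormedSpace ℝ G]
    {φ : A → B} {φ' : A → A →L[ℝ] B} {s : Set A} (hs : Convex ℝ s) (ℓ : B →L[ℝ] G) {κ C : ℝ}
    (hκ : 0 ≤ κ) (hℓ : ∀ b, ‖ℓ b‖ ≤ κ * ‖b‖)
    (h : ∀ x ∈ s, HasFDerivAt (fun x => ℓ (φ x)) (ℓ.comp (φ' x)) x) {z w : A} (hz : z ∈ s)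
    (hw : w ∈ s) (hC : ∀ x ∈ s, ‖φ' x - φ' z‖ ≤ C) :
    ‖ℓ (φ w - φ z - φ' z (w - z))‖ ≤ κ * C * ‖w - z‖ := by
  have := hs.norm_image_sub_le_of_norm_hasFDerivWithin_le' (φ := ℓ.comp (φ' z)) (C := κ * C)
    (fun x hx => (h x hx).hasFDerivWithinAt) (fun x hx => ?_) hz hw
  · simpa only [map_sub, ContinuousLinearMap.comp_apply] using this
  · rw [← ContinuousLinearMap.comp_sub]
    refine ContinuousLinearMap.opNorm_le_bound _
      (mul_nonneg hκ ((norm_nonneg _).trans (hC x hx))) fun a => ?_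
    refine (hℓ _).trans ?_
    rw [mul_assoc]
    exact mul_le_mul_of_nonneg_left ((φ' x - φ' z).le_of_opNorm_le (hC x hx) a) hκ

/-- The norm is built from linear functionals: values and increments of the derivative, remainders,
and the initial value. Each is bounded by its own weight (1, (t - s)^(1/p), (t - s)^(2/p), 1) times
the norm, so the mean value inequality can be applied functional by functional. The factor 4 counts
these families. -/
theorem norm_image_sub_le_of_eval {A : Type*} [NormedAddCommGroup A] [NormedSpace ℝ A]
    {φ : A → ControlledPath X W} {φ' : A → A →L[ℝ] ControlledPath X W} {s : Set A}
    (hs : Convex ℝ s) {C : ℝ}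
    (h : ∀ x t, HasFDerivAt (fun x => (φ x).path t) ((evalPath X W t).comp (φ' x)) x)
    (h' : ∀ x t, HasFDerivAt (fun x => (φ x).der t) ((evalDer X W t).comp (φ' x)) x)
    {z w : A} (hz : z ∈ s) (hw : w ∈ s) (hC : ∀ x ∈ s, ‖φ' x - φ' z‖ ≤ C) :
    ‖φ w - φ z - φ' z (w - z)‖ ≤ 4 * C * ‖w - z‖ := by
  have hC0 : 0 ≤ C := (norm_nonneg _).trans (hC z hz)
  set b := φ w - φ z - φ' z (w - z) with hb
  have h1 : ∀ t, ‖b.der t‖ ≤ C * ‖w - z‖ := fun t => by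
    have := norm_image_sub_le_of_weak hs (evalDer X W t) zero_le_one
      (fun b => by rw [one_mul]; exact (b.der_le t).trans b.seminorm_le_norm)
      (fun x _ => h' x t) hz hw hC
    rwa [one_mul] at this
  have h2 : ∀ s t, s ≤ t → ‖b.der t - b.der s‖ ≤ C * ‖w - z‖ * ((t : ℝ) - s) ^ (1 / p) :=
    fun s t hst => by
    have := norm_image_sub_le_of_weak hs (evalDer X W t - evalDer X W s)
      (time_rpow_nonneg hst (1 / p))
      (fun b => by
        rw [mul_comm]
        exact (b.der_sub_le hst).trans
          (mul_le_mul_of_nonneg_right b.seminorm_le_norm (time_rpow_nonneg hst _)))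
      (fun x _ => (h' x t).sub (h' x s)) hz hw hC
    refine this.trans (le_of_eq ?_)
    ring
  have h3 : ∀ s t, s ≤ t → ‖b.path t - b.path s - b.der s (X.fst s t)‖ ≤
      C * ‖w - z‖ * ((t : ℝ) - s) ^ (2 / p) := fun s t hst => by
    have := norm_image_sub_le_of_weak hs (evalRem X W s t)
      (time_rpow_nonneg hst (2 / p))
      (fun b => by
        rw [mul_comm]
        exact (b.rem_le hst).trans
          (mul_le_mul_of_nonneg_right b.seminorm_le_norm (time_rpow_nonneg hst _)))
      (fun x _ => ((h x t).sub (h x s)).sub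
        ((ContinuousLinearMap.apply ℝ W (X.fst s t)).hasFDerivAt.comp x (h' x s))) hz hw hC
    refine this.trans (le_of_eq ?_)
    ring
  have h4 : ‖b.path 0‖ ≤ C * ‖w - z‖ := by
    have := norm_image_sub_le_of_weak hs (evalPath X W 0) zero_le_one
      (fun b => by rw [one_mul]; exact b.path_zero_le)
      (fun x _ => h x 0) hz hw hC
    rwa [one_mul] at this
  have := seminorm_le_of_bounds h1 ⟨by positivity, h2⟩ ⟨by positivity, h3⟩
  rw [norm_eq_seminorm_add]
  linarith

/-- The derivative of the composition map, in terms of the composition with the derivative. -/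
def compDeriv [Fact (0 < q)] (X : RoughPath T p) (W : Type*) [NormedAddCommGroup W]
    [NormedSpace ℝ W] (n : ℕ)
    (c : LipMap V (V →L[ℝ] W) n 1 →L[ℝ] ControlledPath (X.relax hp.out hpq.le) (V →L[ℝ] W)) :
    ControlledPath X V →L[ℝ]
      LipMap V W (n + 1) 1 →L[ℝ] ControlledPath (X.relax hp.out hpq.le) W :=
  (ContinuousLinearMap.flipₗᵢ ℝ _ _ _
    ((mulL (X.relax hp.out hpq.le) V W).comp (c.comp (LipMap.fderivL V W n 1)))).comp
      (relaxL X V hp.out hpq.le)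

theorem compDeriv_apply [Fact (0 < q)]
    (c : LipMap V (V →L[ℝ] W) n 1 →L[ℝ] ControlledPath (X.relax hp.out hpq.le) (V →L[ℝ] W))
    (h : ControlledPath X V) (f : LipMap V W (n + 1) 1) :
    compDeriv hpq X W n c h f = mul (c f.fderivMap) (relaxPath hp.out hpq.le h) := rfl

theorem norm_compDeriv_le [Fact (0 < q)] {K : ℝ} (hX : X.Bound K)
    (c : LipMap V (V →L[ℝ] W) n 1 →L[ℝ] ControlledPath (X.relax hp.out hpq.le) (V →L[ℝ] W)) :
    ‖compDeriv hpq X W n c‖ ≤ 30 * (K + 1) ^ 2 * ‖c‖ := by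
  refine ContinuousLinearMap.opNorm_le_bound _ (by positivity) fun h => ?_
  refine ContinuousLinearMap.opNorm_le_bound _ (by positivity) fun f => ?_
  rw [compDeriv_apply]
  have h1 := norm_mul_le (hX.relax hp.out hpq.le) (c f.fderivMap) (relaxPath hp.out hpq.le h)
  have h2 : ‖c f.fderivMap‖ ≤ ‖c‖ * ‖f‖ := c.le_opNorm_of_le f.norm_fderivMap_le
  have h3 := norm_relaxPath_le hp.out hpq.le h
  calc _ ≤ 10 * (K + 1) ^ 2 * ‖c f.fderivMap‖ * ‖relaxPath hp.out hpq.le h‖ := h1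
    _ ≤ 10 * (K + 1) ^ 2 * (‖c‖ * ‖f‖) * (3 * ‖h‖) := by gcongr
    _ = _ := by ring

/-- `compDeriv` as a continuous linear map. -/
def compDerivL [Fact (0 < q)] (X : RoughPath T p) (W : Type*) [NormedAddCommGroup W]
    [NormedSpace ℝ W] (n : ℕ) :
    (LipMap V (V →L[ℝ] W) n 1 →L[ℝ] ControlledPath (X.relax hp.out hpq.le) (V →L[ℝ] W)) →L[ℝ]
      ControlledPath X V →L[ℝ]
        LipMap V W (n + 1) 1 →L[ℝ] ControlledPath (X.relax hp.out hpq.le) W :=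
  LinearMap.mkContinuous
    { toFun := compDeriv hpq X W n
      map_add' := fun c d => by
        ext1 h
        ext1 f
        exact congrArg (fun A => A (relaxPath hp.out hpq.le h))
          (map_add (mulL (X.relax hp.out hpq.le) V W) (c f.fderivMap) (d f.fderivMap))
      map_smul' := fun r c => by
        ext1 h
        ext1 f
        exact congrArg (fun A => A (relaxPath hp.out hpq.le h))
          (map_smul (mulL (X.relax hp.out hpq.le) V W) r (c f.fderivMap)) }
    (30 * (X.exists_bound.choose + 1) ^ 2) (norm_compDeriv_le hpq X.exists_bound.choose_spec)

theorem contDiff_compDeriv [Fact (0 < q)] {A : Type*} [NormedAddCommGroup A] [NormedSpace ℝ A]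
    {k : WithTop ℕ∞}
    {c : A → LipMap V (V →L[ℝ] W) n 1 →L[ℝ] ControlledPath (X.relax hp.out hpq.le) (V →L[ℝ] W)}
    (hc : ContDiff ℝ k c) : ContDiff ℝ k fun a => compDeriv hpq X W n (c a) := by
  have h : ContDiff ℝ k (compDerivL (V := V) hpq X W n) := ContinuousLinearMap.contDiff _
  exact h.comp hc

/-- Norm continuity of the candidate derivative together with the chain rule at each fixed time
gives Fréchet differentiability. The estimate is linear in ‖f‖, hence holds in operator norm. -/
theorem hasFDerivAt_compRelax_of_continuous [Fact (0 < q)]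
    (hc : Continuous (compRelax hpq (V →L[ℝ] W) n : ControlledPath X V → _))
    (z : ControlledPath X V) :
    HasFDerivAt (compRelax hpq W (n + 1)) (compDeriv hpq X W (n + 1)
      (compRelax hpq (V →L[ℝ] W) n z)) z := by
  have hD : Continuous fun z : ControlledPath X V =>
      compDeriv hpq X W (n + 1) (compRelax hpq (V →L[ℝ] W) n z) :=
    (compDerivL hpq X W (n + 1)).continuous.comp hc
  refine HasFDerivAt.of_isLittleO (Asymptotics.isLittleO_iff.2 fun ε hε => ?_)
  -- The quarter compensates the factor 4 of `norm_image_sub_le_of_eval`.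
  obtain ⟨r, hr, hball⟩ := exists_ball_norm_sub_le
    (φ := fun z => compDeriv hpq X W (n + 1) (compRelax hpq (V →L[ℝ] W) n z)) hD z
    (div_pos hε four_pos)
  filter_upwards [Metric.ball_mem_nhds z hr] with w hw
  refine ContinuousLinearMap.opNorm_le_bound _ (by positivity) fun f => ?_
  have hpath : ∀ (x : ControlledPath X V) t,
      HasFDerivAt (fun x : ControlledPath X V => (compRelax hpq W (n + 1) x f).path t)
      ((evalPath (X.relax hp.out hpq.le) W t).comp ((compDeriv hpq X W (n + 1)
        (compRelax hpq (V →L[ℝ] W) n x)).flip f)) x := fun x t =>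
    (f.hasFDerivAt (x.path t)).comp x (evalPath X V t).hasFDerivAt
  have hder : ∀ (x : ControlledPath X V) t,
      HasFDerivAt (fun x : ControlledPath X V => (compRelax hpq W (n + 1) x f).der t)
      ((evalDer (X.relax hp.out hpq.le) W t).comp ((compDeriv hpq X W (n + 1)
        (compRelax hpq (V →L[ℝ] W) n x)).flip f)) x := by
    intro x t
    have h1 := ((f.fderivMap.hasFDerivAt (x.path t)).comp x
      (evalPath X V t).hasFDerivAt).clm_comp (evalDer X V t).hasFDerivAt
    refine h1.congr_fderiv ?_
    ext h e
    -- Differentiating f'(z) z' in the direction h gives f''(z)(h, z'), while the product rule for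
    -- f'(z) h produces f''(z)(z', h).
    have hsymm : IsSymmSndFDerivAt ℝ f.fn (x.path t) :=
      f.contDiff_fn.contDiffAt.isSymmSndFDerivAt (by
        rw [minSmoothness_of_isRCLikeNormedField]
        norm_cast
        omega)
    have hs := hsymm.eq (x.der t e) (h.path t)
    change f.fderivMap.fn (x.path t) (h.der t e) +
      fderiv ℝ (fderiv ℝ f.fn) (x.path t) (h.path t) (x.der t e) =
      fderiv ℝ (fderiv ℝ f.fn) (x.path t) (x.der t e) (h.path t) +
      f.fderivMap.fn (x.path t) (h.der t e)
    rw [hs, add_comm]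
  have key := norm_image_sub_le_of_eval (X := X.relax hp.out hpq.le)
    (φ := fun x => compRelax hpq W (n + 1) x f)
    (φ' := fun x => (compDeriv hpq X W (n + 1) (compRelax hpq (V →L[ℝ] W) n x)).flip f)
    (convex_ball z r) (C := ε / 4 * ‖f‖) hpath hder (Metric.mem_ball_self hr) hw
    (fun x hx => by
      refine ContinuousLinearMap.opNorm_le_bound _ (by positivity) fun h => ?_
      have h1 := hball x hx
      have h2 := (compDeriv hpq X W (n + 1) (compRelax hpq (V →L[ℝ] W) n x) -
        compDeriv hpq X W (n + 1) (compRelax hpq (V →L[ℝ] W) n z)).le_of_opNorm_le h1 h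
      refine (ContinuousLinearMap.le_of_opNorm_le _ h2 f).trans (le_of_eq ?_)
      ring)
  refine key.trans (le_of_eq ?_)
  ring

end Comp

section Smooth

universe v

variable {E E2 : Type*} [NormedAddCommGroup E] [NormedSpace ℝ E]
  [NormedAddCommGroup E2] [NormedSpace ℝ E2] {T : TensorSquare E E2} {p q : ℝ}
  {X : RoughPath T p} {V : Type v} [NormedAddCommGroup V] [NormedSpace ℝ V]
  [hp : Fact (0 < p)] [Fact (0 < q)] (hpq : p < q)

/-- The composition map is of class `C^n` on the functions with `n + 1` Lipschitz derivatives. -/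
theorem contDiff_compRelax (n : ℕ) : ∀ (W : Type v) [NormedAddCommGroup W] [NormedSpace ℝ W],
    ContDiff ℝ n (compRelax hpq W n : ControlledPath X V → _) := by
  -- The target W varies in the induction: the derivative at level n + 1 is a continuous linear
  -- image of the composition map at level n with target L(V, W).
  induction n with
  | zero => exact fun W _ _ => contDiff_zero.2 (continuous_compRelax hpq 0)
  | succ n ih =>
    intro W _ _
    exact contDiff_succ_iff_hasFDerivAt.2 ⟨_, contDiff_compDeriv hpq (ih (V →L[ℝ] W)),
      hasFDerivAt_compRelax_of_continuous hpq (ih (V →L[ℝ] W)).continuous⟩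

theorem hasFDerivAt_compRelax (n : ℕ) (W : Type v) [NormedAddCommGroup W] [NormedSpace ℝ W]
    (z : ControlledPath X V) :
    HasFDerivAt (compRelax hpq W (n + 1)) (compDeriv hpq X W (n + 1)
      (compRelax hpq (V →L[ℝ] W) n z)) z :=
  hasFDerivAt_compRelax_of_continuous hpq (contDiff_compRelax hpq n _).continuous z

end Smooth
end ControlledPath

/-! ### The rough integral of a controlled path of linear maps -/

section Sewn

variable {W : Type*} [NormedAddCommGroup W]

/-- The path `w` starts from `0` and its increments are those of the germ `Ξ` up to
`O(|t - s| ^ ζ)` for some `ζ > 1`. -/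
def IsSewing (Ξ : Icc (0 : ℝ) 1 → Icc (0 : ℝ) 1 → W) (w : Icc (0 : ℝ) 1 → W) : Prop :=
  w 0 = 0 ∧ ∃ ζ : ℝ, 1 < ζ ∧ ∃ C : ℝ, ∀ s t : Icc (0 : ℝ) 1, s ≤ t →
    ‖w t - w s - Ξ s t‖ ≤ C * ((t : ℝ) - s) ^ ζ

/-- Times are at most 1, so the smaller of the two exponents serves for both errors. -/
theorem IsSewing.add {Ξ Ξ' : Icc (0 : ℝ) 1 → Icc (0 : ℝ) 1 → W} {w w' : Icc (0 : ℝ) 1 → W}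
    (h : IsSewing Ξ w) (h' : IsSewing Ξ' w') : IsSewing (Ξ + Ξ') (w + w') := by
  obtain ⟨h0, ζ, hζ, C, hC⟩ := h
  obtain ⟨h0', ζ', hζ', C', hC'⟩ := h'
  refine ⟨by rw [Pi.add_apply, h0, h0', add_zero], min ζ ζ', lt_min hζ hζ', |C| + |C'|,
    fun s t hst => ?_⟩
  have e : (w + w') t - (w + w') s - (Ξ + Ξ') s t =
      (w t - w s - Ξ s t) + (w' t - w' s - Ξ' s t) := by
    simp only [Pi.add_apply]
    abel
  have hm : 0 ≤ min ζ ζ' := le_min (by linarith) (by linarith)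
  have key : ∀ {c z : ℝ}, min ζ ζ' ≤ z → c * ((t : ℝ) - s) ^ z ≤
      |c| * ((t : ℝ) - s) ^ (min ζ ζ') := fun {c z} hz =>
    mul_le_mul (le_abs_self c) (time_rpow_le hst hm hz) (time_rpow_nonneg hst _) (abs_nonneg c)
  rw [e, add_mul]
  exact norm_add_le_of_le ((hC s t hst).trans (key (min_le_left _ _)))
    ((hC' s t hst).trans (key (min_le_right _ _)))

theorem IsSewing.smul [NormedSpace ℝ W] {Ξ : Icc (0 : ℝ) 1 → Icc (0 : ℝ) 1 → W}
    {w : Icc (0 : ℝ) 1 → W} (c : ℝ) (h : IsSewing Ξ w) : IsSewing (c • Ξ) (c • w) := by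
  obtain ⟨h0, ζ, hζ, C, hC⟩ := h
  refine ⟨by rw [Pi.smul_apply, h0, smul_zero], ζ, hζ, |c| * C, fun s t hst => ?_⟩
  have e : (c • w) t - (c • w) s - (c • Ξ) s t = c • (w t - w s - Ξ s t) := by
    simp only [Pi.smul_apply, smul_sub]
  rw [e, norm_smul, Real.norm_eq_abs, mul_assoc]
  exact mul_le_mul_of_nonneg_left (hC s t hst) (abs_nonneg c)

/-- The difference of two sewings is Hölder with exponent above 1 and starts from 0. -/
theorem IsSewing.unique {Ξ : Icc (0 : ℝ) 1 → Icc (0 : ℝ) 1 → W} {w w' : Icc (0 : ℝ) 1 → W}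
    (h : IsSewing Ξ w) (h' : IsSewing Ξ w') : w = w' := by
  have hn : IsSewing (-Ξ) (-w') := by
    obtain ⟨h0, ζ, hζ, C, hC⟩ := h'
    refine ⟨by rw [Pi.neg_apply, h0, neg_zero], ζ, hζ, C, fun s t hst => ?_⟩
    refine le_trans (le_of_eq ?_) (hC s t hst)
    rw [← norm_neg]
    congr 1
    simp only [Pi.neg_apply]
    abel
  obtain ⟨h0, ζ, hζ, C, hC⟩ := h.add hn
  funext t
  have := eq_of_holder_gt_one (w := w + -w') hζ (fun s t hst => by
    have := hC s t hst
    rwa [add_neg_cancel, Pi.zero_apply, Pi.zero_apply, sub_zero] at this) t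
  rw [h0] at this
  exact add_neg_eq_zero.1 this

end Sewn

set_option maxSynthPendingDepth 4

namespace ControlledPath

section Integral

variable {E E2 : Type*} [NormedAddCommGroup E] [NormedSpace ℝ E]
  [NormedAddCommGroup E2] [NormedSpace ℝ E2] {T : TensorSquare E E2} {p q : ℝ}
  {X : RoughPath T p} {U V : Type*} [NormedAddCommGroup U] [NormedSpace ℝ U]
  [NormedAddCommGroup V] [NormedSpace ℝ V] [hp : Fact (0 < p)]
  {hpq : p ≤ q} (L : T.Extension V)

/-- The bilinear map `(a, b) ↦ A'_s(a)(y'_s(b))`. -/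
def secondOrder (A : ControlledPath (X.relax hp.out hpq) (U →L[ℝ] V)) (y : ControlledPath X U)
    (s : Icc (0 : ℝ) 1) : E →L[ℝ] E →L[ℝ] V :=
  (A.der s).bilinearComp (ContinuousLinearMap.id ℝ E) (y.der s)

@[simp] theorem secondOrder_apply (A : ControlledPath (X.relax hp.out hpq) (U →L[ℝ] V))
    (y : ControlledPath X U) (s : Icc (0 : ℝ) 1) (a b : E) :
    secondOrder A y s a b = A.der s a (y.der s b) := rfl

/-- The germ `A_s y_{ts} + (A'_s y'_s) 𝕏_{ts}` of the integral of `A` against `y`. -/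
def intGerm (A : ControlledPath (X.relax hp.out hpq) (U →L[ℝ] V)) (y : ControlledPath X U)
    (s t : Icc (0 : ℝ) 1) : V :=
  A.path s (y.path t - y.path s) + L.lift (secondOrder A y s) (X.snd s t)

theorem norm_secondOrder_le (A : ControlledPath (X.relax hp.out hpq) (U →L[ℝ] V))
    (y : ControlledPath X U) (s) : ‖secondOrder A y s‖ ≤ ‖A‖ * y.seminorm := by
  refine ContinuousLinearMap.opNorm_le_bound₂ _
    (mul_nonneg (norm_nonneg _) y.seminorm_nonneg) fun a b => ?_
  rw [secondOrder_apply]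
  have h1 := (A.der s).le_of_opNorm_le ((A.der_le s).trans A.seminorm_le_norm) a
  have h2 := (y.der s).le_of_opNorm_le (y.der_le s) b
  refine ((A.der s a).le_of_opNorm_le_of_le h1 h2).trans (le_of_eq ?_)
  ring

theorem norm_secondOrder_sub_le (A : ControlledPath (X.relax hp.out hpq) (U →L[ℝ] V))
    (y : ControlledPath X U) {s t} (hst : s ≤ t) :
    ‖secondOrder A y t - secondOrder A y s‖ ≤
      2 * (‖A‖ * y.seminorm) * ((t : ℝ) - s) ^ (1 / q) := by
  have hτ := time_rpow_nonneg hst (1 / q)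
  have hy := y.seminorm_nonneg
  refine ContinuousLinearMap.opNorm_le_bound₂ _ (by positivity) fun a b => ?_
  have e : (secondOrder A y t - secondOrder A y s) a b =
      (A.der t - A.der s) a (y.der t b) + A.der s a ((y.der t - y.der s) b) := by
    simp only [sub_apply, secondOrder_apply, map_sub]
    abel
  rw [e]
  have b1 : ‖(A.der t - A.der s) a‖ ≤ ‖A‖ * ((t : ℝ) - s) ^ (1 / q) * ‖a‖ :=
    (A.der t - A.der s).le_of_opNorm_le ((A.der_sub_le hst).trans
      (mul_le_mul_of_nonneg_right A.seminorm_le_norm hτ)) a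
  have b2 := (y.der t).le_of_opNorm_le (y.der_le t) b
  have b3 := (A.der s).le_of_opNorm_le ((A.der_le s).trans A.seminorm_le_norm) a
  have b4 : ‖(y.der t - y.der s) b‖ ≤ y.seminorm * ((t : ℝ) - s) ^ (1 / q) * ‖b‖ :=
    (y.der t - y.der s).le_of_opNorm_le ((y.der_sub_le hst).trans
      (mul_le_mul_of_nonneg_left (div_rpow_time_le hp.out hpq zero_le_one hst) hy)) b
  refine (norm_add_le_of_le (((A.der t - A.der s) a).le_of_opNorm_le_of_le b1 b2)
    ((A.der s a).le_of_opNorm_le_of_le b3 b4)).trans (le_of_eq ?_)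
  ring

variable [hq : Fact (0 < q)]

theorem rpow_div_mul {s t : Icc (0 : ℝ) 1} (hst : s ≤ t) {a b r : ℝ} (hr : 0 < r) (ha : 0 ≤ a)
    (hb : 0 ≤ b) : ((t : ℝ) - s) ^ (a / r) * ((t : ℝ) - s) ^ (b / r) =
      ((t : ℝ) - s) ^ ((a + b) / r) := by
  rw [← Real.rpow_add_of_nonneg (time_sub_nonneg hst) (by positivity) (by positivity), add_div]

/-- The constant in the estimate of the defect of additivity of the germ. -/
def germConst (K : ℝ) : ℝ := 2 * (1 + ‖L.lift‖) * (K + 1) ^ 2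

theorem germConst_nonneg (K : ℝ) : 0 ≤ germConst L K := by
  unfold germConst
  positivity

/-- By Chen's relation the term A'_s X_{us} ⊗ y'_s X_{tu} cancels against the first-order part of
(A_u - A_s)(y_t - y_u). The remaining terms are A'_s X_{us} applied to the error of y_t - y_u
against y'_s X_{tu}, the remainder of A applied to an increment of y, and an increment of A' y'
against 𝕏. Each is of order 3/q. -/
theorem intGerm_defect {K : ℝ} (hX : X.Bound K)
    (A : ControlledPath (X.relax hp.out hpq) (U →L[ℝ] V)) (y : ControlledPath X U)
    {s u t : Icc (0 : ℝ) 1} (hsu : s ≤ u) (hut : u ≤ t) :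
    ‖intGerm L A y s t - intGerm L A y s u - intGerm L A y u t‖ ≤
      germConst L K * (‖A‖ * y.seminorm) * ((t : ℝ) - s) ^ (3 / q) := by
  have hst := hsu.trans hut
  have hK := hX.nonneg
  have hY := y.seminorm_nonneg
  have hA := norm_nonneg A
  have hl := norm_nonneg L.lift
  set τ : ℝ := ((t : ℝ) - s) ^ (1 / q) with hτ
  have hτ0 : 0 ≤ τ := time_rpow_nonneg hst _
  have hτ2 : τ * τ = ((t : ℝ) - s) ^ (2 / q) := by
    rw [hτ, rpow_div_mul hst hq.out zero_le_one zero_le_one]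
    norm_num
  have hτ3 : τ * τ * τ = ((t : ℝ) - s) ^ (3 / q) := by
    rw [hτ2, hτ, rpow_div_mul hst hq.out zero_le_two zero_le_one]
    norm_num
  have mono1 : ∀ (a : ℝ), 0 ≤ a → ((u : ℝ) - s) ^ (a / q) ≤ ((t : ℝ) - s) ^ (a / q) := fun a ha =>
    Real.rpow_le_rpow (time_sub_nonneg hsu) (sub_le_sub_right (by exact_mod_cast hut) _)
      (div_nonneg ha hq.out.le)
  have mono2 : ∀ (a : ℝ), 0 ≤ a → ((t : ℝ) - u) ^ (a / q) ≤ ((t : ℝ) - s) ^ (a / q) := fun a ha =>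
    Real.rpow_le_rpow (time_sub_nonneg hut) (sub_le_sub_left (by exact_mod_cast hsu) _)
      (div_nonneg ha hq.out.le)
  have su1 : ((u : ℝ) - s) ^ (1 / p) ≤ τ :=
    (div_rpow_time_le hp.out hpq zero_le_one hsu).trans (mono1 1 zero_le_one)
  have su1q : ((u : ℝ) - s) ^ (1 / q) ≤ τ := mono1 1 zero_le_one
  have su2q : ((u : ℝ) - s) ^ (2 / q) ≤ τ * τ := hτ2 ▸ mono1 2 zero_le_two
  have ut1 : ((t : ℝ) - u) ^ (1 / p) ≤ τ :=
    (div_rpow_time_le hp.out hpq zero_le_one hut).trans (mono2 1 zero_le_one)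
  have ut2 : ((t : ℝ) - u) ^ (2 / p) ≤ τ * τ := hτ2 ▸
    (div_rpow_time_le hp.out hpq zero_le_two hut).trans (mono2 2 zero_le_two)
  have hXsu : ‖X.fst s u‖ ≤ K * τ := (hX.fst_le s u hsu).trans (by gcongr)
  have hXut : ‖X.fst u t‖ ≤ K * τ := (hX.fst_le u t hut).trans (by gcongr)
  have hXXut : ‖X.snd u t‖ ≤ K * (τ * τ) := (hX.snd_le u t hut).trans (by gcongr)
  have hRA : ‖A.path u - A.path s - A.der s (X.fst s u)‖ ≤ ‖A‖ * (τ * τ) :=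
    (A.rem_le hsu).trans (mul_le_mul A.seminorm_le_norm su2q (time_rpow_nonneg hsu _) hA)
  have hRy : ‖y.path t - y.path u - y.der u (X.fst u t)‖ ≤ y.seminorm * (τ * τ) :=
    (y.rem_le hut).trans (by gcongr)
  have hy' : ‖y.der u - y.der s‖ ≤ y.seminorm * τ := (y.der_sub_le hsu).trans (by gcongr)
  have hyp : ‖y.path t - y.path u‖ ≤ (K + 1) * y.seminorm * τ :=
    (y.path_sub_le hX hut).trans (by gcongr)
  have hB : ‖secondOrder A y u - secondOrder A y s‖ ≤ 2 * (‖A‖ * y.seminorm) * τ :=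
    (norm_secondOrder_sub_le A y hsu).trans (by gcongr)
  have e : intGerm L A y s t - intGerm L A y s u - intGerm L A y u t =
      -(A.der s (X.fst s u) ((y.path t - y.path u - y.der u (X.fst u t)) +
        (y.der u - y.der s) (X.fst u t))) -
      (A.path u - A.path s - A.der s (X.fst s u)) (y.path t - y.path u) -
      L.lift (secondOrder A y u - secondOrder A y s) (X.snd u t) := by
    have hc : L.lift (secondOrder A y s) (X.snd s t) =
        L.lift (secondOrder A y s) (X.snd u t) + L.lift (secondOrder A y s) (X.snd s u) +
        A.der s (X.fst s u) (y.der s (X.fst u t)) := by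
      rw [X.chen s u t hsu hut, map_add, map_add, L.lift_tmul, secondOrder_apply]
    rw [intGerm, intGerm, intGerm, hc]
    simp only [map_sub, map_add, sub_apply]
    abel
  have b1 : ‖A.der s (X.fst s u)‖ ≤ ‖A‖ * (K * τ) :=
    (A.der s).le_of_opNorm_le_of_le ((A.der_le s).trans A.seminorm_le_norm) hXsu
  have b2 : ‖(y.path t - y.path u - y.der u (X.fst u t)) + (y.der u - y.der s) (X.fst u t)‖ ≤
      y.seminorm * (τ * τ) + y.seminorm * τ * (K * τ) :=
    norm_add_le_of_le hRy ((y.der u - y.der s).le_of_opNorm_le_of_le hy' hXut)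
  have b3 := (A.der s (X.fst s u)).le_of_opNorm_le_of_le b1 b2
  have b4 := (A.path u - A.path s - A.der s (X.fst s u)).le_of_opNorm_le_of_le hRA hyp
  have b5 := (L.lift (secondOrder A y u - secondOrder A y s)).le_of_opNorm_le_of_le
    (L.lift.le_opNorm_of_le hB) hXXut
  rw [e, ← hτ3]
  refine (norm_sub_le_of_le (norm_sub_le_of_le ((norm_neg _).trans_le b3) b4) b5).trans ?_
  have hP : 0 ≤ ‖A‖ * y.seminorm * (τ * τ * τ) := by positivity
  have hc : K * (1 + K) + (K + 1) + 2 * ‖L.lift‖ * K ≤ germConst L K := by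
    unfold germConst
    have h1 : ‖L.lift‖ * K ≤ ‖L.lift‖ * (K + 1) ^ 2 := by
      refine mul_le_mul_of_nonneg_left ?_ hl
      nlinarith
    nlinarith
  have := mul_le_mul_of_nonneg_right hc hP
  linarith

theorem one_lt_three_div (hq3 : q < 3) : 1 < 3 / q := (one_lt_div hq.out).2 hq3

/-- The path does not depend on K, by uniqueness of sewing, so one path satisfies the estimate for
every bound K of X. The later smallness threshold can then be uniform over all rough paths with the
same bound. -/
theorem exists_integral [CompleteSpace V] (hq3 : q < 3)
    (A : ControlledPath (X.relax hp.out hpq) (U →L[ℝ] V)) (y : ControlledPath X U) :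
    ∃ w : Icc (0 : ℝ) 1 → V, w 0 = 0 ∧ ∀ K, X.Bound K → ∀ s t, s ≤ t →
      ‖w t - w s - intGerm L A y s t‖ ≤
      sewConst (3 / q) * (germConst L K * (‖A‖ * y.seminorm)) * ((t : ℝ) - s) ^ (3 / q) := by
  have hζ := one_lt_three_div hq3
  have hpos : ∀ K, 0 ≤ germConst L K * (‖A‖ * y.seminorm) := fun K =>
    mul_nonneg (germConst_nonneg L K) (mul_nonneg (norm_nonneg _) y.seminorm_nonneg)
  have H : ∀ K, X.Bound K → _ := fun K hK => exists_sewing (hpos K) hζ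
    fun s u t hsu hut => intGerm_defect L hK A y hsu hut
  obtain ⟨K₀, hK₀⟩ := X.exists_bound
  obtain ⟨w, hw0, hw⟩ := H K₀ hK₀
  refine ⟨w, hw0, fun K hK => ?_⟩
  obtain ⟨v, hv0, hv⟩ := H K hK
  have : w = v := IsSewing.unique (Ξ := intGerm L A y) ⟨hw0, _, hζ, _, hw⟩ ⟨hv0, _, hζ, _, hv⟩
  rw [this]
  exact hv

/-- The path of the rough integral. -/
def intPath [CompleteSpace V] (hq3 : q < 3)
    (A : ControlledPath (X.relax hp.out hpq) (U →L[ℝ] V)) (y : ControlledPath X U) :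
    Icc (0 : ℝ) 1 → V := (exists_integral L hq3 A y).choose

theorem intPath_zero [CompleteSpace V] (hq3 : q < 3)
    (A : ControlledPath (X.relax hp.out hpq) (U →L[ℝ] V)) (y : ControlledPath X U) :
    intPath L hq3 A y 0 = 0 := (exists_integral L hq3 A y).choose_spec.1

theorem intPath_le [CompleteSpace V] (hq3 : q < 3) {K : ℝ} (hX : X.Bound K)
    (A : ControlledPath (X.relax hp.out hpq) (U →L[ℝ] V)) (y : ControlledPath X U) {s t}
    (hst : s ≤ t) :
    ‖intPath L hq3 A y t - intPath L hq3 A y s - intGerm L A y s t‖ ≤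
      sewConst (3 / q) * (germConst L K * (‖A‖ * y.seminorm)) * ((t : ℝ) - s) ^ (3 / q) :=
  (exists_integral L hq3 A y).choose_spec.2 K hX s t hst

theorem isSewing_intPath [CompleteSpace V] (hq3 : q < 3)
    (A : ControlledPath (X.relax hp.out hpq) (U →L[ℝ] V)) (y : ControlledPath X U) :
    IsSewing (intGerm L A y) (intPath L hq3 A y) := by
  obtain ⟨K, hK⟩ := X.exists_bound
  exact ⟨intPath_zero L hq3 A y, _, one_lt_three_div hq3, _, fun s t hst =>
    intPath_le L hq3 hK A y hst⟩

/-- The constant in the estimate of the rough integral. -/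
def intConst (q K : ℝ) : ℝ := 5 * (1 + ‖L.lift‖) * (K + 1) + sewConst (3 / q) * germConst L K

/-- Since q < 3 < 2p, remainders of roughness q are still small enough for paths to be Hölder of
order 1/p. -/
theorem one_div_le_two_div (hp2 : 2 ≤ p) (hq3 : q < 3) : 1 / p ≤ 2 / q := by
  rw [div_le_div_iff₀ hp.out hq.out]
  linarith

/-- Since 2q < 6 ≤ 3p, the sewing error of order 3/q fits into a remainder of order 2/p. -/
theorem two_div_le_three_div (hp2 : 2 ≤ p) (hq3 : q < 3) : 2 / p ≤ 3 / q := by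
  rw [div_le_div_iff₀ hp.out hq.out]
  linarith

/-- The derivative of the rough integral. -/
def intDer (A : ControlledPath (X.relax hp.out hpq) (U →L[ℝ] V)) (y : ControlledPath X U)
    (t : Icc (0 : ℝ) 1) : E →L[ℝ] V := (A.path t).comp (y.der t)

/-- The integral is controlled at roughness p although A is controlled only at roughness q. Its
derivative A y' is Hölder of order 1/p because A_t - A_s = A'_s X + R with X of order 1/p and R of
order 2/q ≥ 1/p. Its remainder is the sewing error plus A_s times the remainder of y plus the
second-order term. -/
theorem integral_bounds [CompleteSpace V] (hp2 : 2 ≤ p) (hq3 : q < 3) {K : ℝ} (hX : X.Bound K)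
    (A : ControlledPath (X.relax hp.out hpq) (U →L[ℝ] V)) (y : ControlledPath X U) :
    (∀ t, ‖intDer A y t‖ ≤ (K + 1) * (‖A‖ * y.seminorm)) ∧
    (0 ≤ 2 * (K + 1) * (‖A‖ * y.seminorm) ∧ ∀ s t, s ≤ t → ‖intDer A y t - intDer A y s‖ ≤
      2 * (K + 1) * (‖A‖ * y.seminorm) * ((t : ℝ) - s) ^ (1 / p)) ∧
    (0 ≤ (sewConst (3 / q) * germConst L K + (K + 1) + ‖L.lift‖ * K) * (‖A‖ * y.seminorm) ∧
      ∀ s t, s ≤ t →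
      ‖intPath L hq3 A y t - intPath L hq3 A y s - intDer A y s (X.fst s t)‖ ≤
      (sewConst (3 / q) * germConst L K + (K + 1) + ‖L.lift‖ * K) * (‖A‖ * y.seminorm) *
        ((t : ℝ) - s) ^ (2 / p)) := by
  have hK := hX.nonneg
  have hY := y.seminorm_nonneg
  have hA := norm_nonneg A
  have hl := norm_nonneg L.lift
  have hs := sewConst_nonneg (one_lt_three_div hq3)
  have hg := germConst_nonneg L K
  have hAp : ∀ t, ‖A.path t‖ ≤ (K + 1) * ‖A‖ := fun t => A.path_le (hX.relax hp.out hpq) t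
  refine ⟨fun t => ?_, ⟨by positivity, fun s t hst => ?_⟩, ⟨by positivity, fun s t hst => ?_⟩⟩
  · refine ((A.path t).opNorm_comp_le _).trans ((mul_le_mul (hAp t) (y.der_le t)
      (norm_nonneg _) (by positivity)).trans (le_of_eq ?_))
    ring
  · set τ := ((t : ℝ) - s) ^ (1 / p) with hτ
    have hτ0 : 0 ≤ τ := time_rpow_nonneg hst _
    have hq' : ((t : ℝ) - s) ^ (2 / q) ≤ τ :=
      time_rpow_le hst (one_div_nonneg.2 hp.out.le) (one_div_le_two_div hp2 hq3)
    have b0 : ‖A.path t - A.path s‖ ≤ (K + 1) * ‖A‖ * τ := by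
      have h1 : ‖A.path t - A.path s - A.der s (X.fst s t)‖ ≤ ‖A‖ * τ :=
        (A.rem_le hst).trans (mul_le_mul A.seminorm_le_norm hq' (time_rpow_nonneg hst _) hA)
      have h2 : ‖A.der s (X.fst s t)‖ ≤ ‖A‖ * (K * τ) :=
        (A.der s).le_of_opNorm_le_of_le ((A.der_le s).trans A.seminorm_le_norm)
          (hX.fst_le s t hst)
      have h3 := norm_add_le (A.path t - A.path s - A.der s (X.fst s t)) (A.der s (X.fst s t))
      rw [sub_add_cancel] at h3
      linarith
    have e : intDer A y t - intDer A y s = (A.path t - A.path s).comp (y.der t) +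
        (A.path s).comp (y.der t - y.der s) := by
      ext x
      simp [intDer]
    rw [e]
    have b1 := ((A.path t - A.path s).opNorm_comp_le (y.der t)).trans
      (mul_le_mul b0 (y.der_le t) (norm_nonneg _) (by positivity))
    have b2 := ((A.path s).opNorm_comp_le (y.der t - y.der s)).trans
      (mul_le_mul (hAp s) (y.der_sub_le hst) (norm_nonneg _) (by positivity))
    refine (norm_add_le_of_le b1 b2).trans (le_of_eq ?_)
    ring
  · have hq' : ((t : ℝ) - s) ^ (3 / q) ≤ ((t : ℝ) - s) ^ (2 / p) :=
      time_rpow_le hst (div_nonneg zero_le_two hp.out.le)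
        (two_div_le_three_div hp2 hq3)
    have e : intPath L hq3 A y t - intPath L hq3 A y s - intDer A y s (X.fst s t) =
        (intPath L hq3 A y t - intPath L hq3 A y s - intGerm L A y s t) +
        A.path s (y.path t - y.path s - y.der s (X.fst s t)) +
        L.lift (secondOrder A y s) (X.snd s t) := by
      rw [intGerm, intDer]
      simp only [map_sub, ContinuousLinearMap.comp_apply]
      abel
    rw [e]
    have b1 := (intPath_le L hq3 hX A y hst).trans (mul_le_mul_of_nonneg_left hq'
      (by positivity))
    have b2 := (A.path s).le_of_opNorm_le_of_le (hAp s) (y.rem_le hst)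
    have b3 := (L.lift (secondOrder A y s)).le_of_opNorm_le_of_le
      (L.lift.le_opNorm_of_le (norm_secondOrder_le A y s)) (hX.snd_le s t hst)
    refine (norm_add_le_of_le (norm_add_le_of_le b1 b2) b3).trans (le_of_eq ?_)
    ring

/-- The rough integral of `A` against `y`. -/
def integral [CompleteSpace V] (hp2 : 2 ≤ p) (hq3 : q < 3)
    (A : ControlledPath (X.relax hp.out hpq) (U →L[ℝ] V))
    (y : ControlledPath X U) : ControlledPath X V :=
  have H := integral_bounds L hp2 hq3 X.exists_bound.choose_spec A y
  ofBounds X (intPath L hq3 A y) (intDer A y) H.1 H.2.1 H.2.2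

@[simp] theorem integral_path [CompleteSpace V] (hp2 : 2 ≤ p) (hq3 : q < 3)
    (A : ControlledPath (X.relax hp.out hpq) (U →L[ℝ] V)) (y : ControlledPath X U) (t) :
    (integral L hp2 hq3 A y).path t = intPath L hq3 A y t := rfl

@[simp] theorem integral_der [CompleteSpace V] (hp2 : 2 ≤ p) (hq3 : q < 3)
    (A : ControlledPath (X.relax hp.out hpq) (U →L[ℝ] V)) (y : ControlledPath X U) (t) :
    (integral L hp2 hq3 A y).der t = (A.path t).comp (y.der t) := rfl

/-- The integral sees only increments of y, so its smallness does not depend on y_0. -/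
theorem norm_integral_le_seminorm [CompleteSpace V] (hp2 : 2 ≤ p) (hq3 : q < 3)
    {K : ℝ} (hX : X.Bound K)
    (A : ControlledPath (X.relax hp.out hpq) (U →L[ℝ] V)) (y : ControlledPath X U) :
    ‖integral L hp2 hq3 A y‖ ≤ intConst L q K * ‖A‖ * y.seminorm := by
  obtain ⟨h1, h2, h3⟩ := integral_bounds L hp2 hq3 hX A y
  have h := seminorm_le_of_bounds (w := integral L hp2 hq3 A y) h1 h2 h3
  rw [norm_eq_seminorm_add, integral_path, intPath_zero, norm_zero, add_zero]
  refine h.trans ?_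
  have hP : 0 ≤ ‖A‖ * y.seminorm := mul_nonneg (norm_nonneg _) y.seminorm_nonneg
  have hc : (K + 1) + 2 * (K + 1) +
      (sewConst (3 / q) * germConst L K + (K + 1) + ‖L.lift‖ * K) ≤ intConst L q K := by
    unfold intConst
    have h1 : 0 ≤ ‖L.lift‖ * K := mul_nonneg (norm_nonneg _) hX.nonneg
    have h2 := norm_nonneg L.lift
    have h3 := hX.nonneg
    linarith
  have := mul_le_mul_of_nonneg_right hc hP
  linarith

theorem intConst_nonneg (hq3 : q < 3) {K : ℝ} (hK : 0 ≤ K) : 0 ≤ intConst L q K := by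
  have := sewConst_nonneg (one_lt_three_div hq3)
  have := germConst_nonneg L K
  have := norm_nonneg L.lift
  unfold intConst
  positivity

theorem norm_integral_le [CompleteSpace V] (hp2 : 2 ≤ p) (hq3 : q < 3) {K : ℝ} (hX : X.Bound K)
    (A : ControlledPath (X.relax hp.out hpq) (U →L[ℝ] V)) (y : ControlledPath X U) :
    ‖integral L hp2 hq3 A y‖ ≤ intConst L q K * ‖A‖ * ‖y‖ := by
  refine (norm_integral_le_seminorm L hp2 hq3 hX A y).trans
    (mul_le_mul_of_nonneg_left y.seminorm_le_norm (mul_nonneg ?_ (norm_nonneg _)))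
  exact intConst_nonneg L hq3 hX.nonneg

/-- By uniqueness of sewing, bilinearity of the integral reduces to bilinearity of its germ. -/
theorem integral_eq [CompleteSpace V] (hp2 : 2 ≤ p) (hq3 : q < 3)
    {A : ControlledPath (X.relax hp.out hpq) (U →L[ℝ] V)} {y : ControlledPath X U}
    {z : ControlledPath X V} (h : IsSewing (intGerm L A y) z.path)
    (h' : ∀ t, z.der t = (A.path t).comp (y.der t)) : integral L hp2 hq3 A y = z :=
  ControlledPath.ext (fun t => congrFun ((isSewing_intPath L hq3 A y).unique h) t)
    fun t => (h' t).symm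

variable (X) in
/-- The rough integral as a continuous bilinear map. -/
def integralL [CompleteSpace V] (hp2 : 2 ≤ p) (hq3 : q < 3) (hpq : p ≤ q) :
    ControlledPath (X.relax hp.out hpq) (U →L[ℝ] V) →L[ℝ]
      ControlledPath X U →L[ℝ] ControlledPath X V :=
  LinearMap.mkContinuous₂
    (LinearMap.mk₂ ℝ (integral L hp2 hq3)
      (fun A B y => by
        refine integral_eq L hp2 hq3 ?_ fun t => ?_
        · convert! (isSewing_intPath L hq3 A y).add (isSewing_intPath L hq3 B y) using 1
          funext s t
          have e : secondOrder (A + B) y s = secondOrder A y s + secondOrder B y s := by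
            ext a b
            simp
          simp only [Pi.add_apply, intGerm, e, map_add, path_add, add_apply]
          abel
        · simp [ContinuousLinearMap.add_comp])
      (fun c A y => by
        refine integral_eq L hp2 hq3 ?_ fun t => ?_
        · convert! (isSewing_intPath L hq3 A y).smul c using 1
          funext s t
          have e : secondOrder (c • A) y s = c • secondOrder A y s := by
            ext a b
            simp
          simp only [Pi.smul_apply, intGerm, e, map_smul, path_smul, smul_apply, smul_add]
        · simp [ContinuousLinearMap.smul_comp])
      (fun A y x => by
        refine integral_eq L hp2 hq3 ?_ fun t => ?_
        · convert! (isSewing_intPath L hq3 A y).add (isSewing_intPath L hq3 A x) using 1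
          funext s t
          have e : secondOrder A (y + x) s = secondOrder A y s + secondOrder A x s := by
            ext a b
            simp
          simp only [Pi.add_apply, intGerm, e, map_add, path_add, add_apply, map_sub]
          abel
        · simp [ContinuousLinearMap.comp_add])
      (fun c A y => by
        refine integral_eq L hp2 hq3 ?_ fun t => ?_
        · convert! (isSewing_intPath L hq3 A y).smul c using 1
          funext s t
          have e : secondOrder A (c • y) s = c • secondOrder A y s := by
            ext a b
            simp
          simp only [Pi.smul_apply, intGerm, e, map_smul, path_smul, smul_apply, smul_add, map_sub,
            smul_sub]
        · simp))
    (intConst L q X.exists_bound.choose) (norm_integral_le L hp2 hq3 X.exists_bound.choose_spec)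

end Integral

end ControlledPath

/-! ### Local solutions -/

section FixedPoint

variable {Z Y : Type*} [NormedAddCommGroup Z] [NormedSpace ℝ Z] [CompleteSpace Z]
  [NormedAddCommGroup Y] [NormedSpace ℝ Y]

/-- The solution `z` of `z = v + A (C z)` depends smoothly on `v` and on the linear map `A`. -/
theorem exists_contDiffAt_fixedPoint {C : Z → Y} {k : WithTop ℕ∞} (hC : ContDiff ℝ k C)
    (hk : k ≠ 0) {v₀ z₀ : Z} {A₀ : Y →L[ℝ] Z} {C' : Z →L[ℝ] Y} (hC' : HasFDerivAt C C' z₀)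
    (h : z₀ = v₀ + A₀ (C z₀)) (hlt : ‖A₀.comp C'‖ < 1) :
    ∃ φ : Z × (Y →L[ℝ] Z) → Z, ContDiffAt ℝ k φ (v₀, A₀) ∧ φ (v₀, A₀) = z₀ ∧
      ∀ᶠ a in nhds (v₀, A₀), φ a = a.1 + a.2 (C (φ a)) := by
  set f : (Z × (Y →L[ℝ] Z)) × Z → Z := fun b => b.2 - (b.1.1 + b.1.2 (C b.2)) with hf
  have hfd : ContDiff ℝ k f := contDiff_snd.sub ((contDiff_fst.comp contDiff_fst).add
    ((contDiff_snd.comp contDiff_fst).clm_apply (hC.comp contDiff_snd)))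
  have hcd : ContDiffAt ℝ k f ((v₀, A₀), z₀) := hfd.contDiffAt
  have hd : fderiv ℝ f ((v₀, A₀), z₀) ∘L .inr ℝ (Z × (Y →L[ℝ] Z)) Z =
      ContinuousLinearMap.id ℝ Z - A₀.comp C' := by
    have h1 : HasFDerivAt (fun z => f ((v₀, A₀), z))
        (fderiv ℝ f ((v₀, A₀), z₀) ∘L .inr ℝ (Z × (Y →L[ℝ] Z)) Z) z₀ :=
      (((hfd.differentiable hk) ((v₀, A₀), z₀)).hasFDerivAt).comp z₀
        (hasFDerivAt_prodMk_right (v₀, A₀) z₀)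
    have h2 : HasFDerivAt (fun z => f ((v₀, A₀), z))
        (ContinuousLinearMap.id ℝ Z - A₀.comp C') z₀ :=
      (hasFDerivAt_id z₀).sub ((A₀.hasFDerivAt.comp z₀ hC').const_add v₀)
    exact h1.unique h2
  -- The partial derivative in z is Id - A₀ C', inverted by the Neumann series.
  have hinv : (fderiv ℝ f ((v₀, A₀), z₀) ∘L .inr ℝ (Z × (Y →L[ℝ] Z)) Z).IsInvertible := by
    rw [hd]
    exact ⟨ContinuousLinearEquiv.unitsEquiv ℝ Z (Units.oneSub (A₀.comp C') hlt), rfl⟩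
  have h0 : f ((v₀, A₀), z₀) = 0 := sub_eq_zero.2 h
  refine ⟨hcd.implicitFunction hk hinv, hcd.contDiffAt_implicitFunction hk hinv,
    hcd.implicitFunction_apply_self hk hinv, ?_⟩
  filter_upwards [hcd.eventually_apply_implicitFunction hk hinv] with a ha
  rw [h0] at ha
  exact sub_eq_zero.1 ha

end FixedPoint

namespace ControlledPath

universe v

section Local

variable {E E2 : Type*} [NormedAddCommGroup E] [NormedSpace ℝ E]
  [NormedAddCommGroup E2] [NormedSpace ℝ E2] {T : TensorSquare E E2} {p q : ℝ}
  {X : RoughPath T p} {U : Type*} {V : Type v} [NormedAddCommGroup U] [NormedSpace ℝ U]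
  [NormedAddCommGroup V] [NormedSpace ℝ V] [CompleteSpace V]
  [hp : Fact (0 < p)] [hq : Fact (0 < q)]
  (L : T.Extension V) (hp2 : 2 ≤ p) (hpq : p < q) (hq3 : q < 3) {n : ℕ}

/-- The map `c ↦ ∫ c(F) dy`. -/
def drive (F : U →L[ℝ] LipMap V V n 1) (y : ControlledPath X U) :
    (LipMap V V n 1 →L[ℝ] ControlledPath (X.relax hp.out hpq.le) V) →L[ℝ] ControlledPath X V :=
  ((integralL X L hp2 hq3 hpq.le).flip y).comp
    ((flipL (X.relax hp.out hpq.le) U V).comp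
      ((ContinuousLinearMap.compL ℝ U (LipMap V V n 1)
        (ControlledPath (X.relax hp.out hpq.le) V)).flip F))

theorem drive_apply (F : U →L[ℝ] LipMap V V n 1) (y : ControlledPath X U)
    (c : LipMap V V n 1 →L[ℝ] ControlledPath (X.relax hp.out hpq.le) V) :
    drive L hp2 hpq hq3 F y c = integral L hp2 hq3 (flipPath (c.comp F)) y := rfl

theorem contDiff_drive {k : WithTop ℕ∞} :
    ContDiff ℝ k fun a : (U →L[ℝ] LipMap V V n 1) × ControlledPath X U =>
      drive L hp2 hpq hq3 a.1 a.2 := by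
  have h1 : ContDiff ℝ k (integralL (U := U) X L hp2 hq3 hpq.le).flip :=
    ContinuousLinearMap.contDiff _
  have h2 : ContDiff ℝ k (ContinuousLinearMap.compL ℝ U (LipMap V V n 1)
      (ControlledPath (X.relax hp.out hpq.le) V)).flip :=
    ContinuousLinearMap.contDiff _
  exact (h1.comp contDiff_snd).clm_comp (contDiff_const.clm_comp (h2.comp contDiff_fst))

theorem norm_drive_le {K : ℝ} (hX : X.Bound K) (F : U →L[ℝ] LipMap V V n 1)
    (y : ControlledPath X U) :
    ‖drive L hp2 hpq hq3 F y‖ ≤ 4 * intConst L q K * ‖F‖ * y.seminorm := by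
  have hc := intConst_nonneg L hq3 hX.nonneg
  have hy := y.seminorm_nonneg
  refine ContinuousLinearMap.opNorm_le_bound _ (by positivity) fun c => ?_
  rw [drive_apply]
  refine (norm_integral_le_seminorm L hp2 hq3 hX _ y).trans ?_
  have h1 : ‖flipPath (c.comp F)‖ ≤ 4 * (‖c‖ * ‖F‖) :=
    (norm_flipPath_le _).trans (mul_le_mul_of_nonneg_left (c.opNorm_comp_le F) (by norm_num))
  calc _ ≤ intConst L q K * (4 * (‖c‖ * ‖F‖)) * y.seminorm := by gcongr
    _ = _ := by ring

/-- The derivative of x ↦ F(x) in the nonlinear germ is also the one in the derivative of the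
controlled path F(z), so the nonlinear integral is the bilinear one with integrand F(z). -/
theorem germ_eq_intGerm (F : U →L[ℝ] LipMap V V (n + 1) 1) (y : ControlledPath X U)
    (z : ControlledPath X V) :
    germ L F y z = intGerm L (flipPath ((compRelax hpq V n z).comp F)) y := by
  funext s t
  rw [germ, intGerm, (hasFDerivAt_formAt F (z.path s)).fderiv]
  rfl

/-- The form z = v + A (C z): the data x₀, F, y enter only through the constant path and the linear
operator `drive`. -/
theorem isSolution_iff (x₀ : V) (F : U →L[ℝ] LipMap V V (n + 1) 1) (y : ControlledPath X U)
    (z : ControlledPath X V) :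
    IsSolution L x₀ F y z ↔
      z = const X V x₀ + drive L hp2 hpq hq3 F y (compRelax hpq V n z) := by
  rw [drive_apply]
  constructor
  · rintro ⟨⟨w, hw, hz⟩, hd⟩
    change IsSewing (germ L F y z) w at hw
    rw [germ_eq_intGerm L hpq] at hw
    have hu := (isSewing_intPath L hq3 _ y).unique hw
    refine ControlledPath.ext (fun t => ?_) fun t => ?_
    · rw [hz, path_add, integral_path, hu, const_path]
    · rw [hd, der_add, const_der, zero_add]
      rfl
  · intro h
    refine ⟨⟨_, ?_, fun t => congrArg (fun x => x.path t) h⟩, fun t => ?_⟩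
    · have := isSewing_intPath L hq3 (flipPath ((compRelax hpq V n z).comp F)) y
      rw [← germ_eq_intGerm] at this
      exact this
    · conv_lhs => rw [h]
      rw [der_add, const_der, zero_add]
      rfl

/-- For `‖F‖ < M` and `y` of seminorm less than `η`, the equation has a solution that is of class
`C^n` in the data, and that is unique among the paths of seminorm less than `η`. -/
def Solvable (X : RoughPath T p) (U : Type*) [NormedAddCommGroup U] [NormedSpace ℝ U]
    (L : T.Extension V) (n : ℕ) (M η : ℝ) : Prop :=
  ∃ S : V × (U →L[ℝ] LipMap V V (n + 1) 1) × ControlledPath X U → ControlledPath X V,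
    ∀ (x₀ : V) (F : U →L[ℝ] LipMap V V (n + 1) 1) (y : ControlledPath X U),
      ‖F‖ < M → y.seminorm < η →
      IsSolution L x₀ F y (S (x₀, F, y)) ∧ ContDiffAt ℝ n S (x₀, F, y) ∧
      ∀ z : ControlledPath X V, IsSolution L x₀ F y z → z.seminorm < η → z = S (x₀, F, y)

theorem norm_compRelax_le_of_seminorm_le_one {K : ℝ} (hX : X.Bound K) {z : ControlledPath X V}
    {W : Type*} [NormedAddCommGroup W] [NormedSpace ℝ W]
    (hz : z.seminorm ≤ 1) : ‖compRelax hpq W n z‖ ≤ 36 * (K + 1) ^ 2 := by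
  refine (norm_compRelax_le hpq hX z).trans ?_
  have h1 : (1 + z.seminorm) ^ 2 ≤ 2 ^ 2 :=
    pow_le_pow_left₀ (by linarith [z.seminorm_nonneg]) (by linarith) 2
  have h2 := mul_le_mul_of_nonneg_left h1 (by positivity : 0 ≤ 9 * (K + 1) ^ 2)
  linarith

/-- Here 1080 = 30 · 36. The bound serves as the Lipschitz constant of the composition map on the
convex unit ball of the seminorm. -/
theorem norm_compDeriv_compRelax_le {K : ℝ} (hX : X.Bound K) {z : ControlledPath X V}
    {W : Type*} [NormedAddCommGroup W] [NormedSpace ℝ W] (hz : z.seminorm ≤ 1) :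
    ‖compDeriv hpq X W (n + 1) (compRelax hpq (V →L[ℝ] W) n z)‖ ≤ 1080 * (K + 1) ^ 4 := by
  refine (norm_compDeriv_le hpq hX _).trans ?_
  have h1 := norm_compRelax_le_of_seminorm_le_one (n := n) (W := V →L[ℝ] W) hpq hX hz
  have h2 := mul_le_mul_of_nonneg_left h1 (by positivity : 0 ≤ 30 * (K + 1) ^ 2)
  refine h2.trans (le_of_eq ?_)
  ring

/-- On the unit ball the fixed point problem has exactly one solution if the driver is small. -/
theorem existsUnique_fixedPoint {K : ℝ} (hX : X.Bound K) (x₀ : V)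
    (A : (LipMap V V (n + 1 + 1) 1 →L[ℝ] ControlledPath (X.relax hp.out hpq.le) V) →L[ℝ]
      ControlledPath X V) (hA : ‖A‖ * (1080 * (K + 1) ^ 4) ≤ 1 / 2) :
    ∃ z : ControlledPath X V, z.seminorm ≤ 1 / 2 ∧
      z = const X V x₀ + A (compRelax hpq V (n + 1) z) ∧
      ∀ w : ControlledPath X V, w.seminorm ≤ 1 →
        w = const X V x₀ + A (compRelax hpq V (n + 1) w) → w = z := by
  set s : Set (ControlledPath X V) := {z | z.seminorm ≤ 1} with hs
  set Φ : ControlledPath X V → ControlledPath X V := fun z =>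
    const X V x₀ + A (compRelax hpq V (n + 1) z) with hΦ
  have hlip : ∀ z ∈ s, ∀ w ∈ s, ‖Φ w - Φ z‖ ≤ 1 / 2 * ‖w - z‖ := by
    intro z hz w hw
    have h1 := (convex_seminorm_le (X := X) (V := V) 1).norm_image_sub_le_of_norm_hasFDerivWithin_le
      (fun x _ => (hasFDerivAt_compRelax hpq n V x).hasFDerivWithinAt)
      (fun x hx => norm_compDeriv_compRelax_le (n := n) (W := V) hpq hX hx) hz hw
    have e : Φ w - Φ z = A (compRelax hpq V (n + 1) w - compRelax hpq V (n + 1) z) := by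
      rw [map_sub]
      exact add_sub_add_left_eq_sub _ _ _
    rw [e]
    refine (A.le_opNorm_of_le h1).trans ?_
    rw [← mul_assoc]
    exact mul_le_mul_of_nonneg_right hA (norm_nonneg _)
  -- The constant path x₀ does not enter the seminorm, so x₀ is arbitrary. The image lies well
  -- inside the ball, which later keeps nearby fixed points in the region of uniqueness.
  have hhalf : ∀ z ∈ s, (Φ z).seminorm ≤ 1 / 2 := by
    intro z hz
    rw [hΦ, seminorm_const_add]
    refine (seminorm_le_norm _).trans ((A.le_opNorm_of_le
      (norm_compRelax_le_of_seminorm_le_one hpq hX hz)).trans (le_trans ?_ hA))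
    refine mul_le_mul_of_nonneg_left ?_ (norm_nonneg _)
    have h1 : 1 ≤ (K + 1) ^ 2 := by nlinarith [hX.nonneg]
    nlinarith
  have hmaps : MapsTo Φ s s := fun z hz => (hhalf z hz).trans (by norm_num)
  have hcomplete : IsComplete s := (isClosed_le continuous_seminorm continuous_const).isComplete
  have hcontr : ContractingWith (1 / 2 : NNReal) (hmaps.restrict Φ s s) := by
    refine ⟨by
      rw [← NNReal.coe_lt_coe]
      norm_num, LipschitzWith.of_dist_le_mul fun a b => ?_⟩
    have := hlip b b.2 a a.2
    rw [Subtype.dist_eq, Subtype.dist_eq, dist_eq_norm, dist_eq_norm]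
    exact this.trans (le_of_eq (by norm_num))
  have h0 : (0 : ControlledPath X V) ∈ s := by
    change seminorm (0 : ControlledPath X V) ≤ 1
    refine (seminorm_le_norm _).trans ?_
    rw [norm_zero]
    exact zero_le_one
  obtain ⟨z, hzs, hz, -⟩ := hcontr.exists_fixedPoint' hcomplete hmaps h0 (edist_ne_top _ _)
  have hz' : Φ z = z := hz
  refine ⟨z, hz' ▸ hhalf z hzs, hz'.symm, fun w hw hw' => ?_⟩
  have h1 := hlip z hzs w hw
  have h2 : Φ w = w := hw'.symm
  rw [h2, hz'] at h1
  have h3 : ‖w - z‖ = 0 := le_antisymm (by linarith) (norm_nonneg _)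
  exact sub_eq_zero.1 (norm_eq_zero.1 h3)

/-- The norm of `drive` is at most a constant times ‖F‖ times the seminorm of y, so small y gives a
contraction. The implicit function theorem yields a smooth local branch of fixed points, identified
with the solution by uniqueness. It is essential that ε depends on X only through K. -/
theorem exists_solvable {p q : ℝ} (U : Type*) [NormedAddCommGroup U] [NormedSpace ℝ U]
    [hp : Fact (0 < p)] [hq : Fact (0 < q)] (hp2 : 2 ≤ p) (hpq : p < q) (hq3 : q < 3) {n : ℕ}
    (M K : ℝ) (hM : 0 < M) (hK : 0 ≤ K) :
    ∃ ε > 0, ∀ X : RoughPath T p, X.Bound K → Solvable X U L (n + 1) M ε := by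
  have hc := intConst_nonneg L hq3 hK
  set κ : ℝ := 4 * intConst L q K * M * (1080 * (K + 1) ^ 4) with hκ
  have hκ0 : 0 ≤ κ := by positivity
  -- This choice gives κ ε ≤ 1/2 for the contraction, and ε ≤ 1 so that paths of seminorm below ε
  -- lie in the uniqueness ball.
  refine ⟨1 / (2 * (κ + 1)), by positivity, fun X hX => ?_⟩
  set ε : ℝ := 1 / (2 * (κ + 1)) with hε
  have hε0 : 0 < ε := by positivity
  have hε1 : ε ≤ 1 := by
    rw [hε, div_le_one (by positivity)]
    linarith
  have hκε : κ * ε ≤ 1 / 2 := by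
    rw [hε, mul_one_div, div_le_div_iff₀ (by positivity) (by norm_num)]
    linarith
  have hsmall : ∀ (F : U →L[ℝ] LipMap V V (n + 1 + 1) 1) (y : ControlledPath X U),
      ‖F‖ < M → y.seminorm < ε →
      ‖drive L hp2 hpq hq3 F y‖ * (1080 * (K + 1) ^ 4) ≤ 1 / 2 := by
    intro F y hF hy
    have h1 := norm_drive_le L hp2 hpq hq3 hX F y
    have h2 : 4 * intConst L q K * ‖F‖ * y.seminorm ≤ 4 * intConst L q K * M * ε := by
      have := y.seminorm_nonneg
      gcongr
    calc _ ≤ 4 * intConst L q K * M * ε * (1080 * (K + 1) ^ 4) := by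
          gcongr
          exact h1.trans h2
      _ = κ * ε := by
          rw [hκ]
          ring
      _ ≤ _ := hκε
  -- For large data the value is the junk 0; this is harmless, since the small data form an open
  -- set.
  have hex : ∀ a : V × (U →L[ℝ] LipMap V V (n + 1 + 1) 1) × ControlledPath X U,
      ∃ z : ControlledPath X V, ‖a.2.1‖ < M → a.2.2.seminorm < ε → (z.seminorm ≤ 1 / 2 ∧
        z = const X V a.1 + drive L hp2 hpq hq3 a.2.1 a.2.2 (compRelax hpq V (n + 1) z) ∧
        ∀ w : ControlledPath X V, w.seminorm ≤ 1 →
          w = const X V a.1 + drive L hp2 hpq hq3 a.2.1 a.2.2 (compRelax hpq V (n + 1) w) →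
          w = z) := by
    intro a
    by_cases ha : ‖a.2.1‖ < M ∧ a.2.2.seminorm < ε
    · obtain ⟨z, hz⟩ := existsUnique_fixedPoint hpq hX a.1 (drive L hp2 hpq hq3 a.2.1 a.2.2)
        (hsmall a.2.1 a.2.2 ha.1 ha.2)
      exact ⟨z, fun _ _ => hz⟩
    · exact ⟨0, fun h1 h2 => absurd ⟨h1, h2⟩ ha⟩
  choose S hS using hex
  refine ⟨S, fun x₀ F y hF hy => ?_⟩
  obtain ⟨h1, h2, h3⟩ := hS (x₀, F, y) hF hy
  refine ⟨(isSolution_iff L hp2 hpq hq3 x₀ F y _).2 h2, ?_, fun z hz hzη =>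
    h3 z (hzη.le.trans hε1) ((isSolution_iff L hp2 hpq hq3 x₀ F y z).1 hz)⟩
  set D := compDeriv hpq X V (n + 1) (compRelax hpq (V →L[ℝ] V) n (S (x₀, F, y))) with hD
  have hlt : ‖(drive L hp2 hpq hq3 F y).comp D‖ < 1 := by
    refine lt_of_le_of_lt (ContinuousLinearMap.opNorm_comp_le _ _) ?_
    refine lt_of_le_of_lt (mul_le_mul_of_nonneg_left
      (norm_compDeriv_compRelax_le hpq hX (h1.trans (by norm_num))) (norm_nonneg _)) ?_
    linarith [hsmall F y hF hy]
  obtain ⟨φ, hφ, hφ0, hφe⟩ := exists_contDiffAt_fixedPoint (k := ((n + 1 : ℕ) : WithTop ℕ∞))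
    (contDiff_compRelax hpq (n + 1) V) (by norm_cast)
    (hasFDerivAt_compRelax hpq n V (S (x₀, F, y))) h2 hlt
  have hdata : ContDiff ℝ ((n + 1 : ℕ) : WithTop ℕ∞)
      fun a : V × (U →L[ℝ] LipMap V V (n + 1 + 1) 1) × ControlledPath X U =>
        (const X V a.1, drive L hp2 hpq hq3 a.2.1 a.2.2) :=
    ((const X V).contDiff.comp contDiff_fst).prodMk
      ((contDiff_drive L hp2 hpq hq3).comp contDiff_snd)
  have hcomp : ContDiffAt ℝ ((n + 1 : ℕ) : WithTop ℕ∞)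
      (fun a : V × (U →L[ℝ] LipMap V V (n + 1 + 1) 1) × ControlledPath X U =>
        φ (const X V a.1, drive L hp2 hpq hq3 a.2.1 a.2.2)) (x₀, F, y) :=
    ContDiffAt.comp (g := φ) (x₀, F, y) hφ hdata.contDiffAt
  refine hcomp.congr_of_eventuallyEq ?_
  have e1 : ∀ᶠ a : V × (U →L[ℝ] LipMap V V (n + 1 + 1) 1) × ControlledPath X U
      in nhds (x₀, F, y), ‖a.2.1‖ < M :=
    (continuous_norm.comp (continuous_fst.comp continuous_snd)).continuousAt.eventually_lt
      continuousAt_const hF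
  have e2 : ∀ᶠ a : V × (U →L[ℝ] LipMap V V (n + 1 + 1) 1) × ControlledPath X U
      in nhds (x₀, F, y), a.2.2.seminorm < ε :=
    (continuous_seminorm.comp (continuous_snd.comp continuous_snd)).continuousAt.eventually_lt
      continuousAt_const hy
  have e3 := hdata.continuous.continuousAt.eventually hφe
  -- At the base point the branch is the solution, of seminorm at most 1/2, so nearby it stays in
  -- the ball where fixed points are unique.
  have e4 : ∀ᶠ a : V × (U →L[ℝ] LipMap V V (n + 1 + 1) 1) × ControlledPath X U
      in nhds (x₀, F, y),
      (φ (const X V a.1, drive L hp2 hpq hq3 a.2.1 a.2.2)).seminorm < 1 := by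
    refine (ContinuousAt.comp continuous_seminorm.continuousAt
      hcomp.continuousAt).eventually_lt continuousAt_const ?_
    change (φ (const X V x₀, drive L hp2 hpq hq3 F y)).seminorm < 1
    rw [hφ0]
    linarith
  filter_upwards [e1, e2, e3, e4] with a h1 h2 h3 h4
  exact ((hS a h1 h2).2.2 _ h4.le h3).symm

end Local

end ControlledPath

/-! ### Restriction to the halves of the time interval -/

section Times

/-- The first half of the time interval. -/
def firstHalf : Icc (0 : ℝ) (1 / 2) := ⟨0, by norm_num⟩

/-- The second half of the time interval. -/
def secondHalf : Icc (0 : ℝ) (1 / 2) := ⟨1 / 2, by norm_num⟩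

/-- The affine map of `[0, 1]` onto `[c, c + 1/2]`. -/
def subTime (c : Icc (0 : ℝ) (1 / 2)) (t : Icc (0 : ℝ) 1) : Icc (0 : ℝ) 1 :=
  ⟨c + t / 2, by linarith [c.2.1, t.2.1], by linarith [c.2.2, t.2.2]⟩

theorem coe_subTime (c : Icc (0 : ℝ) (1 / 2)) (t : Icc (0 : ℝ) 1) :
    (subTime c t : ℝ) = c + t / 2 := rfl

theorem subTime_sub (c : Icc (0 : ℝ) (1 / 2)) (s t : Icc (0 : ℝ) 1) :
    (subTime c t : ℝ) - subTime c s = (t - s) / 2 := by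
  rw [coe_subTime, coe_subTime]
  ring

theorem subTime_mono (c : Icc (0 : ℝ) (1 / 2)) {s t : Icc (0 : ℝ) 1} (h : s ≤ t) :
    subTime c s ≤ subTime c t := by
  rw [← Subtype.coe_le_coe, coe_subTime, coe_subTime]
  have : (s : ℝ) ≤ t := h
  linarith

theorem subTime_first_zero : subTime firstHalf 0 = 0 :=
  Subtype.ext (by rw [coe_subTime]; norm_num [firstHalf])

theorem subTime_first_one : subTime firstHalf 1 = subTime secondHalf 0 :=
  Subtype.ext (by rw [coe_subTime, coe_subTime]; norm_num [firstHalf, secondHalf])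

theorem subTime_first_le_second (s t : Icc (0 : ℝ) 1) :
    subTime firstHalf s ≤ subTime secondHalf t := by
  rw [← Subtype.coe_le_coe, coe_subTime, coe_subTime]
  have h1 := s.2.2
  have h2 := t.2.1
  simp only [firstHalf, secondHalf]
  linarith

/-- The time elapsed in the first half, rescaled to `[0, 1]`. -/
def firstTime (t : Icc (0 : ℝ) 1) : Icc (0 : ℝ) 1 := projIcc 0 1 zero_le_one (2 * t)

/-- The time elapsed in the second half, rescaled to `[0, 1]`. -/
def secondTime (t : Icc (0 : ℝ) 1) : Icc (0 : ℝ) 1 := projIcc 0 1 zero_le_one (2 * t - 1)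

@[simp] theorem firstTime_first (t : Icc (0 : ℝ) 1) : firstTime (subTime firstHalf t) = t := by
  have : (2 : ℝ) * subTime firstHalf t = t := by
    rw [coe_subTime]
    simp only [firstHalf]
    ring
  rw [firstTime, this, projIcc_val]

@[simp] theorem firstTime_second (t : Icc (0 : ℝ) 1) : firstTime (subTime secondHalf t) = 1 := by
  refine projIcc_of_right_le _ ?_
  rw [coe_subTime]
  have := t.2.1
  simp only [secondHalf]
  linarith

@[simp] theorem secondTime_first (t : Icc (0 : ℝ) 1) : secondTime (subTime firstHalf t) = 0 := by
  refine projIcc_of_le_left _ ?_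
  rw [coe_subTime]
  have := t.2.2
  simp only [firstHalf]
  linarith

@[simp] theorem secondTime_second (t : Icc (0 : ℝ) 1) :
    secondTime (subTime secondHalf t) = t := by
  have : (2 : ℝ) * subTime secondHalf t - 1 = t := by
    rw [coe_subTime]
    simp only [secondHalf]
    ring
  rw [secondTime, this, projIcc_val]

theorem exists_subTime (t : Icc (0 : ℝ) 1) :
    (∃ a, t = subTime firstHalf a) ∨ ∃ a, t = subTime secondHalf a := by
  rcases le_total (t : ℝ) (1 / 2) with h | h
  · exact .inl ⟨⟨2 * t, by linarith [t.2.1], by linarith⟩, Subtype.ext (by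
      rw [coe_subTime]
      simp only [firstHalf]
      ring)⟩
  · exact .inr ⟨⟨2 * t - 1, by linarith, by linarith [t.2.2]⟩, Subtype.ext (by
      rw [coe_subTime]
      simp only [secondHalf]
      ring)⟩

theorem le_of_subTime_le {c : Icc (0 : ℝ) (1 / 2)} {s t : Icc (0 : ℝ) 1}
    (h : subTime c s ≤ subTime c t) : s ≤ t := by
  have h1 := time_sub_nonneg h
  rw [subTime_sub] at h1
  have h2 : (s : ℝ) ≤ t := by linarith
  exact h2

/-- Two ordered times lie in the same half or on both sides of the middle; the reverse order forces
both to be the middle. -/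
theorem subTime_cases {P : Icc (0 : ℝ) 1 → Icc (0 : ℝ) 1 → Prop}
    (h1 : ∀ s t, s ≤ t → P (subTime firstHalf s) (subTime firstHalf t))
    (h2 : ∀ s t, s ≤ t → P (subTime secondHalf s) (subTime secondHalf t))
    (h3 : ∀ s t, P (subTime firstHalf s) (subTime secondHalf t)) (s t : Icc (0 : ℝ) 1)
    (hst : s ≤ t) : P s t := by
  rcases exists_subTime s with ⟨a, rfl⟩ | ⟨a, rfl⟩ <;>
    rcases exists_subTime t with ⟨b, rfl⟩ | ⟨b, rfl⟩
  · exact h1 a b (le_of_subTime_le hst)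
  · exact h3 a b
  · have h := le_antisymm hst (subTime_first_le_second b a)
    have h0 : b = 1 := by
      rw [← firstTime_first b, ← h, firstTime_second]
    subst h0
    rw [h]
    exact h1 _ _ le_rfl
  · exact h2 a b (le_of_subTime_le hst)

end Times

/-- The factor by which a rough path of roughness `p` grows when time is slowed down to half
speed. -/
def halfScale (p : ℝ) : ℝ := 2 ^ (1 / p)

theorem halfScale_pos (p : ℝ) : 0 < halfScale p := Real.rpow_pos_of_pos two_pos _

theorem one_lt_halfScale {p : ℝ} (hp : 0 < p) : 1 < halfScale p :=
  Real.one_lt_rpow one_lt_two (one_div_pos.2 hp)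

theorem half_rpow_one_div (p : ℝ) {x : ℝ} (hx : 0 ≤ x) :
    (x / 2) ^ (1 / p) = (halfScale p)⁻¹ * x ^ (1 / p) := by
  rw [Real.div_rpow hx zero_le_two, div_eq_inv_mul, halfScale]

theorem halfScale_sq (p : ℝ) : halfScale p ^ 2 = 2 ^ (2 / p) := by
  rw [halfScale, ← Real.rpow_natCast, ← Real.rpow_mul zero_le_two]
  congr 1
  push_cast
  ring

theorem half_rpow_two_div (p : ℝ) {x : ℝ} (hx : 0 ≤ x) :
    (x / 2) ^ (2 / p) = (halfScale p ^ 2)⁻¹ * x ^ (2 / p) := by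
  rw [Real.div_rpow hx zero_le_two, div_eq_inv_mul, halfScale_sq]

theorem rpow_one_div_le_halfScale {p x y : ℝ} (hp : 0 < p) (hx : 0 ≤ x) (h : x ≤ 2 * y) :
    x ^ (1 / p) ≤ halfScale p * y ^ (1 / p) := by
  rw [halfScale, ← Real.mul_rpow zero_le_two (by linarith)]
  exact Real.rpow_le_rpow hx h (one_div_nonneg.2 hp.le)

theorem rpow_two_div_le_halfScale {p x y : ℝ} (hp : 0 < p) (hx : 0 ≤ x) (h : x ≤ 2 * y) :
    x ^ (2 / p) ≤ halfScale p ^ 2 * y ^ (2 / p) := by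
  rw [halfScale_sq, ← Real.mul_rpow zero_le_two (by linarith)]
  exact Real.rpow_le_rpow hx h (div_nonneg zero_le_two hp.le)

section Halves

variable {E E2 : Type*} [NormedAddCommGroup E] [NormedSpace ℝ E]
  [NormedAddCommGroup E2] [NormedSpace ℝ E2] {T : TensorSquare E E2} {p : ℝ}
  (X : RoughPath T p) (U V : Type*) [NormedAddCommGroup U] [NormedSpace ℝ U]
  [NormedAddCommGroup V] [NormedSpace ℝ V]

/-- Slowing time divides the bounds of the two levels by λ = `halfScale p` and λ²; the dilation
multiplies them back, so K is unchanged. -/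
theorem RoughPath.half_bound {X : RoughPath T p} {K : ℝ} (hX : X.Bound K)
    (c : Icc (0 : ℝ) (1 / 2)) {s t : Icc (0 : ℝ) 1} (hst : s ≤ t) :
    ‖halfScale p • X.fst (subTime c s) (subTime c t)‖ ≤ K * ((t : ℝ) - s) ^ (1 / p) ∧
    ‖halfScale p ^ 2 • X.snd (subTime c s) (subTime c t)‖ ≤ K * ((t : ℝ) - s) ^ (2 / p) := by
  have hpos := halfScale_pos p
  have h1 := hX.fst_le _ _ (subTime_mono c hst)
  have h2 := hX.snd_le _ _ (subTime_mono c hst)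
  rw [subTime_sub, half_rpow_one_div p (time_sub_nonneg hst)] at h1
  rw [subTime_sub, half_rpow_two_div p (time_sub_nonneg hst)] at h2
  rw [norm_smul, norm_smul, Real.norm_of_nonneg hpos.le, Real.norm_of_nonneg (by positivity)]
  refine ⟨(mul_le_mul_of_nonneg_left h1 hpos.le).trans_eq ?_,
    (mul_le_mul_of_nonneg_left h2 (by positivity)).trans_eq ?_⟩ <;> field_simp

/-- The rough path on the interval `[c, c + 1/2]`, reparametrized by `[0, 1]` and dilated. -/
def RoughPath.half (c : Icc (0 : ℝ) (1 / 2)) : RoughPath T p where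
  fst s t := halfScale p • X.fst (subTime c s) (subTime c t)
  snd s t := halfScale p ^ 2 • X.snd (subTime c s) (subTime c t)
  fst_add s u t hsu hut := by
    rw [X.fst_add _ _ _ (subTime_mono c hsu) (subTime_mono c hut), smul_add]
  chen s u t hsu hut := by
    rw [X.chen _ _ _ (subTime_mono c hsu) (subTime_mono c hut)]
    simp only [map_smul, smul_apply, smul_add, smul_smul, pow_two]
  fst_holder := by
    obtain ⟨K, hK⟩ := X.exists_bound
    exact ⟨K, fun s t hst => (half_bound hK c hst).1⟩
  snd_holder := by
    obtain ⟨K, hK⟩ := X.exists_bound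
    exact ⟨K, fun s t hst => (half_bound hK c hst).2⟩

theorem RoughPath.Bound.half {X : RoughPath T p} {K : ℝ} (hX : X.Bound K)
    (c : Icc (0 : ℝ) (1 / 2)) : (X.half c).Bound K :=
  ⟨hX.nonneg, fun _ _ hst => (half_bound hX c hst).1, fun _ _ hst => (half_bound hX c hst).2⟩

theorem RoughPath.fst_self (t) : X.fst t t = 0 := by
  simpa using X.fst_add t t t le_rfl le_rfl

theorem RoughPath.fst_subTime (c : Icc (0 : ℝ) (1 / 2)) (s t : Icc (0 : ℝ) 1) :
    X.fst (subTime c s) (subTime c t) = (halfScale p)⁻¹ • (X.half c).fst s t :=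
  (inv_smul_smul₀ (halfScale_pos p).ne' _).symm

theorem RoughPath.fst_subTime_first_second (s t : Icc (0 : ℝ) 1) :
    X.fst (subTime firstHalf s) (subTime secondHalf t) =
      (halfScale p)⁻¹ • ((X.half secondHalf).fst 0 t + (X.half firstHalf).fst s 1) := by
  have hs : s ≤ 1 := s.2.2
  have ht : 0 ≤ t := t.2.1
  rw [X.fst_add _ (subTime secondHalf 0) _ (subTime_first_le_second _ _) (subTime_mono _ ht),
    X.fst_subTime, ← subTime_first_one, X.fst_subTime, smul_add]

namespace ControlledPath

variable {X U V}

/-- The restriction of a controlled path to `[c, c + 1/2]`. -/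
def restrict (c : Icc (0 : ℝ) (1 / 2)) (z : ControlledPath X V) :
    (Icc (0 : ℝ) 1 → V) × (Icc (0 : ℝ) 1 → E →L[ℝ] V) :=
  (fun t => z.path (subTime c t), fun t => (halfScale p)⁻¹ • z.der (subTime c t))

/-- One factor 1/λ comes from the derivative, rescaled against the dilated X, the other from the
slower time. -/
theorem derivQuotient_restrict (c : Icc (0 : ℝ) (1 / 2)) (z : ControlledPath X V) (i) :
    derivQuotient p (restrict c z) i =
      (halfScale p ^ 2)⁻¹ • derivQuotient p z.1 (subTime c i.1, subTime c i.2) := by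
  have hpos := halfScale_pos p
  simp only [derivQuotient, restrict, subTime_sub, ← smul_sub, smul_smul]
  rw [abs_div, abs_two, half_rpow_one_div p (abs_nonneg _)]
  change _ • (z.der _ - z.der _) = _ • (z.der _ - z.der _)
  congr 1
  rw [mul_inv, inv_inv]
  field_simp

/-- In z' X the rescaling of z' cancels the dilation of X, so only the slower time contributes, with
1/λ². -/
theorem remQuotient_restrict (c : Icc (0 : ℝ) (1 / 2)) (z : ControlledPath X V) (i) :
    remQuotient (X.half c) (restrict c z) i = (halfScale p ^ 2)⁻¹ •
      remQuotient X z.1 ⟨(subTime c i.1.1, subTime c i.1.2), subTime_mono c i.2⟩ := by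
  have hpos := halfScale_pos p
  simp only [remQuotient, restrict, subTime_sub, smul_smul]
  rw [half_rpow_two_div p (time_sub_nonneg i.2), mul_inv, inv_inv,
    inv_mul_cancel_left₀ (by positivity)]
  simp only [RoughPath.half, map_smul, smul_apply, smul_smul, mul_inv_cancel₀ hpos.ne', one_smul]
  rfl

theorem norm_inv_sq_smul_le {G : Type*} [NormedAddCommGroup G] [NormedSpace ℝ G] (hp : 0 < p)
    {x : G} {C : ℝ} (h : ‖x‖ ≤ C) : ‖(halfScale p ^ 2)⁻¹ • x‖ ≤ (halfScale p)⁻¹ * C := by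
  have hpos := halfScale_pos p
  rw [norm_smul, Real.norm_of_nonneg (by positivity)]
  refine mul_le_mul ?_ h (norm_nonneg _) (by positivity)
  refine inv_anti₀ hpos ?_
  nlinarith [one_lt_halfScale hp]

variable [hp : Fact (0 < p)]

theorem restrict_bounds (c : Icc (0 : ℝ) (1 / 2)) (z : ControlledPath X V) :
    (∀ t, ‖(restrict c z).2 t‖ ≤ (halfScale p)⁻¹ * supNorm z.der) ∧
    (∀ i, ‖derivQuotient p (restrict c z) i‖ ≤
      (halfScale p)⁻¹ * supNorm (derivQuotient p z.1)) ∧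
    (∀ i, ‖remQuotient (X.half c) (restrict c z) i‖ ≤
      (halfScale p)⁻¹ * supNorm (remQuotient X z.1)) := by
  have hpos := halfScale_pos p
  refine ⟨fun t => ?_, fun i => ?_, fun i => ?_⟩
  · rw [restrict, norm_smul, Real.norm_of_nonneg (by positivity)]
    exact mul_le_mul_of_nonneg_left (le_supNorm z.2.1 _) (by positivity)
  · rw [derivQuotient_restrict]
    exact norm_inv_sq_smul_le hp.out (le_supNorm z.2.2.1 _)
  · rw [remQuotient_restrict]
    exact norm_inv_sq_smul_le hp.out (le_supNorm z.2.2.2 _)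

/-- The restriction of a controlled path to `[c, c + 1/2]`, as a controlled path. -/
def restrictPath (c : Icc (0 : ℝ) (1 / 2)) (z : ControlledPath X V) :
    ControlledPath (X.half c) V :=
  ⟨restrict c z, ⟨_, (restrict_bounds c z).1⟩, ⟨_, (restrict_bounds c z).2.1⟩,
    ⟨_, (restrict_bounds c z).2.2⟩⟩

@[simp] theorem restrictPath_path (c : Icc (0 : ℝ) (1 / 2)) (z : ControlledPath X V) (t) :
    (restrictPath c z).path t = z.path (subTime c t) := rfl

@[simp] theorem restrictPath_der (c : Icc (0 : ℝ) (1 / 2)) (z : ControlledPath X V) (t) :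
    (restrictPath c z).der t = (halfScale p)⁻¹ • z.der (subTime c t) := rfl

/-- All three parts shrink by at least 1/λ. This is the purpose of the dilation: restriction in time
alone need not decrease the supremum of z'. -/
theorem seminorm_restrictPath_le (c : Icc (0 : ℝ) (1 / 2)) (z : ControlledPath X V) :
    (restrictPath c z).seminorm ≤ (halfScale p)⁻¹ * z.seminorm := by
  have hpos := inv_pos.2 (halfScale_pos p)
  obtain ⟨h1, h2, h3⟩ := restrict_bounds c z
  rw [seminorm.eq_def z, mul_add, mul_add]
  exact add_le_add (add_le_add
    (supNorm_le (mul_nonneg hpos.le (supNorm_nonneg _)) h1)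
    (supNorm_le (mul_nonneg hpos.le (supNorm_nonneg _)) h2))
    (supNorm_le (mul_nonneg hpos.le (supNorm_nonneg _)) h3)

variable (X V) in
/-- Restriction to `[c, c + 1/2]` as a continuous linear map. -/
def restrictL (c : Icc (0 : ℝ) (1 / 2)) :
    ControlledPath X V →L[ℝ] ControlledPath (X.half c) V :=
  LinearMap.mkContinuous
    { toFun := restrictPath c
      map_add' := fun _ _ => by ext <;> simp
      map_smul' := fun r _ => by
        ext
        · simp
        · simp [smul_comm r] }
    ((halfScale p)⁻¹ + (X.exists_bound.choose + 1)) fun z => by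
      rw [add_mul]
      refine add_le_add ((seminorm_restrictPath_le c z).trans ?_)
        (z.path_le X.exists_bound.choose_spec _)
      exact mul_le_mul_of_nonneg_left z.seminorm_le_norm (inv_pos.2 (halfScale_pos p)).le

theorem ext_halves {z w : ControlledPath X V}
    (h1 : restrictPath firstHalf z = restrictPath firstHalf w)
    (h2 : restrictPath secondHalf z = restrictPath secondHalf w) : z = w := by
  have hp1 : ∀ t, z.path (subTime firstHalf t) = w.path (subTime firstHalf t) := fun t =>
    congrArg (fun v : ControlledPath (X.half firstHalf) V => v.path t) h1
  have hp2 : ∀ t, z.path (subTime secondHalf t) = w.path (subTime secondHalf t) := fun t =>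
    congrArg (fun v : ControlledPath (X.half secondHalf) V => v.path t) h2
  have hd1 : ∀ t, (halfScale p)⁻¹ • z.der (subTime firstHalf t) =
      (halfScale p)⁻¹ • w.der (subTime firstHalf t) := fun t =>
    congrArg (fun v : ControlledPath (X.half firstHalf) V => v.der t) h1
  have hd2 : ∀ t, (halfScale p)⁻¹ • z.der (subTime secondHalf t) =
      (halfScale p)⁻¹ • w.der (subTime secondHalf t) := fun t =>
    congrArg (fun v : ControlledPath (X.half secondHalf) V => v.der t) h2
  have hne := inv_ne_zero (halfScale_pos p).ne'
  refine ControlledPath.ext (fun t => ?_) fun t => ?_ <;>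
    rcases exists_subTime t with ⟨a, rfl⟩ | ⟨a, rfl⟩
  · exact hp1 a
  · exact hp2 a
  · exact smul_right_injective _ hne (hd1 a)
  · exact smul_right_injective _ hne (hd2 a)

/-! ### Concatenation -/

/-- The path of the concatenation. The second path is corrected so that the values and the
derivatives at the common time agree. -/
def gluePath (a : ControlledPath (X.half firstHalf) V) (b : ControlledPath (X.half secondHalf) V)
    (t : Icc (0 : ℝ) 1) : V :=
  a.path (firstTime t) + (b.path (secondTime t) - b.path 0) +
    (a.der 1 - b.der 0) ((X.half secondHalf).fst 0 (secondTime t))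

/-- The derivative of the concatenation. -/
def glueDer (a : ControlledPath (X.half firstHalf) V) (b : ControlledPath (X.half secondHalf) V)
    (t : Icc (0 : ℝ) 1) : E →L[ℝ] V :=
  halfScale p • (a.der (firstTime t) + (b.der (secondTime t) - b.der 0))

/-- Inside one half the increments are those of a or b. Across the middle the remainder splits into
that of a up to its end, that of b from its start, and (a'_1 - a'_s) X, a product of two increments
of order 1/p. Thanks to the correction in `gluePath` and `glueDer`, no matching at the junction is
needed, and concatenation is a linear map on the whole product space. -/
theorem glue_bounds {K : ℝ} (hX : X.Bound K) (a : ControlledPath (X.half firstHalf) V)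
    (b : ControlledPath (X.half secondHalf) V) :
    (∀ t, ‖glueDer a b t‖ ≤ halfScale p * (2 * (a.seminorm + b.seminorm))) ∧
    (0 ≤ halfScale p ^ 2 * (a.seminorm + b.seminorm) ∧ ∀ s t, s ≤ t →
      ‖glueDer a b t - glueDer a b s‖ ≤
        halfScale p ^ 2 * (a.seminorm + b.seminorm) * ((t : ℝ) - s) ^ (1 / p)) ∧
    (0 ≤ halfScale p ^ 2 * ((K + 1) * (a.seminorm + b.seminorm)) ∧ ∀ s t, s ≤ t →
      ‖gluePath a b t - gluePath a b s - glueDer a b s (X.fst s t)‖ ≤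
        halfScale p ^ 2 * ((K + 1) * (a.seminorm + b.seminorm)) * ((t : ℝ) - s) ^ (2 / p)) := by
  have hpos := halfScale_pos p
  have ha := a.seminorm_nonneg
  have hb := b.seminorm_nonneg
  have hK := hX.nonneg
  have hne := hpos.ne'
  have cross : ∀ s t : Icc (0 : ℝ) 1,
      (1 : ℝ) - s ≤ 2 * ((subTime secondHalf t : ℝ) - subTime firstHalf s) ∧
      (t : ℝ) - 0 ≤ 2 * ((subTime secondHalf t : ℝ) - subTime firstHalf s) := by
    intro s t
    rw [coe_subTime, coe_subTime]
    simp only [firstHalf, secondHalf]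
    constructor <;> linarith [s.2.2, t.2.1]
  have inner : ∀ (c : Icc (0 : ℝ) (1 / 2)) (s t : Icc (0 : ℝ) 1),
      (t : ℝ) - s ≤ 2 * ((subTime c t : ℝ) - subTime c s) := by
    intro c s t
    rw [subTime_sub]
    linarith
  refine ⟨fun t => ?_, ⟨by positivity, subTime_cases (fun s t hst => ?_) (fun s t hst => ?_)
    fun s t => ?_⟩, ⟨by positivity, subTime_cases (fun s t hst => ?_) (fun s t hst => ?_)
    fun s t => ?_⟩⟩
  · rw [glueDer, norm_smul, Real.norm_of_nonneg hpos.le]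
    refine mul_le_mul_of_nonneg_left ?_ hpos.le
    refine (norm_add_le_of_le (a.der_le _) (norm_sub_le_of_le (b.der_le _) (b.der_le 0))).trans ?_
    linarith
  · have e : glueDer a b (subTime firstHalf t) - glueDer a b (subTime firstHalf s) =
        halfScale p • (a.der t - a.der s) := by
      simp only [glueDer, firstTime_first, secondTime_first, ← smul_sub]
      congr 1
      abel
    rw [e, norm_smul, Real.norm_of_nonneg hpos.le]
    have h1 := a.der_sub_le hst
    have h2 := rpow_one_div_le_halfScale hp.out (time_sub_nonneg hst) (inner firstHalf s t)
    set ρ := ((subTime firstHalf t : ℝ) - subTime firstHalf s) ^ (1 / p)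
    have h3 : 0 ≤ ρ := time_rpow_nonneg (subTime_mono _ hst) _
    calc _ ≤ halfScale p * ((a.seminorm + b.seminorm) * (halfScale p * ρ)) := by
          gcongr
          exact h1.trans (mul_le_mul (by linarith) h2 (time_rpow_nonneg hst _) (by positivity))
      _ = _ := by ring
  · have e : glueDer a b (subTime secondHalf t) - glueDer a b (subTime secondHalf s) =
        halfScale p • (b.der t - b.der s) := by
      simp only [glueDer, firstTime_second, secondTime_second, ← smul_sub]
      congr 1
      abel
    rw [e, norm_smul, Real.norm_of_nonneg hpos.le]
    have h1 := b.der_sub_le hst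
    have h2 := rpow_one_div_le_halfScale hp.out (time_sub_nonneg hst) (inner secondHalf s t)
    set ρ := ((subTime secondHalf t : ℝ) - subTime secondHalf s) ^ (1 / p)
    have h3 : 0 ≤ ρ := time_rpow_nonneg (subTime_mono _ hst) _
    calc _ ≤ halfScale p * ((a.seminorm + b.seminorm) * (halfScale p * ρ)) := by
          gcongr
          exact h1.trans (mul_le_mul (by linarith) h2 (time_rpow_nonneg hst _) (by positivity))
      _ = _ := by ring
  · have e : glueDer a b (subTime secondHalf t) - glueDer a b (subTime firstHalf s) =
        halfScale p • ((a.der 1 - a.der s) + (b.der t - b.der 0)) := by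
      simp only [glueDer, firstTime_first, secondTime_first, firstTime_second, secondTime_second,
        ← smul_sub]
      congr 1
      abel
    rw [e, norm_smul, Real.norm_of_nonneg hpos.le]
    have hs : s ≤ 1 := s.2.2
    have ht : 0 ≤ t := t.2.1
    have h1 := a.der_sub_le hs
    have h1' := b.der_sub_le ht
    have h2 := rpow_one_div_le_halfScale hp.out (time_sub_nonneg hs) (cross s t).1
    have h2' := rpow_one_div_le_halfScale hp.out (time_sub_nonneg ht) (cross s t).2
    set ρ := ((subTime secondHalf t : ℝ) - subTime firstHalf s) ^ (1 / p)
    calc _ ≤ halfScale p * (a.seminorm * (halfScale p * ρ) + b.seminorm * (halfScale p * ρ)) := by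
          gcongr
          exact norm_add_le_of_le (h1.trans (mul_le_mul_of_nonneg_left h2 ha))
            (h1'.trans (mul_le_mul_of_nonneg_left h2' hb))
      _ = _ := by ring
  · have e : gluePath a b (subTime firstHalf t) - gluePath a b (subTime firstHalf s) -
        glueDer a b (subTime firstHalf s) (X.fst (subTime firstHalf s) (subTime firstHalf t)) =
        a.path t - a.path s - a.der s ((X.half firstHalf).fst s t) := by
      simp only [gluePath, glueDer, firstTime_first, secondTime_first, X.fst_subTime, map_smul,
        smul_apply, inv_smul_smul₀ hne, sub_self, add_zero, RoughPath.fst_self, map_zero]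
    rw [e]
    have h1 := a.rem_le hst
    have h2 := rpow_two_div_le_halfScale hp.out (time_sub_nonneg hst) (inner firstHalf s t)
    set ρ := ((subTime firstHalf t : ℝ) - subTime firstHalf s) ^ (2 / p)
    calc _ ≤ ((K + 1) * (a.seminorm + b.seminorm)) * (halfScale p ^ 2 * ρ) :=
          h1.trans (mul_le_mul (by nlinarith) h2 (time_rpow_nonneg hst _) (by positivity))
      _ = _ := by ring
  · have e : gluePath a b (subTime secondHalf t) - gluePath a b (subTime secondHalf s) -
        glueDer a b (subTime secondHalf s) (X.fst (subTime secondHalf s) (subTime secondHalf t)) =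
        b.path t - b.path s - b.der s ((X.half secondHalf).fst s t) := by
      have h0 : 0 ≤ s := s.2.1
      simp only [gluePath, glueDer, firstTime_second, secondTime_second, X.fst_subTime, map_smul,
        smul_apply, smul_add, inv_smul_smul₀ hne,
        (X.half secondHalf).fst_add 0 s t h0 hst, map_add, add_apply, sub_apply]
      abel
    rw [e]
    have h1 := b.rem_le hst
    have h2 := rpow_two_div_le_halfScale hp.out (time_sub_nonneg hst) (inner secondHalf s t)
    set ρ := ((subTime secondHalf t : ℝ) - subTime secondHalf s) ^ (2 / p)
    calc _ ≤ ((K + 1) * (a.seminorm + b.seminorm)) * (halfScale p ^ 2 * ρ) :=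
          h1.trans (mul_le_mul (by nlinarith) h2 (time_rpow_nonneg hst _) (by positivity))
      _ = _ := by ring
  · have hs : s ≤ 1 := s.2.2
    have ht : 0 ≤ t := t.2.1
    have e : gluePath a b (subTime secondHalf t) - gluePath a b (subTime firstHalf s) -
        glueDer a b (subTime firstHalf s) (X.fst (subTime firstHalf s) (subTime secondHalf t)) =
        (a.path 1 - a.path s - a.der s ((X.half firstHalf).fst s 1)) +
        (b.path t - b.path 0 - b.der 0 ((X.half secondHalf).fst 0 t)) +
        (a.der 1 - a.der s) ((X.half secondHalf).fst 0 t) := by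
      simp only [gluePath, glueDer, firstTime_first, secondTime_first, firstTime_second,
        secondTime_second, X.fst_subTime_first_second, map_smul,
        smul_apply, smul_add, inv_smul_smul₀ hne,
        map_add, sub_apply, RoughPath.fst_self, map_zero, sub_self, add_zero]
      abel
    rw [e]
    have h1 := a.rem_le hs
    have h1' := b.rem_le ht
    have h1'' := (a.der 1 - a.der s).le_of_opNorm_le_of_le (a.der_sub_le hs)
      ((hX.half secondHalf).fst_le 0 t ht)
    have h2 := rpow_two_div_le_halfScale hp.out (time_sub_nonneg hs) (cross s t).1
    have h2' := rpow_two_div_le_halfScale hp.out (time_sub_nonneg ht) (cross s t).2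
    have h3 := rpow_one_div_le_halfScale hp.out (time_sub_nonneg hs) (cross s t).1
    have h3' := rpow_one_div_le_halfScale hp.out (time_sub_nonneg ht) (cross s t).2
    have hr := Real.rpow_nonneg (time_sub_nonneg (subTime_first_le_second s t)) (2 / p)
    have hr' := Real.rpow_nonneg (time_sub_nonneg (subTime_first_le_second s t)) (1 / p)
    have hsq : ((subTime secondHalf t : ℝ) - subTime firstHalf s) ^ (1 / p) *
        ((subTime secondHalf t : ℝ) - subTime firstHalf s) ^ (1 / p) =
        ((subTime secondHalf t : ℝ) - subTime firstHalf s) ^ (2 / p) := by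
      rw [rpow_div_mul (subTime_first_le_second s t) hp.out zero_le_one zero_le_one]
      norm_num
    set ρ := ((subTime secondHalf t : ℝ) - subTime firstHalf s) ^ (2 / p)
    set r := ((subTime secondHalf t : ℝ) - subTime firstHalf s) ^ (1 / p)
    have hc : a.seminorm * ((1 : ℝ) - s) ^ (1 / p) * (K * ((t : ℝ) - 0) ^ (1 / p)) ≤
        a.seminorm * (halfScale p * r) * (K * (halfScale p * r)) := by
      have := time_rpow_nonneg ht (1 / p)
      exact mul_le_mul (mul_le_mul_of_nonneg_left h3 ha) (mul_le_mul_of_nonneg_left h3' hK)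
        (mul_nonneg hK this) (by positivity)
    calc _ ≤ a.seminorm * (halfScale p ^ 2 * ρ) + b.seminorm * (halfScale p ^ 2 * ρ) +
          a.seminorm * (halfScale p * r) * (K * (halfScale p * r)) :=
          norm_add_le_of_le (norm_add_le_of_le (h1.trans (mul_le_mul_of_nonneg_left h2 ha))
            (h1'.trans (mul_le_mul_of_nonneg_left h2' hb))) (h1''.trans hc)
      _ = halfScale p ^ 2 * (a.seminorm + b.seminorm + K * a.seminorm) * ρ := by
          rw [← hsq]
          ring
      _ ≤ _ := by
          gcongr
          nlinarith

variable (X V) in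
/-- Concatenation of paths on the two halves of the time interval. -/
def glue : ControlledPath (X.half firstHalf) V × ControlledPath (X.half secondHalf) V →L[ℝ]
    ControlledPath X V :=
  LinearMap.mkContinuous
    { toFun := fun c =>
        have H := glue_bounds X.exists_bound.choose_spec c.1 c.2
        ofBounds X (gluePath c.1 c.2) (glueDer c.1 c.2) H.1 H.2.1 H.2.2
      map_add' := fun c d => by
        refine ControlledPath.ext (fun t => ?_) fun t => ?_
        · simp only [ofBounds_path, path_add, gluePath, Prod.fst_add, Prod.snd_add, der_add,
            add_apply, sub_apply]
          abel
        · simp only [ofBounds_der, der_add, glueDer, Prod.fst_add, Prod.snd_add, ← smul_add]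
          congr 1
          abel
      map_smul' := fun r d => by
        refine ControlledPath.ext (fun t => ?_) fun t => ?_
        · simp only [ofBounds_path, path_smul, gluePath, Prod.smul_fst, Prod.smul_snd, der_smul,
            smul_apply, sub_apply, smul_add, smul_sub, RingHom.id_apply]
        · simp only [ofBounds_der, der_smul, glueDer, Prod.smul_fst, Prod.smul_snd, ← smul_add,
            ← smul_sub, RingHom.id_apply]
          rw [smul_comm] }
    (2 * (halfScale p * 2 + halfScale p ^ 2 +
      halfScale p ^ 2 * (X.exists_bound.choose + 1)) + 1) fun c => by
      have hX := X.exists_bound.choose_spec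
      have H := glue_bounds hX c.1 c.2
      have h := seminorm_le_of_bounds
        (w := ofBounds X (gluePath c.1 c.2) (glueDer c.1 c.2) H.1 H.2.1 H.2.2) H.1 H.2.1 H.2.2
      have h1 : c.1.seminorm ≤ ‖c‖ := c.1.seminorm_le_norm.trans (norm_fst_le c)
      have h2 : c.2.seminorm ≤ ‖c‖ := c.2.seminorm_le_norm.trans (norm_snd_le c)
      have h0 : gluePath c.1 c.2 0 = c.1.path 0 := by
        rw [← subTime_first_zero, gluePath, firstTime_first, secondTime_first,
          RoughPath.fst_self, map_zero, sub_self, add_zero, add_zero, subTime_first_zero]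
      have h3 : ‖c.1.path 0‖ ≤ ‖c‖ := c.1.path_zero_le.trans (norm_fst_le c)
      have hpos := halfScale_pos p
      have hK := hX.nonneg
      change seminorm _ + ‖gluePath c.1 c.2 0‖ ≤ _
      rw [h0]
      refine (add_le_add_left h _).trans ?_
      have h4 : (halfScale p * 2 + halfScale p ^ 2 +
        halfScale p ^ 2 * (X.exists_bound.choose + 1)) * (c.1.seminorm + c.2.seminorm) ≤
        (halfScale p * 2 + halfScale p ^ 2 +
        halfScale p ^ 2 * (X.exists_bound.choose + 1)) * (2 * ‖c‖) :=
        mul_le_mul_of_nonneg_left (by linarith) (by positivity)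
      linarith

theorem glue_path (a : ControlledPath (X.half firstHalf) V)
    (b : ControlledPath (X.half secondHalf) V) (t) :
    (glue X V (a, b)).path t = gluePath a b t := rfl

theorem glue_der (a : ControlledPath (X.half firstHalf) V)
    (b : ControlledPath (X.half secondHalf) V) (t) :
    (glue X V (a, b)).der t = glueDer a b t := rfl

theorem restrictPath_first_glue (a : ControlledPath (X.half firstHalf) V)
    (b : ControlledPath (X.half secondHalf) V) :
    restrictPath firstHalf (glue X V (a, b)) = a := by
  have hne := (halfScale_pos p).ne'
  refine ControlledPath.ext (fun t => ?_) fun t => ?_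
  · simp [glue_path, gluePath, RoughPath.fst_self]
  · simp [glue_der, glueDer, hne]

/-- The corrections vanish exactly when values and derivatives match at the junction. -/
theorem restrictPath_second_glue {a : ControlledPath (X.half firstHalf) V}
    {b : ControlledPath (X.half secondHalf) V} (h : b.path 0 = a.path 1)
    (h' : b.der 0 = a.der 1) :
    restrictPath secondHalf (glue X V (a, b)) = b := by
  have hne := (halfScale_pos p).ne'
  refine ControlledPath.ext (fun t => ?_) fun t => ?_
  · simp [glue_path, gluePath, h, h']
  · simp [glue_der, glueDer, hne, h']

end ControlledPath

end Halves

/-! ### Solutions on the halves of the time interval -/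

section Increments

variable {W : Type*} [NormedAddCommGroup W]

/-- The increments of the path `w` are those of the germ `Ξ` up to `O(|t - s| ^ ζ)` for some
`ζ > 1`. -/
def IncrementsNear (Ξ : Icc (0 : ℝ) 1 → Icc (0 : ℝ) 1 → W) (w : Icc (0 : ℝ) 1 → W) : Prop :=
  ∃ ζ : ℝ, 1 < ζ ∧ ∃ C : ℝ, ∀ s t : Icc (0 : ℝ) 1, s ≤ t →
    ‖w t - w s - Ξ s t‖ ≤ C * ((t : ℝ) - s) ^ ζ

theorem IncrementsNear.restrict {Ξ : Icc (0 : ℝ) 1 → Icc (0 : ℝ) 1 → W} {w : Icc (0 : ℝ) 1 → W}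
    (h : IncrementsNear Ξ w) (c : Icc (0 : ℝ) (1 / 2)) :
    IncrementsNear (fun s t => Ξ (subTime c s) (subTime c t)) fun t => w (subTime c t) := by
  obtain ⟨ζ, hζ, C, hC⟩ := h
  refine ⟨ζ, hζ, |C|, fun s t hst => (hC _ _ (subTime_mono c hst)).trans ?_⟩
  have h0 := time_sub_nonneg hst
  rw [subTime_sub]
  exact mul_le_mul (le_abs_self C) (Real.rpow_le_rpow (by linarith) (by linarith) (by linarith))
    (Real.rpow_nonneg (by linarith) _) (abs_nonneg C)

/-- Across the middle the error is the sum of the errors on the two sides minus the defect of the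
germ at the middle, which almost additivity controls. -/
theorem IncrementsNear.of_halves {Ξ : Icc (0 : ℝ) 1 → Icc (0 : ℝ) 1 → W}
    {w : Icc (0 : ℝ) 1 → W}
    (h1 : IncrementsNear (fun s t => Ξ (subTime firstHalf s) (subTime firstHalf t))
      fun t => w (subTime firstHalf t))
    (h2 : IncrementsNear (fun s t => Ξ (subTime secondHalf s) (subTime secondHalf t))
      fun t => w (subTime secondHalf t))
    {D ζ : ℝ} (hζ : 1 < ζ) (hD : ∀ s u t, s ≤ u → u ≤ t →
      ‖Ξ s t - Ξ s u - Ξ u t‖ ≤ D * ((t : ℝ) - s) ^ ζ) : IncrementsNear Ξ w := by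
  obtain ⟨ζ₁, hζ₁, C₁, h1⟩ := h1
  obtain ⟨ζ₂, hζ₂, C₂, h2⟩ := h2
  set μ := min ζ (min ζ₁ ζ₂) with hμ
  have hμ1 : 1 < μ := lt_min hζ (lt_min hζ₁ hζ₂)
  have hμ0 : 0 ≤ μ := by linarith
  -- Lengths in the rescaled time of a half are at most twice the true lengths; the smallest
  -- exponent μ serves for all the estimates.
  have key : ∀ {z C x : ℝ} {s t : Icc (0 : ℝ) 1} (_ : s ≤ t) {a b : Icc (0 : ℝ) 1}
      (_ : a ≤ b), μ ≤ z → (b : ℝ) - a ≤ 2 * ((t : ℝ) - s) → x ≤ C * ((b : ℝ) - a) ^ z →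
      x ≤ |C| * 2 ^ μ * ((t : ℝ) - s) ^ μ := by
    intro z C x s t hst a b hab hz hle hx
    refine hx.trans ?_
    rw [mul_assoc, ← Real.mul_rpow zero_le_two (time_sub_nonneg hst)]
    exact mul_le_mul (le_abs_self C) ((time_rpow_le hab hμ0 hz).trans
      (Real.rpow_le_rpow (time_sub_nonneg hab) hle hμ0)) (time_rpow_nonneg hab _) (abs_nonneg C)
  have hz : μ ≤ ζ := min_le_left _ _
  have hz1 : μ ≤ ζ₁ := (min_le_right _ _).trans (min_le_left _ _)
  have hz2 : μ ≤ ζ₂ := (min_le_right _ _).trans (min_le_right _ _)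
  have grow : ∀ {C C' : ℝ} {s t : Icc (0 : ℝ) 1}, s ≤ t → |C| ≤ C' →
      |C| * 2 ^ μ * ((t : ℝ) - s) ^ μ ≤ C' * 2 ^ μ * ((t : ℝ) - s) ^ μ := by
    intro C C' s t hst h
    have := time_rpow_nonneg hst μ
    gcongr
  have hC1 : |C₁| ≤ |C₁| + |C₂| + |D| := by linarith [abs_nonneg C₂, abs_nonneg D]
  have hC2 : |C₂| ≤ |C₁| + |C₂| + |D| := by linarith [abs_nonneg C₁, abs_nonneg D]
  refine ⟨μ, hμ1, (|C₁| + |C₂| + |D|) * 2 ^ μ, subTime_cases (fun s t hst => ?_)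
    (fun s t hst => ?_) fun s t => ?_⟩
  · have hle := subTime_mono firstHalf hst
    refine (key hle hst hz1 ?_ (h1 s t hst)).trans (grow hle hC1)
    rw [subTime_sub]
    linarith
  · have hle := subTime_mono secondHalf hst
    refine (key hle hst hz2 ?_ (h2 s t hst)).trans (grow hle hC2)
    rw [subTime_sub]
    linarith
  · have hs : s ≤ 1 := s.2.2
    have ht : 0 ≤ t := t.2.1
    have hle := subTime_first_le_second s t
    have hsu := subTime_mono firstHalf hs
    have hut := subTime_mono secondHalf ht
    rw [subTime_first_one] at hsu
    have e1 : (1 : ℝ) - s ≤ 2 * ((subTime secondHalf t : ℝ) - subTime firstHalf s) := by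
      rw [coe_subTime, coe_subTime]
      simp only [firstHalf, secondHalf]
      linarith [s.2.2, t.2.1]
    have e2 : (t : ℝ) - 0 ≤ 2 * ((subTime secondHalf t : ℝ) - subTime firstHalf s) := by
      rw [coe_subTime, coe_subTime]
      simp only [firstHalf, secondHalf]
      linarith [s.2.2, t.2.1]
    have b1 := h1 s 1 hs
    simp only [subTime_first_one] at b1
    have b1 := key hle hs hz1 e1 b1
    have b2 := key hle ht hz2 e2 (h2 0 t ht)
    have b3 := key hle hle hz (by linarith [time_sub_nonneg hle]) (hD _ _ _ hsu hut)
    set m := subTime secondHalf 0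
    have e : w (subTime secondHalf t) - w (subTime firstHalf s) -
        Ξ (subTime firstHalf s) (subTime secondHalf t) =
        (w m - w (subTime firstHalf s) - Ξ (subTime firstHalf s) m) +
        (w (subTime secondHalf t) - w m - Ξ m (subTime secondHalf t)) -
        (Ξ (subTime firstHalf s) (subTime secondHalf t) - Ξ (subTime firstHalf s) m -
          Ξ m (subTime secondHalf t)) := by abel
    rw [e]
    refine (norm_sub_le_of_le (norm_add_le_of_le b1 b2) b3).trans (le_of_eq ?_)
    ring

end Increments

namespace ControlledPath

universe v

section General

variable {E E2 : Type*} [NormedAddCommGroup E] [NormedSpace ℝ E]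
  [NormedAddCommGroup E2] [NormedSpace ℝ E2] {T : TensorSquare E E2} {p : ℝ}
  {X : RoughPath T p} {U V : Type*} [NormedAddCommGroup U] [NormedSpace ℝ U]
  [NormedAddCommGroup V] [NormedSpace ℝ V] (L : T.Extension V) {m : ℕ} {δ : ℝ}

/-- Shifting by x₀ separates the initial value from the condition on increments, and only the latter
is stable under restriction. -/
theorem isSolution_iff_incrementsNear (x₀ : V) (F : U →L[ℝ] LipMap V V m δ)
    (y : ControlledPath X U) (z : ControlledPath X V) :
    IsSolution L x₀ F y z ↔ z.path 0 = x₀ ∧ IncrementsNear (germ L F y z) z.path ∧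
      ∀ t, z.der t = (formAt F (z.path t)).comp (y.der t) := by
  constructor
  · rintro ⟨⟨w, ⟨hw0, ζ, hζ, C, hC⟩, hz⟩, hd⟩
    refine ⟨by rw [hz, hw0, add_zero], ⟨ζ, hζ, C, fun s t hst => ?_⟩, hd⟩
    rw [hz t, hz s, add_sub_add_left_eq_sub]
    exact hC s t hst
  · rintro ⟨h0, ⟨ζ, hζ, C, hC⟩, hd⟩
    refine ⟨⟨fun t => z.path t - x₀, ⟨sub_eq_zero.2 h0, ζ, hζ, C, fun s t hst => ?_⟩,
      fun t => (add_sub_cancel _ _).symm⟩, hd⟩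
    rw [sub_sub_sub_cancel_right]
    exact hC s t hst

variable [hp : Fact (0 < p)]

/-- In the second-order term the factors 1/λ of the two derivatives cancel against the factor λ² of
the dilated second level. -/
theorem germ_restrictPath (c : Icc (0 : ℝ) (1 / 2)) (F : U →L[ℝ] LipMap V V m δ)
    (y : ControlledPath X U) (z : ControlledPath X V) :
    germ L F (restrictPath c y) (restrictPath c z) =
      fun s t => germ L F y z (subTime c s) (subTime c t) := by
  funext s t
  have hne := (halfScale_pos p).ne'
  have e : (fderiv ℝ (formAt F) (z.path (subTime c s))).bilinearComp
      ((restrictPath c z).der s) ((restrictPath c y).der s) =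
      (halfScale p ^ 2)⁻¹ • (fderiv ℝ (formAt F) (z.path (subTime c s))).bilinearComp
        (z.der (subTime c s)) (y.der (subTime c s)) := by
    ext a b
    simp only [restrictPath_der, ContinuousLinearMap.bilinearComp_apply, smul_apply, map_smul,
      smul_smul, pow_two, mul_inv]
  rw [germ, germ, restrictPath_path, restrictPath_path, restrictPath_path, e, map_smul, smul_apply]
  change _ + _ • (L.lift _) (halfScale p ^ 2 • _) = _
  rw [map_smul, inv_smul_smul₀ (pow_ne_zero 2 hne)]

theorem restrictPath_der_iff (c : Icc (0 : ℝ) (1 / 2)) (F : U →L[ℝ] LipMap V V m δ)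
    (y : ControlledPath X U) (z : ControlledPath X V) (t) :
    (restrictPath c z).der t =
      (formAt F ((restrictPath c z).path t)).comp ((restrictPath c y).der t) ↔
    z.der (subTime c t) = (formAt F (z.path (subTime c t))).comp (y.der (subTime c t)) := by
  have hne := inv_ne_zero (halfScale_pos p).ne'
  rw [restrictPath_der, restrictPath_der, restrictPath_path, ContinuousLinearMap.comp_smul]
  exact (smul_right_injective (E →L[ℝ] V) hne).eq_iff

theorem seminorm_restrictPath_lt (c : Icc (0 : ℝ) (1 / 2)) {z : ControlledPath X V} {η : ℝ}
    (hz : z.seminorm < halfScale p * η) : (restrictPath c z).seminorm < η := by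
  refine (seminorm_restrictPath_le c z).trans_lt ?_
  rwa [inv_mul_lt_iff₀ (halfScale_pos p)]

theorem isSolution_restrictPath {L : T.Extension V} {x₀ : V} {F : U →L[ℝ] LipMap V V m δ}
    {y : ControlledPath X U} {z : ControlledPath X V} (h : IsSolution L x₀ F y z)
    (c : Icc (0 : ℝ) (1 / 2)) :
    IsSolution L (z.path (subTime c 0)) F (restrictPath c y) (restrictPath c z) := by
  obtain ⟨-, h2, h3⟩ := (isSolution_iff_incrementsNear L x₀ F y z).1 h
  refine (isSolution_iff_incrementsNear L _ F _ _).2 ⟨rfl, ?_, fun t =>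
    (restrictPath_der_iff c F y z t).2 (h3 _)⟩
  rw [germ_restrictPath]
  exact h2.restrict c

end General

/-! ### Concatenation of solutions and global solvability -/

section Concatenation

variable {E E2 : Type*} [NormedAddCommGroup E] [NormedSpace ℝ E]
  [NormedAddCommGroup E2] [NormedSpace ℝ E2] {T : TensorSquare E E2} {p q : ℝ}
  {X : RoughPath T p} {U : Type*} {V : Type v} [NormedAddCommGroup U] [NormedSpace ℝ U]
  [NormedAddCommGroup V] [NormedSpace ℝ V] [CompleteSpace V]
  [hp : Fact (0 < p)] [hq : Fact (0 < q)]
  {L : T.Extension V} {n : ℕ}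

theorem isSolution_of_halves (hpq : p < q) (hq3 : q < 3) {x₀ : V}
    {F : U →L[ℝ] LipMap V V (n + 1) 1} {y : ControlledPath X U} {z : ControlledPath X V}
    (h1 : IsSolution L x₀ F (restrictPath firstHalf y) (restrictPath firstHalf z))
    (h2 : IsSolution L (z.path (subTime secondHalf 0)) F (restrictPath secondHalf y)
      (restrictPath secondHalf z)) : IsSolution L x₀ F y z := by
  obtain ⟨a0, a1, a2⟩ := (isSolution_iff_incrementsNear L _ F _ _).1 h1
  obtain ⟨-, b1, b2⟩ := (isSolution_iff_incrementsNear L _ F _ _).1 h2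
  rw [germ_restrictPath] at a1 b1
  rw [restrictPath_path, subTime_first_zero] at a0
  obtain ⟨K, hK⟩ := X.exists_bound
  refine (isSolution_iff_incrementsNear L _ F _ _).2 ⟨a0, ?_, fun t => ?_⟩
  · rw [germ_eq_intGerm L hpq] at a1 b1 ⊢
    exact a1.of_halves b1 (one_lt_three_div hq3) fun s u t hsu hut =>
      intGerm_defect L hK _ y hsu hut
  · rcases exists_subTime t with ⟨a, rfl⟩ | ⟨a, rfl⟩
    · exact (restrictPath_der_iff firstHalf F y z a).1 (a2 a)
    · exact (restrictPath_der_iff secondHalf F y z a).1 (b2 a)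

/-- The final value on the first half is the initial value on the second; this is why solvability
includes smoothness in x₀. Restriction divides seminorms by at least λ, so the threshold grows by λ,
both for y and for uniqueness. -/
theorem Solvable.of_halves (hpq : p < q) (hq3 : q < 3) {M η : ℝ}
    (h1 : Solvable (X.half firstHalf) U L n M η) (h2 : Solvable (X.half secondHalf) U L n M η) :
    Solvable X U L n M (halfScale p * η) := by
  obtain ⟨S₁, h1⟩ := h1
  obtain ⟨S₂, h2⟩ := h2
  set first : V × (U →L[ℝ] LipMap V V (n + 1) 1) × ControlledPath X U →
      ControlledPath (X.half firstHalf) V :=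
    fun a => S₁ (a.1, a.2.1, restrictL X U firstHalf a.2.2) with hfirst
  set second : V × (U →L[ℝ] LipMap V V (n + 1) 1) × ControlledPath X U →
      ControlledPath (X.half secondHalf) V :=
    fun a => S₂ (evalPath (X.half firstHalf) V 1 (first a), a.2.1,
      restrictL X U secondHalf a.2.2) with hsecond
  refine ⟨fun a => glue X V (first a, second a), fun x₀ F y hF hy => ?_⟩
  obtain ⟨s1, d1, u1⟩ := h1 x₀ F (restrictPath firstHalf y) hF
    (seminorm_restrictPath_lt firstHalf hy)
  obtain ⟨s2, d2, u2⟩ := h2 ((first (x₀, F, y)).path 1) F (restrictPath secondHalf y) hF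
    (seminorm_restrictPath_lt secondHalf hy)
  change IsSolution L x₀ F (restrictPath firstHalf y) (first (x₀, F, y)) at s1
  change ∀ z, _ → _ → z = first (x₀, F, y) at u1
  change IsSolution L _ F (restrictPath secondHalf y) (second (x₀, F, y)) at s2
  change ∀ z, _ → _ → z = second (x₀, F, y) at u2
  obtain ⟨-, -, e1⟩ := (isSolution_iff_incrementsNear L _ F _ _).1 s1
  obtain ⟨p2, -, e2⟩ := (isSolution_iff_incrementsNear L _ F _ _).1 s2
  -- Both derivatives are F(x) y' at the junction, so they match once the values do.
  have hder : (second (x₀, F, y)).der 0 = (first (x₀, F, y)).der 1 := by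
    rw [e1, e2, p2, restrictPath_der, restrictPath_der, subTime_first_one]
  have r1 := restrictPath_first_glue (first (x₀, F, y)) (second (x₀, F, y))
  have r2 := restrictPath_second_glue p2 hder
  refine ⟨?_, ?_, fun z hz hzη => ?_⟩
  · refine isSolution_of_halves hpq hq3 (by rwa [r1]) ?_
    rw [← restrictPath_path, r2, p2]
    exact s2
  · have l1 : ContDiff ℝ n (restrictL X U firstHalf) := ContinuousLinearMap.contDiff _
    have l2 : ContDiff ℝ n (restrictL X U secondHalf) := ContinuousLinearMap.contDiff _
    have l3 : ContDiff ℝ n (evalPath (X.half firstHalf) V 1) := ContinuousLinearMap.contDiff _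
    have l4 : ContDiff ℝ n (glue X V) := ContinuousLinearMap.contDiff _
    have c1 : ContDiffAt ℝ n first (x₀, F, y) := by
      refine ContDiffAt.comp (g := S₁)
        (f := fun a : V × (U →L[ℝ] LipMap V V (n + 1) 1) × ControlledPath X U =>
          (a.1, a.2.1, restrictL X U firstHalf a.2.2)) (x₀, F, y) d1 ?_
      exact (contDiff_fst.prodMk ((contDiff_fst.comp contDiff_snd).prodMk
        (l1.comp (contDiff_snd.comp contDiff_snd)))).contDiffAt
    have c2 : ContDiffAt ℝ n second (x₀, F, y) := by
      refine ContDiffAt.comp (g := S₂)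
        (f := fun a : V × (U →L[ℝ] LipMap V V (n + 1) 1) × ControlledPath X U =>
          (evalPath (X.half firstHalf) V 1 (first a), a.2.1, restrictL X U secondHalf a.2.2))
        (x₀, F, y) d2 ?_
      exact (l3.contDiffAt.comp (x₀, F, y) c1).prodMk
        (((contDiff_fst.comp contDiff_snd).prodMk
          (l2.comp (contDiff_snd.comp contDiff_snd))).contDiffAt)
    exact l4.contDiffAt.comp (x₀, F, y) (c1.prodMk c2)
  · obtain ⟨z0, -, -⟩ := (isSolution_iff_incrementsNear L _ F _ _).1 hz
    have g1 := u1 (restrictPath firstHalf z) (by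
      have := isSolution_restrictPath hz firstHalf
      rwa [subTime_first_zero, z0] at this) (seminorm_restrictPath_lt firstHalf hzη)
    have g2 := u2 (restrictPath secondHalf z) (by
      have := isSolution_restrictPath hz secondHalf
      rwa [← subTime_first_one, ← restrictPath_path, g1] at this)
        (seminorm_restrictPath_lt secondHalf hzη)
    exact ext_halves (g1.trans r1.symm) (g2.trans r2.symm)

/-- The equation can be solved for arbitrarily large data. -/
theorem exists_solvable_ge (hp2 : 2 ≤ p) (hpq : p < q) (hq3 : q < 3) (X : RoughPath T p)
    (U : Type*) [NormedAddCommGroup U] [NormedSpace ℝ U] (L : T.Extension V) (n : ℕ) {M : ℝ}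
    (hM : 0 < M) (r : ℝ) : ∃ η, r ≤ η ∧ Solvable X U L (n + 1) M η := by
  obtain ⟨K, hK⟩ := X.exists_bound
  obtain ⟨ε, hε, h⟩ := exists_solvable L U hp2 hpq hq3 (n := n) M K hM hK.nonneg
  -- The induction runs over all rough paths with bound K, since both halves keep that bound.
  have key : ∀ j : ℕ, ∀ X : RoughPath T p, X.Bound K →
      Solvable X U L (n + 1) M (halfScale p ^ j * ε) := by
    intro j
    induction j with
    | zero =>
      intro X hX
      rw [pow_zero, one_mul]
      exact h X hX
    | succ j ih =>
      intro X hX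
      rw [pow_succ', mul_assoc]
      exact Solvable.of_halves hpq hq3 (ih _ (hX.half _)) (ih _ (hX.half _))
  obtain ⟨j, hj⟩ := pow_unbounded_of_one_lt (r / ε) (one_lt_halfScale hp.out)
  exact ⟨_, ((div_lt_iff₀ hε).1 hj).le, key j X hK⟩

/-- The equation driven by one-forms in `L(U, Lip_{n+3})` has exactly one solution, and it is of
class `C^{n+1}` in the data. -/
theorem exists_solutionMap (hp2 : 2 ≤ p) (hpq : p < q) (hq3 : q < 3) (X : RoughPath T p)
    (U : Type*) [NormedAddCommGroup U] [NormedSpace ℝ U] (L : T.Extension V) (n : ℕ) (x₀ : V) :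
    ∃ I : (U →L[ℝ] LipMap V V (n + 1 + 1) 1) × ControlledPath X U → ControlledPath X V,
      (∀ F y z, IsSolution L x₀ F y z ↔ z = I (F, y)) ∧
      ContDiff ℝ ((n + 1 : ℕ) : WithTop ℕ∞) I := by
  have hpos : ∀ F : U →L[ℝ] LipMap V V (n + 1 + 1) 1, 0 < ‖F‖ + 1 := fun F => by positivity
  have hex : ∀ a : (U →L[ℝ] LipMap V V (n + 1 + 1) 1) × ControlledPath X U,
      ∃ z, IsSolution L x₀ a.1 a.2 z ∧ ∀ w, IsSolution L x₀ a.1 a.2 w → w = z := by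
    intro a
    obtain ⟨η₀, h0, S₀, hS₀⟩ :=
      exists_solvable_ge hp2 hpq hq3 X U L n (hpos a.1) (a.2.seminorm + 1)
    obtain ⟨hz, -, -⟩ := hS₀ x₀ a.1 a.2 (lt_add_one _) (by linarith)
    refine ⟨_, hz, fun w hw => ?_⟩
    -- A threshold above the seminorms of y and of both solutions: there uniqueness identifies them.
    obtain ⟨η, h1, S, hS⟩ := exists_solvable_ge hp2 hpq hq3 X U L n (hpos a.1)
      (a.2.seminorm + w.seminorm + (S₀ (x₀, a.1, a.2)).seminorm + 1)
    have n1 := a.2.seminorm_nonneg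
    have n2 := w.seminorm_nonneg
    have n3 := (S₀ (x₀, a.1, a.2)).seminorm_nonneg
    obtain ⟨-, -, hu⟩ := hS x₀ a.1 a.2 (lt_add_one _) (by linarith)
    rw [hu _ hw (by linarith), hu _ hz (by linarith)]
  choose I hI hu using hex
  refine ⟨I, fun F y z => ⟨hu (F, y) z, fun h => h ▸ hI (F, y)⟩, contDiff_iff_contDiffAt.2 ?_⟩
  rintro ⟨F, y⟩
  -- One smooth family of solutions covers all data near (F, y), and uniqueness equates it with I
  -- there.
  obtain ⟨η, h0, S, hS⟩ := exists_solvable_ge hp2 hpq hq3 X U L n (hpos F) (y.seminorm + 1)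
  have hF : ‖F‖ < ‖F‖ + 1 := lt_add_one _
  have hy : y.seminorm < η := by linarith
  have hcomp : ContDiffAt ℝ ((n + 1 : ℕ) : WithTop ℕ∞)
      (fun a : (U →L[ℝ] LipMap V V (n + 1 + 1) 1) × ControlledPath X U => S (x₀, a)) (F, y) :=
    ContDiffAt.comp (g := S) (F, y) (hS x₀ F y hF hy).2.1
      (contDiff_const.prodMk contDiff_id).contDiffAt
  refine hcomp.congr_of_eventuallyEq ?_
  have e1 : ∀ᶠ a : (U →L[ℝ] LipMap V V (n + 1 + 1) 1) × ControlledPath X U in nhds (F, y),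
      ‖a.1‖ < ‖F‖ + 1 :=
    (continuous_norm.comp continuous_fst).continuousAt.eventually_lt continuousAt_const hF
  have e2 : ∀ᶠ a : (U →L[ℝ] LipMap V V (n + 1 + 1) 1) × ControlledPath X U in nhds (F, y),
      a.2.seminorm < η :=
    (continuous_seminorm.comp continuous_snd).continuousAt.eventually_lt continuousAt_const hy
  filter_upwards [e1, e2] with a h1 h2
  exact (hu a _ (hS x₀ a.1 a.2 h1 h2).1).symm

end Concatenation

/-! ### Reduction to a Lipschitz top derivative, and the theorem -/

section Lower

variable {E E2 : Type*} [NormedAddCommGroup E] [NormedSpace ℝ E]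
  [NormedAddCommGroup E2] [NormedSpace ℝ E2] {T : TensorSquare E E2} {p : ℝ}
  {X : RoughPath T p} {U V : Type*} [NormedAddCommGroup U] [NormedSpace ℝ U]
  [NormedAddCommGroup V] [NormedSpace ℝ V]

/-- Lowering keeps the underlying functions, and the notion of solution sees nothing else. -/
theorem isSolution_lower (L : T.Extension V) {m : ℕ} {δ : ℝ} (x₀ : V)
    (F : U →L[ℝ] LipMap V V (m + 1) δ) (y : ControlledPath X U) (z : ControlledPath X V) :
    IsSolution L x₀ ((LipMap.lowerL V V m δ).comp F) y z ↔ IsSolution L x₀ F y z :=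
  Iff.rfl

end Lower

end ControlledPath

end ItoLyons

end

theorem theorem1 {E E2 U V : Type*}
    [NormedAddCommGroup E] [NormedSpace ℝ E] [CompleteSpace E]
    [NormedAddCommGroup E2] [NormedSpace ℝ E2] [CompleteSpace E2]
    [NormedAddCommGroup U] [NormedSpace ℝ U] [CompleteSpace U]
    [NormedAddCommGroup V] [NormedSpace ℝ V] [CompleteSpace V]
    (T : ItoLyons.TensorSquare E E2) (L : T.Extension V)
    (p : ℝ) (hp2 : 2 ≤ p) (hp3 : p < 3) (X : ItoLyons.RoughPath T p)
    (k : ℝ) (hk : 3 ≤ k) (m : ℕ) (δ : ℝ) (hδ0 : 0 ≤ δ) (hδ1 : δ ≤ 1) (hkm : k = m + δ)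
    (x₀ : V) :
    ∃ I : (U →L[ℝ] ItoLyons.LipMap V V m δ) × ItoLyons.ControlledPath X U →
        ItoLyons.ControlledPath.startingAt X x₀,
      (∀ (F : U →L[ℝ] ItoLyons.LipMap V V m δ) (y : ItoLyons.ControlledPath X U)
        (x : ItoLyons.ControlledPath X V),
        ItoLyons.IsSolution L x₀ F y x ↔ x = (I (F, y) : ItoLyons.ControlledPath X V)) ∧
      ContDiff ℝ ((⌊k⌋₊ - 2 : ℕ) : WithTop ℕ∞)
        (fun q => (I q : ItoLyons.ControlledPath X V)) := by
  have : Fact (0 < p) := ⟨by linarith⟩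
  -- The auxiliary roughness q is the midpoint of p and 3.
  have : Fact (0 < (p + 3) / 2) := ⟨by linarith⟩
  suffices H : ∃ I : (U →L[ℝ] ItoLyons.LipMap V V m δ) × ItoLyons.ControlledPath X U →
      ItoLyons.ControlledPath X V,
      (∀ F y z, ItoLyons.IsSolution L x₀ F y z ↔ z = I (F, y)) ∧
      ContDiff ℝ ((⌊k⌋₊ - 2 : ℕ) : WithTop ℕ∞) I by
    obtain ⟨I, h1, h2⟩ := H
    exact ⟨fun a => ⟨I a, ((ItoLyons.ControlledPath.isSolution_iff_incrementsNear L x₀ a.1 a.2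
      (I a)).1 ((h1 a.1 a.2 (I a)).2 rfl)).1⟩, h1, h2⟩
  have hn : 3 ≤ ⌊k⌋₊ := Nat.le_floor (by exact_mod_cast hk)
  obtain ⟨n, hn⟩ := Nat.exists_eq_add_of_le' hn
  obtain ⟨I, h1, h2⟩ := ItoLyons.ControlledPath.exists_solutionMap hp2
    (by linarith : p < (p + 3) / 2) (by linarith) X U L n x₀
  have hfloor : ⌊k⌋₊ - 2 = n + 1 := by omega
  rw [hfloor]
  -- For δ = 1 the integer part of k is m + 1, and the top derivative is already Lipschitz. For δ <
  -- 1 it is m, and one derivative is traded for the Lipschitz property of the preceding one; this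
  -- includes integer k with δ = 0.
  rcases hδ1.eq_or_lt with rfl | hlt
  · have hm : m = n + 1 + 1 := by
      have : ⌊k⌋₊ = m + 1 := by
        rw [hkm]
        exact_mod_cast Nat.floor_natCast (R := ℝ) (m + 1)
      omega
    subst hm
    exact ⟨I, h1, h2⟩
  · have hm : m = n + 1 + 1 + 1 := by
      have : ⌊k⌋₊ = m := by
        rw [hkm, Nat.floor_eq_iff (by positivity)]
        constructor <;> linarith
      omega
    subst hm
    refine ⟨fun a => I ((ItoLyons.LipMap.lowerL V V (n + 1 + 1) δ).comp a.1, a.2),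
      fun F y z => ?_, ?_⟩
    · rw [← h1]
      exact (ItoLyons.ControlledPath.isSolution_lower L x₀ F y z).symm
    · have hl : ContDiff ℝ ((n + 1 : ℕ) : WithTop ℕ∞) (ContinuousLinearMap.compL ℝ U _ _
        (ItoLyons.LipMap.lowerL V V (n + 1 + 1) δ)) := ContinuousLinearMap.contDiff _
      exact h2.comp ((hl.comp contDiff_fst).prodMk contDiff_snd)
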